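/- Let $s\in\mathbb{N}$, $s\ge 1$, $k_F>0$, and write $\mathbb{Z}^3_*=\mathbb{Z}^3\setminus\{0\}$. Let $\hat V_k\in\mathbb{R}$ satisfy $\hat V_{-k}=\hat V_k$ and $\hat V_k\ge 0$ for $k\in\mathbb{Z}^3_*$, and $\sum_{k\in\mathbb{Z}^3_*}\hat V_k^2<\infty$. Let $B_F=\{p\in\mathbb{Z}^3: |p|\le k_F\}$, and for $k\in\mathbb{Z}^3_*$ let $$L_k=\{p\in\mathbb{Z}^3: |p-k|\le k_F<|p|\},\qquad \lambda_{k,p}=\tfrac12\left(|p|^2-|p-k|^2\right)\quad(p\in L_k).$$ On the real space $\ell^2(L_k)$ with standard basis $(e_p)_{p\in L_k}$ define $h_ke_p=\lambda_{k,p}e_p$, $P_k=\langle v_k,\cdot\rangle v_k$ with $v_k=\sqrt{\frac{s\hat V_kk_F^{-1}}{2(2\pi)^3}}\sum_{p\in L_k}e_p$, $$K_k=-\tfrac12\log\left(h_k^{-1/2}\left(h_k^{1/2}(h_k+2P_k)h_k^{1/2}\right)^{1/2}h_k^{-1/2}\right),$$ $$B_k(t)=\tfrac12\left(e^{tK_k}(h_k+2P_k)e^{tK_k}-e^{-tK_k}h_ke^{-tK_k}\right),\quad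 t\in[0,1].$$ Let $c_{p,\sigma}^*,c_{p,\sigma}$ ($p\in\mathbb{Z}^3$, $1\le\sigma\le s$) be the fermionic creation and annihilation operators of the plane wave states $u_{p,\sigma}$ of $L^2(\mathbb{T}^3;\mathbb{C}^s)$, where $\mathbb{T}^3$ has side length $2\pi$, let $\psi_F=\bigwedge_{p\in B_F,\,1\le\sigma\le s}u_{p,\sigma}$ be the Fermi state, and set $$b_{k,p}=\frac1{\sqrt s}\sum_{\sigma=1}^s c_{p-k,\sigma}^*c_{p,\sigma},\qquad b_k(\varphi)=\sum_{p\in L_k}\langle\varphi,e_p\rangle b_{k,p},\qquad b_k^*(\varphi)=b_k(\varphi)^*,$$ $$\varepsilon_{k,l}(e_p;e_q)=-\frac1s\sum_{\sigma=1}^s\left(\delta_{p,q}c_{q-l,\sigma}c_{p-k,\sigma}^*+\delta_{p-k,q-l}c_{q,\sigma}^*c_{p,\sigma}\right).$$ With $\{X,Y\}=XY+YX$ and $2\,\mathrm{Re}(X)=X+X^*$, put for an operator $B$ on $\ell^2(L_k)$ $$\mathcal E_k^2(B)=\frac12\sum_{l\in\mathbb{Z}^3_*}\sum_{p\in L_k}\sum_{q\in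 L_l}\left\{b_k(Be_p),\left\{\varepsilon_{-k,-l}(e_{-p};e_{-q}),b_l^*(K_le_q)\right\}\right\},$$ the sum over $l$ being understood strongly. Finally let $$E_{\mathrm{corr},\mathrm{ex}}=\frac{sk_F^{-2}}{4(2\pi)^6}\sum_{k,l\in\mathbb{Z}^3_*}\hat V_k\hat V_l\sum_{p,q\in L_k\cap L_l}\frac{\delta_{p+q,k+l}}{\lambda_{k,p}+\lambda_{k,q}}.$$ Then there is a constant $C>0$, depending only on $s$ and on the value of $\sum_{k\in\mathbb{Z}^3_*}\hat V_k^2$, such that for all $k_F\ge 1$ the sum over $l$ in $\mathcal E_k^2(B_k(t))\psi_F$, the integrals and sums below and the sum defining $E_{\mathrm{corr},\mathrm{ex}}$ all converge (absolutely, resp. unconditionally), and $$\left|\sum_{k\in\mathbb{Z}^3_*}\int_0^1\left\langle\psi_F,2\,\mathrm{Re}\left(\mathcal E_k^2(B_k(t))\right)\psi_F\right\rangle dt-E_{\mathrm{corr},\mathrm{ex}}\right|\le C\sqrt{\sum_{k\in\mathbb{Z}^3_*}\hat V_k^2\min\{|k|,k_F\}}.$$ -/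

import Mathlib

namespace FermiGas

noncomputable section

/-! ### Momenta, Fermi ball, lunes -/

/-- The momentum lattice `ℤ³`. -/
abbrev Mom : Type := Fin 3 → ℤ

/-- The nonzero momenta `ℤ³ \ {0}`. -/
abbrev MomStar : Type := {k : Mom // k ≠ 0}

/-- The squared Euclidean length `|p|²`. -/
def sqLen (p : Mom) : ℝ := ∑ i, (p i : ℝ) ^ 2

/-- The Euclidean length `|p|`. -/
def len (p : Mom) : ℝ := Real.sqrt (sqLen p)

theorem finite_ball (r : ℝ) (k : Mom) : {p : Mom | len (p - k) ≤ r}.Finite := by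
  refine (Set.Finite.pi' (t := fun i => Set.Icc (k i - ⌈r⌉) (k i + ⌈r⌉))
    (fun i => Set.finite_Icc _ _)).subset ?_
  intro p hp i
  have h1 : ((p - k) i : ℝ) ^ 2 ≤ sqLen (p - k) :=
    Finset.single_le_sum (f := fun j => (((p - k) j : ℤ) : ℝ) ^ 2)
      (fun j _ => sq_nonneg _) (Finset.mem_univ i)
  have h2 : |((p - k) i : ℝ)| ≤ r := (Real.abs_le_sqrt h1).trans hp
  have h3 : |((p - k) i : ℝ)| ≤ (⌈r⌉ : ℝ) := h2.trans (Int.le_ceil r)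
  have h4 : |(p - k) i| ≤ ⌈r⌉ := by exact_mod_cast h3
  rw [Pi.sub_apply, abs_le] at h4
  exact ⟨by linarith [h4.1], by linarith [h4.2]⟩

/-- The closed Fermi ball `B_F = {p ∈ ℤ³ : |p| ≤ k_F}`. -/
def fermiBall (kF : ℝ) : Finset Mom :=
  Set.Finite.toFinset (s := {p : Mom | len p ≤ kF})
    (by simpa using finite_ball kF 0)

/-- The lune `L_k = {p ∈ ℤ³ : |p - k| ≤ k_F < |p|}`. -/
def lune (kF : ℝ) (k : Mom) : Finset Mom :=
  Set.Finite.toFinset (s := {p : Mom | len (p - k) ≤ kF ∧ kF < len p})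
    ((finite_ball kF k).subset fun _ hp => hp.1)

/-- `λ_{k,p} = (|p|² - |p - k|²) / 2`. -/
def lam (k p : Mom) : ℝ := (sqLen p - sqLen (p - k)) / 2

/-! ### The fermionic Fock space over `L²(𝕋³; ℂˢ)`, in the occupation number representation

The plane waves `u_{p,σ}(x) = (2π)^{-3/2} e^{ip·x} v_σ` form an orthonormal basis of the one-particle
space, so that their wedge products `⋀_{(p,σ) ∈ S} u_{p,σ}`, `S` a finite set of modes, form an
orthonormal basis of the Fock space, which is thereby `ℓ²` of the finite sets of modes. The
factors of a wedge product are ordered along a fixed enumeration of the modes. -/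

/-- The one-particle modes `(p, σ)`. -/
abbrev Mode (s : ℕ) : Type := Mom × Fin s

/-- The fermionic Fock space, with its orthonormal basis of Slater states. -/
abbrev Fock (s : ℕ) : Type := lp (fun _ : Finset (Mode s) => ℂ) 2

/-- The sign `(-1)^j`, where `j` is the number of elements of `S` that precede `m`. -/
def modeSign {s : ℕ} (S : Finset (Mode s)) (m : Mode s) : ℂ :=
  (-1) ^ (S.filter fun n => Encodable.encode n < Encodable.encode m).card

theorem norm_modeSign {s : ℕ} (S : Finset (Mode s)) (m : Mode s) : ‖modeSign S m‖ = 1 := by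
  simp [modeSign]

/-- The coordinates of `c_m Ψ`: those of the linear map that takes the Slater state of `S ∪ {m}`,
`m ∉ S`, to `modeSign S m` times that of `S`, and that of a set without `m` to `0`. -/
def annFun {s : ℕ} (m : Mode s) (Ψ : Finset (Mode s) → ℂ) (S : Finset (Mode s)) : ℂ :=
  if m ∈ S then 0 else modeSign S m * Ψ (insert m S)

theorem sum_annFun_le {s : ℕ} (m : Mode s) (Ψ : Fock s) (A : Finset (Finset (Mode s))) :
    ∑ S ∈ A, ‖annFun m Ψ S‖ ^ (2 : ENNReal).toReal ≤ ‖Ψ‖ ^ (2 : ENNReal).toReal := by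
  have h1 : ∑ S ∈ A, ‖annFun m Ψ S‖ ^ (2 : ENNReal).toReal
      = ∑ S ∈ A.filter (fun S => m ∉ S), ‖Ψ (insert m S)‖ ^ (2 : ENNReal).toReal := by
    rw [Finset.sum_filter]
    refine Finset.sum_congr rfl fun S _ => ?_
    by_cases h : m ∈ S <;> simp [annFun, h, norm_modeSign]
  have h2 : Set.InjOn (fun S : Finset (Mode s) => insert m S)
      (A.filter (fun S => m ∉ S) : Finset (Finset (Mode s))) := by
    intro S hS T hT h
    have hS' : m ∉ S := (Finset.mem_filter.mp hS).2
    have hT' : m ∉ T := (Finset.mem_filter.mp hT).2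
    rw [← Finset.erase_insert hS', ← Finset.erase_insert hT']
    exact congrArg (fun U => Finset.erase U m) h
  rw [h1, ← Finset.sum_image (f := fun T => ‖Ψ T‖ ^ (2 : ENNReal).toReal) h2]
  exact lp.sum_rpow_le_norm_rpow (by simp) Ψ _

/-- The annihilation operator `c_m = c_{p,σ}` of the plane wave state `u_{p,σ}`, `m = (p, σ)`. -/
def ann {s : ℕ} (m : Mode s) : Fock s →L[ℂ] Fock s :=
  LinearMap.mkContinuous
    { toFun := fun Ψ => ⟨annFun m Ψ, memℓp_gen' (sum_annFun_le m Ψ)⟩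
      map_add' := by
        intro Φ Ψ
        ext S
        change annFun m (⇑Φ + ⇑Ψ) S = annFun m Φ S + annFun m Ψ S
        by_cases h : m ∈ S <;> simp [annFun, h, mul_add]
      map_smul' := by
        intro a Ψ
        ext S
        by_cases h : m ∈ S <;> simp [annFun, h, mul_left_comm] }
    1 (fun Ψ => by
      rw [one_mul]
      exact lp.norm_le_of_forall_sum_le (by simp) (norm_nonneg _) (sum_annFun_le m Ψ))

/-- The creation operator `c_m^*`, the adjoint of `c_m`. -/
def cre {s : ℕ} (m : Mode s) : Fock s →L[ℂ] Fock s := star (ann m)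

/-- The Fermi state `ψ_F = ⋀_{p ∈ B_F, σ} u_{p,σ}`. -/
def fermiState (s : ℕ) (kF : ℝ) : Fock s :=
  lp.single 2 (fermiBall kF ×ˢ (Finset.univ : Finset (Fin s))) 1

/-- The anticommutator `{X, Y} = X Y + Y X`. -/
def anticomm {s : ℕ} (X Y : Fock s →L[ℂ] Fock s) : Fock s →L[ℂ] Fock s := X * Y + Y * X

/-! ### Excitation operators -/

/-- `b_{k,p} = s^{-1/2} ∑_σ c_{p-k,σ}^* c_{p,σ}`. -/
def excAnn (s : ℕ) (k p : Mom) : Fock s →L[ℂ] Fock s :=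
  ((Real.sqrt s)⁻¹ : ℂ) • ∑ σ : Fin s, cre (p - k, σ) * ann (p, σ)

/-- `b_{k,p}^* = s^{-1/2} ∑_σ c_{p,σ}^* c_{p-k,σ}`. -/
def excCre (s : ℕ) (k p : Mom) : Fock s →L[ℂ] Fock s :=
  ((Real.sqrt s)⁻¹ : ℂ) • ∑ σ : Fin s, cre (p, σ) * ann (p - k, σ)

/-- `b_k(φ) = ∑_{p ∈ L_k} ⟨φ, e_p⟩ b_{k,p}` for `φ` in the real space `ℓ²(L_k)`. -/
def genAnn (s : ℕ) (kF : ℝ) (k : Mom) (φ : lune kF k → ℝ) : Fock s →L[ℂ] Fock s :=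
  ∑ p : lune kF k, (φ p : ℂ) • excAnn s k p

/-- `b_k^*(φ) = ∑_{p ∈ L_k} ⟨e_p, φ⟩ b_{k,p}^*` for `φ` in the real space `ℓ²(L_k)`. -/
def genCre (s : ℕ) (kF : ℝ) (k : Mom) (φ : lune kF k → ℝ) : Fock s →L[ℂ] Fock s :=
  ∑ p : lune kF k, (φ p : ℂ) • excCre s k p

/-- The exchange correction `ε_{k,l}(e_p; e_q)
= -s⁻¹ ∑_σ (δ_{p,q} c_{q-l,σ} c_{p-k,σ}^* + δ_{p-k,q-l} c_{q,σ}^* c_{p,σ})`. -/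
def exchCorr (s : ℕ) (k l p q : Mom) : Fock s →L[ℂ] Fock s :=
  -((s : ℂ)⁻¹ • ∑ σ : Fin s,
    ((if p = q then ann (q - l, σ) * cre (p - k, σ) else 0) +
      (if p - k = q - l then cre (q, σ) * ann (p, σ) else 0)))

/-! ### One-body operators on `ℓ²(L_k)`

Operators on the real space `ℓ²(L_k)` are given by their matrices in the standard basis
`(e_p)_{p ∈ L_k}`; functions of symmetric matrices are taken by the functional calculus. -/

/-- Matrices of operators on `ℓ²(L_k)`, `M p q = ⟨e_p, M e_q⟩`. -/
abbrev LuneMat (kF : ℝ) (k : Mom) : Type := Matrix (lune kF k) (lune kF k) ℝ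

/-- `h_k e_p = λ_{k,p} e_p`. -/
def hOp (kF : ℝ) (k : Mom) : LuneMat kF k := Matrix.diagonal fun p => lam k p

/-- `v_k = √(s V̂_k k_F⁻¹ / (2 (2π)³)) ∑_{p ∈ L_k} e_p`. -/
def vVec (s : ℕ) (V : Mom → ℝ) (kF : ℝ) (k : Mom) : lune kF k → ℝ :=
  fun _ => Real.sqrt (s * V k * kF⁻¹ / (2 * (2 * Real.pi) ^ 3))

/-- `P_k = ⟨v_k, ·⟩ v_k`. -/
def POp (s : ℕ) (V : Mom → ℝ) (kF : ℝ) (k : Mom) : LuneMat kF k :=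
  Matrix.vecMulVec (vVec s V kF k) (vVec s V kF k)

/-- The square root of a positive semidefinite matrix. -/
def matSqrt {kF : ℝ} {k : Mom} (M : LuneMat kF k) : LuneMat kF k := cfc Real.sqrt M

/-- The logarithm of a positive definite matrix. -/
def matLog {kF : ℝ} {k : Mom} (M : LuneMat kF k) : LuneMat kF k := cfc Real.log M

/-- `K_k = -½ log (h_k^{-1/2} (h_k^{1/2} (h_k + 2 P_k) h_k^{1/2})^{1/2} h_k^{-1/2})`. -/
def KOp (s : ℕ) (V : Mom → ℝ) (kF : ℝ) (k : Mom) : LuneMat kF k :=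
  -((1 / 2 : ℝ) • matLog ((matSqrt (hOp kF k))⁻¹ *
    matSqrt (matSqrt (hOp kF k) * (hOp kF k + (2 : ℝ) • POp s V kF k) * matSqrt (hOp kF k)) *
    (matSqrt (hOp kF k))⁻¹))

/-- `B_k(t) = ½ (e^{t K_k} (h_k + 2 P_k) e^{t K_k} - e^{-t K_k} h_k e^{-t K_k})`. -/
def BOp (s : ℕ) (V : Mom → ℝ) (kF : ℝ) (k : Mom) (t : ℝ) : LuneMat kF k :=
  (1 / 2 : ℝ) •
    (NormedSpace.exp (t • KOp s V kF k) * (hOp kF k + (2 : ℝ) • POp s V kF k) *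
        NormedSpace.exp (t • KOp s V kF k) -
      NormedSpace.exp (-(t • KOp s V kF k)) * hOp kF k * NormedSpace.exp (-(t • KOp s V kF k)))

/-! ### The exchange operator -/

/-- The `l`-th term `½ ∑_{p ∈ L_k} ∑_{q ∈ L_l}
{b_k(B e_p), {ε_{-k,-l}(e_{-p}; e_{-q}), b_l^*(K_l e_q)}}` of `ℰ²_k(B)`. -/
def exch2Term (s : ℕ) (V : Mom → ℝ) (kF : ℝ) (k : Mom) (B : LuneMat kF k) (l : Mom) :
    Fock s →L[ℂ] Fock s :=
  (1 / 2 : ℂ) • ∑ p : lune kF k, ∑ q : lune kF l,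
    anticomm (genAnn s kF k (B.col p))
      (anticomm (exchCorr s (-k) (-l) (-p) (-q)) (genCre s kF l ((KOp s V kF l).col q)))

/-- `ℰ²_k(B)`, the strong sum of its terms over `l ∈ ℤ³ \ {0}`. -/
def exch2 (s : ℕ) (V : Mom → ℝ) (kF : ℝ) (k : Mom) (B : LuneMat kF k) (Ψ : Fock s) : Fock s :=
  ∑' l : MomStar, exch2Term s V kF k B l Ψ

/-- `⟨ψ_F, 2 Re(ℰ²_k(B)) ψ_F⟩ = ⟨ψ_F, ℰ²_k(B) ψ_F⟩ + ⟨ℰ²_k(B) ψ_F, ψ_F⟩`, where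
`2 Re(X) = X + X^*`. -/
def fermiExch2 (s : ℕ) (V : Mom → ℝ) (kF : ℝ) (k : Mom) (B : LuneMat kF k) : ℝ :=
  2 * (inner ℂ (fermiState s kF) (exch2 s V kF k B (fermiState s kF))).re

/-! ### The Gell-Mann–Brueckner exchange contribution -/

/-- `V̂_k V̂_l ∑_{p,q ∈ L_k ∩ L_l} δ_{p+q,k+l} / (λ_{k,p} + λ_{k,q})`. -/
def exchSummand (V : Mom → ℝ) (kF : ℝ) (k l : Mom) : ℝ :=
  V k * V l * ∑ p ∈ lune kF k ∩ lune kF l, ∑ q ∈ lune kF k ∩ lune kF l,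
    if p + q = k + l then 1 / (lam k p + lam k q) else 0

/-- `E_{corr,ex} = s k_F⁻² / (4 (2π)⁶) ∑_{k,l ∈ ℤ³ \ {0}} V̂_k V̂_l
∑_{p,q ∈ L_k ∩ L_l} δ_{p+q,k+l} / (λ_{k,p} + λ_{k,q})`. -/
def exchangeEnergy (s : ℕ) (V : Mom → ℝ) (kF : ℝ) : ℝ :=
  s * (kF ^ 2)⁻¹ / (4 * (2 * Real.pi) ^ 6) *
    ∑' kl : MomStar × MomStar, exchSummand V kF kl.1 kl.2

end

end FermiGas

/-! Both `b_k(φ)` and `ε_{-k,-l}(e_{-p}; e_{-q})`, `p ∈ L_k`, annihilate `ψ_F`, so of the four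
orderings in the double anticommutator only `b ε b^*` contributes. The states `c_m^* c_h ψ_F` (`m`
outside, `h` inside the Fermi ball) are orthonormal, and `ε` turns an excitation of momentum `l`
into one of momentum `k`. The expectation is therefore explicit: minus `s⁻¹` times a sum over `p, q
∈ L_k` of `B(q,p)` against `δ_{p+q,k+l} K_l(q,p) + δ_{p+q,k-l} K_l(-p,-q)` (`fermiExch2_hasSum`).
Reflecting `l` gives the second part the shape of the first.

With `g_k = s V̂_k k_F⁻¹ / (2 (2π)³)`, to leading order `∫₀¹ B_k(t) dt` has all entries `g_k / 2`,
and `-K_l` has entries `g_l / (λ_{l,p} + λ_{l,q})`. Since `λ_{l,p} + λ_{l,q} = λ_{k,p} + λ_{k,q}`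
when `p + q = k + l`, each of the two parts yields half of the exchange energy.

The relative errors are `O(⟨v, h⁻¹ v⟩)`, entry by entry (`logKernelBounds`, `KOp_bounds`,
`BOp_bound`). This rests on positivity of entries. Write `K = -½ L`, `L = log E`, where `E` is the
positive solution of `E h E = h + 2 v vᵀ`. The off-diagonal entries of `E⁻¹` are nonpositive, so `W
= 1 - E⁻¹` has nonnegative entries, and so have `L = ∑ Wⁿ/n` and `X = E - 1 = e^L - 1`. The
quadratic equation `X h + h X + X h X = 2 v vᵀ` then bounds `X` from above, and `X - X² ≤ L ≤ X`
passes the information to `L`. Similarly `e^{aL} h e^{aL} - h - a(hL + Lh)` is nonnegative and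
increasing in `a`, so its value at `a = 1` controls `B_k(t)`.

The lattice estimate `∑_{p ∈ L_k} λ_{k,p}⁻¹ ≤ C k_F` (`sum_inv_lam_le`) gives `⟨v_k, h_k⁻¹ v_k⟩ ≤ C
V̂_k`. There remains `k_F⁻² ∑ V̂_k² V̂_l w(k,l)`, where `w(k,l)` is the sum of `1/(λ_{k,p} +
λ_{k,q})` over exchange pairs. Cauchy–Schwarz in `l`, the count `|L_l| ≤ C k_F² min(|l|, k_F)`, and
disjointness of the pair sets for different `l` bound the sum over `l` by `C k_F² (∑_l V̂_l²
min(|l|, k_F))^{1/2}` for each `k` (`sum_mul_exchWeight_le`). The sum over `k` of `V̂_k²` is the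
given constant. -/

namespace FermiGas

set_option linter.unusedSectionVars false

/-! ### Entrywise nonnegative matrices and spectral calculus -/

section Entrywise

variable {ι : Type*} [Fintype ι] [DecidableEq ι]

/-- All entries of the matrix are nonnegative. -/
def EntryNonneg (A : Matrix ι ι ℝ) : Prop := ∀ i j, 0 ≤ A i j

theorem EntryNonneg.add {A B : Matrix ι ι ℝ} (hA : EntryNonneg A) (hB : EntryNonneg B) :
    EntryNonneg (A + B) := fun i j => add_nonneg (hA i j) (hB i j)

theorem EntryNonneg.mul {A B : Matrix ι ι ℝ} (hA : EntryNonneg A) (hB : EntryNonneg B) :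
    EntryNonneg (A * B) := fun i j => by
  rw [Matrix.mul_apply]
  exact Finset.sum_nonneg fun k _ => mul_nonneg (hA i k) (hB k j)

theorem EntryNonneg.one : EntryNonneg (1 : Matrix ι ι ℝ) := fun i j => by
  rw [Matrix.one_apply]; split_ifs <;> norm_num

theorem EntryNonneg.pow {A : Matrix ι ι ℝ} (hA : EntryNonneg A) (n : ℕ) :
    EntryNonneg (A ^ n) := by
  induction n with
  | zero => simpa using EntryNonneg.one
  | succ n ih => rw [pow_succ]; exact ih.mul hA

theorem EntryNonneg.diagonal {d : ι → ℝ} (hd : ∀ i, 0 ≤ d i) :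
    EntryNonneg (Matrix.diagonal d) := fun i j => by
  rw [Matrix.diagonal_apply]; split_ifs
  · exact hd i
  · exact le_rfl

theorem EntryNonneg.smul {A : Matrix ι ι ℝ} (hA : EntryNonneg A) {c : ℝ} (hc : 0 ≤ c) :
    EntryNonneg (c • A) := fun i j => mul_nonneg hc (hA i j)

/-- The symmetric matrix with eigenvalues `d` and eigenvectors the columns of `U`. -/
def diagConj (U : Matrix ι ι ℝ) (d : ι → ℝ) : Matrix ι ι ℝ :=
  U * Matrix.diagonal d * U.transpose

theorem diagConj_apply (U : Matrix ι ι ℝ) (d : ι → ℝ) (p q : ι) :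
    diagConj U d p q = ∑ i, U p i * d i * U q i := by
  simp [diagConj, Matrix.mul_apply, Matrix.diagonal_apply]

theorem diagConj_add (U : Matrix ι ι ℝ) (d e : ι → ℝ) :
    diagConj U d + diagConj U e = diagConj U (fun i => d i + e i) := by
  ext p q
  simp only [Matrix.add_apply, diagConj_apply, ← Finset.sum_add_distrib]
  exact Finset.sum_congr rfl fun i _ => by ring

theorem diagConj_smul (U : Matrix ι ι ℝ) (c : ℝ) (d : ι → ℝ) :
    c • diagConj U d = diagConj U (fun i => c * d i) := by
  ext p q
  simp only [Matrix.smul_apply, diagConj_apply, smul_eq_mul, Finset.mul_sum]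
  exact Finset.sum_congr rfl fun i _ => by ring

theorem diagConj_mul {U : Matrix ι ι ℝ} (hU : U.transpose * U = 1) (d e : ι → ℝ) :
    diagConj U d * diagConj U e = diagConj U (fun i => d i * e i) := by
  unfold diagConj
  calc U * Matrix.diagonal d * U.transpose * (U * Matrix.diagonal e * U.transpose)
      = U * Matrix.diagonal d * (U.transpose * U) * Matrix.diagonal e * U.transpose := by
        simp only [Matrix.mul_assoc]
    _ = _ := by rw [hU, Matrix.mul_one, Matrix.mul_assoc U, Matrix.diagonal_mul_diagonal]

theorem diagConj_one {U : Matrix ι ι ℝ} (hU' : U * U.transpose = 1) :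
    diagConj U (fun _ => 1) = 1 := by
  unfold diagConj
  rw [show (Matrix.diagonal fun _ : ι => (1 : ℝ)) = 1 from Matrix.diagonal_one, Matrix.mul_one, hU']

theorem diagConj_pow {U : Matrix ι ι ℝ} (hU : U.transpose * U = 1) (hU' : U * U.transpose = 1)
    (d : ι → ℝ) (n : ℕ) : diagConj U d ^ n = diagConj U (fun i => d i ^ n) := by
  induction n with
  | zero => simp [diagConj_one hU']
  | succ n ih => rw [pow_succ, ih, diagConj_mul hU]; simp only [pow_succ]

theorem diagConj_transpose (U : Matrix ι ι ℝ) (d : ι → ℝ) :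
    (diagConj U d).transpose = diagConj U d := by
  ext p q
  simp only [Matrix.transpose_apply, diagConj_apply]
  exact Finset.sum_congr rfl fun i _ => by ring

theorem exp_diagConj {U : Matrix ι ι ℝ} (hU : U.transpose * U = 1) (hU' : U * U.transpose = 1)
    (d : ι → ℝ) :
    NormedSpace.exp (diagConj U d) = diagConj U (fun i => Real.exp (d i)) := by
  have hinv : U⁻¹ = U.transpose := Matrix.inv_eq_left_inv hU
  have hunit : IsUnit U := ⟨⟨U, U.transpose, hU', hU⟩, rfl⟩
  unfold diagConj
  rw [← hinv, Matrix.exp_conj U _ hunit, Matrix.exp_diagonal]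
  congr 3
  ext i
  rw [Pi.exp_def, Real.exp_eq_exp_ℝ]

/-- The spectral theorem with a single `U` for `A` and all `cfc f A`, so that identities between
functions of `A` reduce to scalar identities in the eigenvalues. -/
theorem exists_diagConj {A : Matrix ι ι ℝ} (hA : A.IsHermitian) :
    ∃ (U : Matrix ι ι ℝ) (μ : ι → ℝ), U.transpose * U = 1 ∧ U * U.transpose = 1 ∧
      A = diagConj U μ ∧ ∀ f : ℝ → ℝ, cfc f A = diagConj U (fun i => f (μ i)) := by
  refine ⟨hA.eigenvectorUnitary, hA.eigenvalues, ?_, ?_, ?_, fun f => ?_⟩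
  · have := Unitary.coe_star_mul_self hA.eigenvectorUnitary
    simpa [Matrix.star_eq_conjTranspose] using this
  · have := Unitary.coe_mul_star_self hA.eigenvectorUnitary
    simpa [Matrix.star_eq_conjTranspose] using this
  · conv_lhs => rw [hA.spectral_theorem]
    simp [diagConj, Unitary.conjStarAlgAut_apply, Matrix.star_eq_conjTranspose]
  · rw [hA.cfc_eq]
    simp [diagConj, Matrix.IsHermitian.cfc, Unitary.conjStarAlgAut_apply, Matrix.star_eq_conjTranspose]
    rfl

/-- The `i`-th column of `U` is a unit eigenvector. -/
theorem diagConj_mulVec {U : Matrix ι ι ℝ} (hU : U.transpose * U = 1) (d : ι → ℝ) (i : ι) :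
    Matrix.mulVec (diagConj U d) (fun p => U p i) = d i • fun p => U p i := by
  have h : diagConj U d * U = U * Matrix.diagonal d := by
    unfold diagConj; rw [Matrix.mul_assoc, hU, Matrix.mul_one]
  ext p
  have := congrFun (congrFun h p) i
  rw [Matrix.mul_diagonal] at this
  simp only [Matrix.mulVec, dotProduct, Pi.smul_apply, smul_eq_mul]
  rw [Matrix.mul_apply] at this
  rw [this, mul_comm]

theorem sum_sq_col {U : Matrix ι ι ℝ} (hU : U.transpose * U = 1) (i : ι) :
    ∑ p, U p i * U p i = 1 := by
  have := congrFun (congrFun hU i) i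
  simpa [Matrix.mul_apply] using this

theorem hasSum_diagConj (U : Matrix ι ι ℝ) {c : ℕ → ι → ℝ} {d : ι → ℝ}
    (h : ∀ i, HasSum (fun n => c n i) (d i)) (p q : ι) :
    HasSum (fun n => diagConj U (c n) p q) (diagConj U d p q) := by
  simp only [diagConj_apply]
  exact hasSum_sum fun i _ => ((h i).mul_left _).mul_right _

/-- A power series with nonnegative coefficients takes an entrywise nonnegative matrix to one. -/
theorem EntryNonneg.of_powerSeries {U : Matrix ι ι ℝ} (hU : U.transpose * U = 1)
    (hU' : U * U.transpose = 1) {μ d : ι → ℝ} (hμ : EntryNonneg (diagConj U μ)) {c : ℕ → ℝ}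
    (hc : ∀ n, 0 ≤ c n) (h : ∀ i, HasSum (fun n => c n * μ i ^ n) (d i)) :
    EntryNonneg (diagConj U d) := fun p q => by
  refine (hasSum_diagConj U h p q).nonneg fun n => ?_
  rw [← diagConj_smul U (c n) (fun i => μ i ^ n), ← diagConj_pow hU hU']
  exact mul_nonneg (hc n) (hμ.pow n p q)

theorem posDef_eigenvalue_pos {U : Matrix ι ι ℝ} (hU : U.transpose * U = 1) {μ : ι → ℝ}
    (h : (diagConj U μ).PosDef) (i : ι) : 0 < μ i := by
  have h1 : (fun p => U p i) ≠ 0 := by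
    intro h0
    have := sum_sq_col hU i
    simp only [fun p => congrFun h0 p, Pi.zero_apply, mul_zero, Finset.sum_const_zero] at this
    norm_num at this
  have h2 := h.dotProduct_mulVec_pos h1
  rw [diagConj_mulVec hU] at h2
  have h3 : ∑ x, U x i * (μ i * U x i) = μ i := by
    have h4 : ∑ x, U x i * (μ i * U x i) = μ i * ∑ x, U x i * U x i := by
      rw [Finset.mul_sum]
      exact Finset.sum_congr rfl fun x _ => by ring
    rw [h4, sum_sq_col hU i, mul_one]
  simpa [dotProduct, h3] using h2

/-- A positive definite matrix whose square has nonpositive off-diagonal entries has itself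
nonpositive off-diagonal entries. -/
theorem offDiag_nonpos_of_sq {T : Matrix ι ι ℝ} (hT : T.PosDef)
    (h : ∀ p q, p ≠ q → (T * T) p q ≤ 0) {p q : ι} (hpq : p ≠ q) : T p q ≤ 0 := by
  obtain ⟨U, τ, hU, hU', hTU, -⟩ := exists_diagConj hT.isHermitian
  have hτ : ∀ i, 0 < τ i := posDef_eigenvalue_pos hU (hTU ▸ hT)
  -- The scale `σ` is large enough that the spectrum of `T/σ` lies in `(0, 1]` and the diagonal of
  -- `1 - (T/σ)²` is nonnegative.
  set σ : ℝ := 1 + ∑ i, τ i + ∑ i, |(T * T) i i| with hσ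
  have hs1 : 0 ≤ ∑ i, τ i := Finset.sum_nonneg fun i _ => (hτ i).le
  have hs2 : 0 ≤ ∑ i, |(T * T) i i| := Finset.sum_nonneg fun i _ => abs_nonneg _
  have hσ1 : 1 ≤ σ := by linarith
  have hσ0 : 0 < σ := by linarith
  have hτσ : ∀ i, τ i / σ ≤ 1 := fun i => by
    rw [div_le_one hσ0]
    have := Finset.single_le_sum (f := τ) (fun j _ => (hτ j).le) (Finset.mem_univ i)
    linarith
  have hdσ : ∀ i, (T * T) i i ≤ σ ^ 2 := fun i => by
    have := Finset.single_le_sum (f := fun i => |(T * T) i i|) (fun j _ => abs_nonneg _)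
      (Finset.mem_univ i)
    have h3 := le_abs_self ((T * T) i i)
    nlinarith
  -- the iteration `g ↦ (1 - x² + g²) / 2`
  let g : ℕ → ℝ → ℝ := fun n x => Nat.rec 0 (fun _ y => (1 - x ^ 2 + y ^ 2) / 2) n
  have g0 : ∀ x, g 0 x = 0 := fun x => rfl
  have gs : ∀ n x, g (n + 1) x = (1 - x ^ 2 + g n x ^ 2) / 2 := fun n x => rfl
  -- The fixed point is `1 - x`. The error is multiplied at each step by `(1 - x + g)/2 ≤ 1 - x <
  -- 1`.
  have hg : ∀ x, 0 < x → x ≤ 1 → Filter.Tendsto (fun n => g n x) Filter.atTop (nhds (1 - x)) := by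
    intro x hx hx1
    have hb : ∀ n, 0 ≤ g n x ∧ g n x ≤ 1 - x ∧ 1 - x - g n x ≤ (1 - x) ^ n := by
      intro n
      induction n with
      | zero => rw [g0]; simp; exact ⟨hx1, hx.le⟩
      | succ n ih =>
        obtain ⟨h1, h2, h3⟩ := ih
        rw [gs]
        refine ⟨by nlinarith, by nlinarith, ?_⟩
        have : 1 - x - (1 - x ^ 2 + g n x ^ 2) / 2 = (1 - x - g n x) * ((1 - x + g n x) / 2) := by
          ring
        rw [this, pow_succ]
        exact mul_le_mul h3 (by linarith) (by linarith) (pow_nonneg (by linarith) _)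
    have h0 : Filter.Tendsto (fun n : ℕ => (1 - x) ^ n) Filter.atTop (nhds 0) :=
      tendsto_pow_atTop_nhds_zero_of_lt_one (by linarith) (by linarith)
    have h1 : Filter.Tendsto (fun n : ℕ => 1 - x - (1 - x) ^ n) Filter.atTop (nhds (1 - x)) := by
      simpa using h0.const_sub (1 - x)
    exact tendsto_of_tendsto_of_tendsto_of_le_of_le h1 tendsto_const_nhds
      (fun n => by have := (hb n).2.2; simp only; linarith) (fun n => (hb n).2.1)
  -- With `N = 1 - (T/σ)²` entrywise nonnegative, the iteration `G ↦ (N + G²)/2` from `0` preserves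
  -- this sign. Its limit `1 - T/σ` inherits it.
  have hN : EntryNonneg (diagConj U fun i => 1 - (τ i / σ) ^ 2) := by
    have : (diagConj U fun i => 1 - (τ i / σ) ^ 2) = 1 + (-(σ ^ 2)⁻¹) • (T * T) := by
      rw [hTU, diagConj_mul hU, diagConj_smul, ← diagConj_one hU', diagConj_add]
      congr 1; ext i; field_simp; ring
    rw [this]
    intro i j
    rcases eq_or_ne i j with rfl | hij
    · have := hdσ i
      have h5 : (σ ^ 2)⁻¹ * (T * T) i i ≤ 1 := by
        rw [inv_mul_le_iff₀ (by positivity)]; linarith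
      simp; linarith
    · have := h i j hij
      have h5 : (σ ^ 2)⁻¹ * (T * T) i j ≤ 0 :=
        mul_nonpos_of_nonneg_of_nonpos (by positivity) this
      simp [Matrix.one_apply_ne hij]; linarith
  have hgn : ∀ n, EntryNonneg (diagConj U fun i => g n (τ i / σ)) := by
    intro n
    induction n with
    | zero => intro p q; simp [diagConj_apply, g0]
    | succ n ih =>
      have := (hN.add (ih.mul ih)).smul (c := 1 / 2) (by norm_num)
      rw [diagConj_mul hU, diagConj_add, diagConj_smul] at this
      convert this using 3
      rw [gs]; ring
  have hlim : Filter.Tendsto (fun n => diagConj U (fun i => g n (τ i / σ)) p q) Filter.atTop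
      (nhds (diagConj U (fun i => 1 - τ i / σ) p q)) := by
    simp only [diagConj_apply]
    exact tendsto_finsetSum _ fun i _ =>
      ((hg _ (div_pos (hτ i) hσ0) (hτσ i)).const_mul _).mul_const _
  have hfin : 0 ≤ diagConj U (fun i => 1 - τ i / σ) p q :=
    ge_of_tendsto' hlim fun n => hgn n p q
  have heq : (diagConj U fun i => 1 - τ i / σ) = 1 + (-σ⁻¹) • T := by
    rw [hTU, diagConj_smul, ← diagConj_one hU', diagConj_add]
    congr 1; ext i; field_simp; ring
  rw [heq] at hfin
  simp [Matrix.one_apply_ne hpq] at hfin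
  by_contra hc
  push Not at hc
  have := mul_pos (inv_pos.mpr hσ0) hc
  linarith

end Entrywise

/-! ### The one-body kernels: entrywise bounds -/

section Kernel

variable {ι : Type*} [Fintype ι] [DecidableEq ι]

theorem hasSum_of_eq {f g : ℕ → ℝ} {a : ℝ} (h : HasSum f a) (hfg : ∀ n, g n = f n) :
    HasSum g a := (funext hfg : g = f) ▸ h

/-- The terms of order `0` and `1` are dropped and the remaining coefficients are nonnegative. At `x
= 1 - η⁻¹` the value is `log η - x`, which will give `W ≤ log E` entrywise. -/
theorem hasSum_neg_log_sub {x : ℝ} (hx : |x| < 1) :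
    HasSum (fun n : ℕ => (if n < 2 then 0 else 1 / (n : ℝ)) * x ^ n) (-Real.log (1 - x) - x) := by
  have h0 : HasSum (fun n : ℕ => x ^ n / (n : ℝ)) (-Real.log (1 - x)) := by
    rw [← hasSum_nat_add_iff' 1]
    simpa using Real.hasSum_pow_div_log_of_abs_lt_one hx
  have h1 := h0.sub (hasSum_ite_eq (1 : ℕ) x)
  refine hasSum_of_eq h1 fun n => ?_
  rcases n with _ | _ | n
  · simp
  · simp
  · simp; ring

theorem hasSum_exp_sub (a x : ℝ) :
    HasSum (fun n : ℕ => (if n < 2 then 0 else a ^ n / (n.factorial : ℝ)) * x ^ n)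
      (Real.exp (a * x) - 1 - a * x) := by
  have h0 : HasSum (fun n : ℕ => (a * x) ^ n / (n.factorial : ℝ)) (Real.exp (a * x)) := by
    rw [Real.exp_eq_exp_ℝ]
    exact NormedSpace.expSeries_div_hasSum_exp (a * x)
  have h1 := (h0.sub (hasSum_ite_eq (0 : ℕ) 1)).sub (hasSum_ite_eq (1 : ℕ) (a * x))
  refine hasSum_of_eq h1 fun n => ?_
  rcases n with _ | _ | n
  · simp
  · simp
  · simp [mul_pow]; ring

/-- The exponential remainder `e^{aL} - 1 - aL` of an entrywise nonnegative `L` is entrywise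
nonnegative and increasing in `a`. -/
theorem EntryNonneg.exp_remainder {U : Matrix ι ι ℝ} (hU : U.transpose * U = 1)
    (hU' : U * U.transpose = 1) {l : ι → ℝ} (hl : EntryNonneg (diagConj U l)) {a : ℝ}
    (ha : 0 ≤ a) (ha1 : a ≤ 1) :
    EntryNonneg (diagConj U fun i => Real.exp (a * l i) - 1 - a * l i) ∧
    EntryNonneg ((diagConj U fun i => Real.exp (1 * l i) - 1 - 1 * l i) -
      diagConj U fun i => Real.exp (a * l i) - 1 - a * l i) := by
  constructor
  · exact EntryNonneg.of_powerSeries hU hU' hl (fun n => by split_ifs <;> positivity)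
      fun i => hasSum_exp_sub a (l i)
  · have : (diagConj U fun i => Real.exp (1 * l i) - 1 - 1 * l i) -
        (diagConj U fun i => Real.exp (a * l i) - 1 - a * l i) =
        diagConj U fun i => (Real.exp (1 * l i) - 1 - 1 * l i) -
          (Real.exp (a * l i) - 1 - a * l i) := by
      rw [sub_eq_iff_eq_add, diagConj_add]
      congr 1; ext i; ring
    rw [this]
    refine EntryNonneg.of_powerSeries hU hU' hl
      -- Monotonicity in `a` is seen coefficientwise: `aⁿ ≤ 1`.
      (c := fun n => if n < 2 then 0 else (1 - a ^ n) / (n.factorial : ℝ)) (fun n => ?_) fun i => ?_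
    · split_ifs
      · exact le_rfl
      · exact div_nonneg (sub_nonneg.mpr (pow_le_one₀ ha ha1)) (by positivity)
    · refine hasSum_of_eq ((hasSum_exp_sub 1 (l i)).sub (hasSum_exp_sub a (l i))) fun n => ?_
      split_ifs
      · simp
      · rw [one_pow]; ring

/-- The eigenvalues of a positive solution of `E h E = h + 2 v vᵀ` are at least `1`. -/
theorem one_le_eigenvalue {U : Matrix ι ι ℝ} (hU : U.transpose * U = 1) {η l v : ι → ℝ}
    (hl : ∀ i, 0 < l i) (hη : ∀ i, 0 < η i)
    (hE : diagConj U η * Matrix.diagonal l * diagConj U η =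
      Matrix.diagonal l + (2 : ℝ) • Matrix.vecMulVec v v) (i : ι) : 1 ≤ η i := by
  set x : ι → ℝ := fun p => U p i with hx
  have hxE : Matrix.mulVec (diagConj U η) x = η i • x := diagConj_mulVec hU η i
  have hpos : 0 < ∑ p, l p * x p ^ 2 := by
    have h1 : ∃ p, x p ≠ 0 := by
      by_contra hc
      push Not at hc
      have := sum_sq_col hU i
      simp only [hx] at hc
      simp [hc] at this
    obtain ⟨p, hp⟩ := h1
    exact Finset.sum_pos' (fun q _ => mul_nonneg (hl q).le (sq_nonneg _))
      ⟨p, Finset.mem_univ p, mul_pos (hl p) (by positivity)⟩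
  -- Testing the equation on an eigenvector `x` gives `η² ⟨x, h x⟩ = ⟨x, h x⟩ + 2 ⟨v, x⟩²` with `⟨x,
  -- h x⟩ > 0`.
  have e1 : x ⬝ᵥ Matrix.mulVec (diagConj U η * Matrix.diagonal l * diagConj U η) x =
      η i ^ 2 * ∑ p, l p * x p ^ 2 := by
    rw [← Matrix.mulVec_mulVec, ← Matrix.mulVec_mulVec, hxE, Matrix.dotProduct_mulVec,
      ← Matrix.mulVec_transpose, diagConj_transpose, hxE]
    simp only [dotProduct, Matrix.mulVec_diagonal, Pi.smul_apply, smul_eq_mul, Finset.mul_sum]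
    exact Finset.sum_congr rfl fun p _ => by ring
  have e2 : x ⬝ᵥ Matrix.mulVec (Matrix.diagonal l + (2 : ℝ) • Matrix.vecMulVec v v) x =
      ∑ p, l p * x p ^ 2 + 2 * (∑ p, v p * x p) ^ 2 := by
    rw [Matrix.add_mulVec, dotProduct_add, Matrix.smul_mulVec, dotProduct_smul]
    congr 1
    · simp only [dotProduct, Matrix.mulVec_diagonal]
      exact Finset.sum_congr rfl fun p _ => by ring
    · rw [Matrix.vecMulVec_mulVec, sq]
      simp only [dotProduct, Pi.smul_apply, smul_eq_mul, MulOpposite.smul_eq_mul_unop,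
        MulOpposite.unop_op, Finset.sum_mul, Finset.mul_sum]
      exact Finset.sum_congr rfl fun p _ => Finset.sum_congr rfl fun q _ => by ring
  rw [hE, e2] at e1
  have h3 : 1 ≤ η i ^ 2 := by
    by_contra hc
    push Not at hc
    nlinarith [sq_nonneg (∑ p, v p * x p)]
  nlinarith [hη i]

/-- The off-diagonal entries of `E⁻¹` are nonpositive. -/
theorem inv_offDiag_nonpos {E : Matrix ι ι ℝ} (hEpos : E.PosDef) {l v : ι → ℝ}
    (hl : ∀ i, 0 < l i) (hv : ∀ i, 0 ≤ v i)
    (hE : E * Matrix.diagonal l * E = Matrix.diagonal l + (2 : ℝ) • Matrix.vecMulVec v v)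
    {p q : ι} (hpq : p ≠ q) : E⁻¹ p q ≤ 0 := by
  set d : ι → ℝ := fun i => (Real.sqrt (l i))⁻¹ with hd
  have hd0 : ∀ i, 0 < d i := fun i => inv_pos.mpr (Real.sqrt_pos.mpr (hl i))
  have hdd : ∀ i, d i * d i = (l i)⁻¹ := fun i => by
    simp only [hd, ← mul_inv, Real.mul_self_sqrt (hl i).le]
  have hinvl : (Matrix.diagonal l)⁻¹ = Matrix.diagonal fun i => (l i)⁻¹ := by
    refine Matrix.inv_eq_right_inv ?_
    rw [Matrix.diagonal_mul_diagonal]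
    simp [fun i => mul_inv_cancel₀ (hl i).ne']
  -- With `T = h^{-1/2} E⁻¹ h^{-1/2}` the square is `T² = h^{-1/2} (h + 2 v vᵀ)⁻¹ h^{-1/2}`, which
  -- is explicit. Conjugation by a positive diagonal matrix does not affect signs.
  set T : Matrix ι ι ℝ := Matrix.diagonal d * E⁻¹ * Matrix.diagonal d with hT
  have hTpos : T.PosDef := by
    have := hEpos.inv.conjTranspose_mul_mul_same (B := Matrix.diagonal d) (by
      intro x y hxy
      ext i
      have := congrFun hxy i
      simp only [Matrix.mulVec_diagonal] at this
      exact mul_left_cancel₀ (hd0 i).ne' this)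
    simpa [Matrix.diagonal_conjTranspose, hT] using this
  obtain ⟨α, hα⟩ : ∃ α, α = ∑ r, v r ^ 2 / l r := ⟨_, rfl⟩
  have hα0 : 0 ≤ α := hα ▸ Finset.sum_nonneg fun r _ => div_nonneg (sq_nonneg _) (hl r).le
  -- The left side is `(E h E)⁻¹ = (h + 2 v vᵀ)⁻¹`, evaluated by the Sherman–Morrison formula with
  -- `α = ⟨v, h⁻¹ v⟩`.
  have hinv : E⁻¹ * (Matrix.diagonal fun i => (l i)⁻¹) * E⁻¹ =
      (Matrix.diagonal fun i => (l i)⁻¹) -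
        (2 / (1 + 2 * α)) • Matrix.vecMulVec (fun i => v i / l i) (fun i => v i / l i) := by
    rw [← hinvl, Matrix.mul_assoc, ← Matrix.mul_inv_rev, ← Matrix.mul_inv_rev, hE, hinvl]
    refine Matrix.inv_eq_right_inv ?_
    ext i j
    have hne : 1 + 2 * α ≠ 0 := by positivity
    have hli := (hl i).ne'
    have hlj := (hl j).ne'
    have s1 : ∑ r, v r * ((2 / (1 + 2 * α)) * (v r / l r * (v j / l j))) =
        (2 / (1 + 2 * α)) * (v j / l j) * α := by
      calc _ = ∑ r, (2 / (1 + 2 * α)) * (v j / l j) * (v r ^ 2 / l r) :=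
            Finset.sum_congr rfl fun r _ => by ring
        _ = _ := by rw [← Finset.mul_sum, hα]
    have s2 : ∑ r, v r * (if r = j then (l r)⁻¹ else 0) = v j / l j := by
      simp [div_eq_mul_inv]
    have s3 : (Matrix.vecMulVec v v * ((Matrix.diagonal fun i => (l i)⁻¹) -
        (2 / (1 + 2 * α)) • Matrix.vecMulVec (fun i => v i / l i) (fun i => v i / l i))) i j =
        v i * (v j / l j - (2 / (1 + 2 * α)) * (v j / l j) * α) := by
      refine Eq.trans ?_ (congrArg₂ (fun a b => v i * (a - b)) s2 s1)
      rw [Matrix.mul_apply, ← Finset.sum_sub_distrib, Finset.mul_sum]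
      refine Finset.sum_congr rfl fun r _ => ?_
      simp only [Matrix.vecMulVec_apply, Matrix.diagonal_apply, Matrix.sub_apply,
        Matrix.smul_apply, smul_eq_mul]
      ring
    rw [Matrix.add_mul, Matrix.add_apply, Matrix.smul_mul, Matrix.smul_apply, s3,
      Matrix.diagonal_mul]
    simp only [Matrix.sub_apply, Matrix.diagonal_apply, Matrix.smul_apply, Matrix.vecMulVec_apply,
      Matrix.one_apply, smul_eq_mul]
    by_cases hij : i = j
    · subst hij
      simp only [if_true]
      field_simp
      ring
    · simp only [hij, if_false]
      field_simp
      ring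
  have hTT : T * T = Matrix.diagonal d * ((Matrix.diagonal fun i => (l i)⁻¹) -
        (2 / (1 + 2 * α)) • Matrix.vecMulVec (fun i => v i / l i) (fun i => v i / l i)) *
        Matrix.diagonal d := by
    rw [← hinv, show (Matrix.diagonal fun i => (l i)⁻¹) = Matrix.diagonal d * Matrix.diagonal d by
      rw [Matrix.diagonal_mul_diagonal]; simp only [hdd]]
    simp only [hT, Matrix.mul_assoc]
  have hoff := offDiag_nonpos_of_sq hTpos (fun i j hij => by
    rw [hTT, Matrix.mul_diagonal, Matrix.diagonal_mul]
    simp only [Matrix.sub_apply, Matrix.diagonal_apply_ne _ hij, Matrix.smul_apply,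
      Matrix.vecMulVec_apply, smul_eq_mul, zero_sub]
    have h1 : 0 ≤ d i * (2 / (1 + 2 * α) * (v i / l i * (v j / l j))) * d j := by
      have := hd0 i; have := hd0 j; have := hv i; have := hv j; have := hl i; have := hl j
      positivity
    linarith) hpq
  rw [hT, Matrix.mul_diagonal, Matrix.diagonal_mul] at hoff
  by_contra hc
  push Not at hc
  have := mul_pos (mul_pos (hd0 p) hc) (hd0 q)
  linarith

end Kernel

section Kernel

variable {ι : Type*} [Fintype ι] [DecidableEq ι]

/-- Entrywise bounds for the logarithm `L` of the positive solution `E` of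
`E h E = h + 2 v vᵀ`, `h` diagonal. -/
structure LogKernelBounds (E L : Matrix ι ι ℝ) (l v : ι → ℝ) : Prop where
  exp_eq : NormedSpace.exp L = E
  symm : ∀ p q, L p q = L q p
  nonneg : ∀ p q, 0 ≤ L p q
  le : ∀ p q, (l p + l q) * L p q ≤ 2 * (v p * v q)
  ge : ∀ p q, 2 * (v p * v q) * (1 - 4 * ∑ r, v r ^ 2 / l r) ≤ (l p + l q) * L p q
  remainder_nonneg : ∀ a ∈ Set.Icc (0 : ℝ) 1, ∀ p q,
    0 ≤ (NormedSpace.exp (a • L) * Matrix.diagonal l * NormedSpace.exp (a • L)) p q -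
      Matrix.diagonal l p q - a * ((l p + l q) * L p q)
  remainder_le : ∀ a ∈ Set.Icc (0 : ℝ) 1, ∀ p q,
    (NormedSpace.exp (a • L) * Matrix.diagonal l * NormedSpace.exp (a • L)) p q -
      Matrix.diagonal l p q - a * ((l p + l q) * L p q) ≤
      2 * (v p * v q) - (l p + l q) * L p q

theorem mul_diagonal_mul_apply (A B : Matrix ι ι ℝ) (l : ι → ℝ) (p q : ι) :
    (A * Matrix.diagonal l * B) p q = ∑ r, A p r * l r * B r q := by
  simp [Matrix.mul_apply, Matrix.diagonal_apply]

theorem EntryNonneg.sandwich_mono {A B : Matrix ι ι ℝ} {l : ι → ℝ} (hl : ∀ i, 0 < l i)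
    (hA : EntryNonneg A) (hAB : EntryNonneg (B - A)) (p q : ι) :
    (A * Matrix.diagonal l * A) p q ≤ (B * Matrix.diagonal l * B) p q := by
  have hle : ∀ i j, A i j ≤ B i j := fun i j => sub_nonneg.mp (hAB i j)
  rw [mul_diagonal_mul_apply, mul_diagonal_mul_apply]
  refine Finset.sum_le_sum fun r _ => ?_
  exact mul_le_mul (mul_le_mul_of_nonneg_right (hle _ _) (hl r).le) (hle _ _) (hA _ _)
    (mul_nonneg ((hA _ _).trans (hle _ _)) (hl r).le)

/-- All matrices involved are functions of `E`, hence commute: `W = 1 - E⁻¹`, `L = log E`, `X = E -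
1` and `Y a = e^{aL} - 1 - aL`. Entrywise they satisfy `0 ≤ W ≤ L ≤ X`. Upper bounds come from the
quadratic equation for `X`, and lower bounds from `W = X - XW`. -/
theorem logKernelBounds {E : Matrix ι ι ℝ} (hEpos : E.PosDef) {l v : ι → ℝ}
    (hl : ∀ i, 0 < l i) (hv : ∀ i, 0 ≤ v i)
    (hE : E * Matrix.diagonal l * E = Matrix.diagonal l + (2 : ℝ) • Matrix.vecMulVec v v) :
    LogKernelBounds E (cfc Real.log E) l v := by
  have hEinv : ∀ p q, p ≠ q → E⁻¹ p q ≤ 0 := fun p q => inv_offDiag_nonpos hEpos hl hv hE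
  obtain ⟨U, η, hU, hU', hEU, hcfc⟩ := exists_diagConj hEpos.isHermitian
  rw [hcfc Real.log]
  subst hEU
  have hη : ∀ i, 0 < η i := posDef_eigenvalue_pos hU hEpos
  have hη1 : ∀ i, 1 ≤ η i := one_le_eigenvalue hU hl hη hE
  have hinv : (diagConj U η)⁻¹ = diagConj U fun i => (η i)⁻¹ := by
    refine Matrix.inv_eq_right_inv ?_
    rw [diagConj_mul hU, ← diagConj_one hU']
    congr 1; ext i; exact mul_inv_cancel₀ (hη i).ne'
  obtain ⟨W, hWdef⟩ : ∃ W, W = diagConj U fun i => 1 - (η i)⁻¹ := ⟨_, rfl⟩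
  obtain ⟨X, hXdef⟩ : ∃ X, X = diagConj U fun i => η i - 1 := ⟨_, rfl⟩
  obtain ⟨L, hLdef⟩ : ∃ L, L = diagConj U fun i => Real.log (η i) := ⟨_, rfl⟩
  have hW : EntryNonneg W := by
    intro p q
    have h1 : W = 1 + (-1 : ℝ) • (diagConj U η)⁻¹ := by
      rw [hinv, diagConj_smul, ← diagConj_one hU', diagConj_add, hWdef]
      congr 1; ext i; ring
    rcases eq_or_ne p q with rfl | hpq
    · rw [hWdef, diagConj_apply]
      refine Finset.sum_nonneg fun i _ => ?_
      have : 0 ≤ 1 - (η i)⁻¹ := sub_nonneg.mpr (inv_le_one_of_one_le₀ (hη1 i))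
      have h2 : U p i * (1 - (η i)⁻¹) * U p i = (1 - (η i)⁻¹) * (U p i) ^ 2 := by ring
      rw [h2]; positivity
    · have := hEinv p q hpq
      rw [h1]
      simp [Matrix.one_apply_ne hpq]; exact this
  have hLW : EntryNonneg (L - W) := by
    have h1 : L - W = diagConj U fun i => -Real.log (1 - (1 - (η i)⁻¹)) - (1 - (η i)⁻¹) := by
      rw [sub_eq_iff_eq_add, hLdef, hWdef, diagConj_add]
      congr 1; ext i; rw [sub_sub_cancel, Real.log_inv]; ring
    rw [h1]
    refine EntryNonneg.of_powerSeries hU hU' (hWdef ▸ hW)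
      (c := fun n : ℕ => if n < 2 then 0 else 1 / (n : ℝ))
      (fun n => by split_ifs <;> positivity) fun i => hasSum_neg_log_sub ?_
    have h2 : (η i)⁻¹ ≤ 1 := inv_le_one_of_one_le₀ (hη1 i)
    have h3 : 0 < (η i)⁻¹ := inv_pos.mpr (hη i)
    rw [abs_lt]; constructor <;> linarith
  have hL : EntryNonneg L := by
    have := hLW.add hW
    rwa [sub_add_cancel] at this
  have hexp : ∀ a : ℝ, NormedSpace.exp (a • L) =
      1 + a • L + diagConj U fun i => Real.exp (a * Real.log (η i)) - 1 - a * Real.log (η i) := by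
    intro a
    rw [hLdef, diagConj_smul, exp_diagConj hU hU', ← diagConj_one hU', diagConj_add, diagConj_add]
    congr 1; ext i; ring
  obtain ⟨Y, hYdef⟩ : ∃ Y : ℝ → Matrix ι ι ℝ, ∀ a, Y a = diagConj U fun i =>
    Real.exp (a * Real.log (η i)) - 1 - a * Real.log (η i) := ⟨_, fun _ => rfl⟩
  simp only [← hYdef] at hexp
  have hY : ∀ a ∈ Set.Icc (0 : ℝ) 1, EntryNonneg (Y a) ∧ EntryNonneg (Y 1 - Y a) := by
    intro a ha
    rw [hYdef, hYdef]
    exact EntryNonneg.exp_remainder hU hU' (hLdef ▸ hL) ha.1 ha.2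
  have hE1 : diagConj U η = 1 + X := by
    rw [hXdef, ← diagConj_one hU', diagConj_add]
    congr 1; ext i; ring
  have hexpL : NormedSpace.exp L = diagConj U η := by
    rw [hLdef, exp_diagConj hU hU']
    congr 1; ext i; exact Real.exp_log (hη i)
  have hXY : X = L + Y 1 := by
    have := hexp 1
    rw [one_smul, hexpL, hE1, add_assoc] at this
    exact add_left_cancel this
  have hX : EntryNonneg X := hXY ▸ hL.add (hY 1 ⟨zero_le_one, le_rfl⟩).1
  have hXW : EntryNonneg (X - W) := by
    have : X - W = (L - W) + Y 1 := by rw [hXY]; abel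
    rw [this]; exact hLW.add (hY 1 ⟨zero_le_one, le_rfl⟩).1
  have hWX : W = X - X * W := by
    rw [eq_sub_iff_add_eq, hXdef, hWdef, diagConj_mul hU, diagConj_add]
    congr 1; ext i; have := (hη i).ne'; field_simp; ring
  have hXsym : ∀ p q, X p q = X q p := fun p q => by
    conv_lhs => rw [hXdef, ← diagConj_transpose]
    rw [hXdef, Matrix.transpose_apply]
  -- the quadratic equation for `X`
  have hquad : ∀ p q, (l p + l q) * X p q + (X * Matrix.diagonal l * X) p q = 2 * (v p * v q) := by
    intro p q
    have h1 : X * Matrix.diagonal l + Matrix.diagonal l * X + X * Matrix.diagonal l * X =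
        (2 : ℝ) • Matrix.vecMulVec v v := by
      rw [hE1] at hE
      have h2 : (1 + X) * Matrix.diagonal l * (1 + X) = Matrix.diagonal l +
          (X * Matrix.diagonal l + Matrix.diagonal l * X + X * Matrix.diagonal l * X) := by
        noncomm_ring
      rw [h2] at hE
      exact add_left_cancel hE
    have h2 := congrFun (congrFun h1 p) q
    rw [Matrix.add_apply, Matrix.add_apply, Matrix.mul_diagonal, Matrix.diagonal_mul,
      Matrix.smul_apply, Matrix.vecMulVec_apply, smul_eq_mul] at h2
    linarith
  have hXle : ∀ p q, X p q ≤ 2 * (v p * v q) / (l p + l q) := by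
    intro p q
    rw [le_div_iff₀ (add_pos (hl p) (hl q))]
    have := hquad p q
    have h2 := (hX.mul (EntryNonneg.diagonal fun i => (hl i).le)).mul hX p q
    linarith
  obtain ⟨α, hα⟩ : ∃ α, α = ∑ r, v r ^ 2 / l r := ⟨_, rfl⟩
  have hXX : ∀ p q r, X p r * X r q ≤
      4 * (v p * v q) * (v r ^ 2 / ((l p + l r) * (l r + l q))) := by
    intro p q r
    have h1 := mul_le_mul (hXle p r) (hXle r q) (hX r q)
      (div_nonneg (mul_nonneg two_pos.le (mul_nonneg (hv p) (hv r)))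
        (add_pos (hl p) (hl r)).le)
    refine h1.trans (le_of_eq ?_)
    have := (add_pos (hl p) (hl r)).ne'; have := (add_pos (hl r) (hl q)).ne'
    field_simp; ring
  have hvv : ∀ p q, 0 ≤ v p * v q := fun p q => mul_nonneg (hv p) (hv q)
  have hXhX : ∀ p q, (X * Matrix.diagonal l * X) p q ≤ 4 * (v p * v q) * α := by
    intro p q
    rw [mul_diagonal_mul_apply, hα, Finset.mul_sum]
    refine Finset.sum_le_sum fun r _ => ?_
    have h1 := mul_le_mul_of_nonneg_left (hXX p q r) (hl r).le
    have h2 : X p r * l r * X r q = l r * (X p r * X r q) := by ring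
    rw [h2]
    refine h1.trans ?_
    have h3 : l r * (4 * (v p * v q) * (v r ^ 2 / ((l p + l r) * (l r + l q)))) =
      4 * (v p * v q) * (l r * v r ^ 2 / ((l p + l r) * (l r + l q))) := by ring
    rw [h3]
    refine mul_le_mul_of_nonneg_left ?_ (mul_nonneg (by norm_num) (hvv p q))
    -- The weight is handled by `l_r² ≤ (l_p + l_r)(l_r + l_q)`.
    have hp := hl p; have hq := hl q; have hr := hl r
    rw [div_le_div_iff₀ (by positivity) hr]
    nlinarith [mul_nonneg (sq_nonneg (v r)) (by positivity : 0 ≤ l p * l q + l p * l r + l r * l q)]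
  have hXXs : ∀ p q, (l p + l q) * (X * X) p q ≤ 4 * (v p * v q) * α := by
    intro p q
    rw [Matrix.mul_apply, hα, Finset.mul_sum, Finset.mul_sum]
    refine Finset.sum_le_sum fun r _ => ?_
    have hp := hl p; have hq := hl q; have hr := hl r
    have h1 := mul_le_mul_of_nonneg_left (hXX p q r) (add_pos hp hq).le
    refine h1.trans ?_
    have h3 : (l p + l q) * (4 * (v p * v q) * (v r ^ 2 / ((l p + l r) * (l r + l q)))) =
      4 * (v p * v q) * ((l p + l q) * v r ^ 2 / ((l p + l r) * (l r + l q))) := by ring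
    rw [h3]
    refine mul_le_mul_of_nonneg_left ?_ (mul_nonneg (by norm_num) (hvv p q))
    -- Here `(l_p + l_r)(l_r + l_q) - (l_p + l_q) l_r = l_p l_q + l_r² ≥ 0`.
    rw [div_le_div_iff₀ (by positivity) hr]
    nlinarith [mul_nonneg (sq_nonneg (v r)) (by positivity : 0 ≤ l p * l q + l r * l r)]
  have hLX : ∀ p q, L p q ≤ X p q := fun p q => by
    have := (hY 1 ⟨zero_le_one, le_rfl⟩).1 p q
    rw [hXY, Matrix.add_apply]; linarith
  -- `L ≥ W = X - XW ≥ X - X²`, the last step because `W ≤ X` and `X ≥ 0` entrywise.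
  have hlow : ∀ p q, X p q - (X * X) p q ≤ L p q := fun p q => by
    have h1 : 0 ≤ (L - W) p q := hLW p q
    have h2 := hX.mul hXW p q
    rw [Matrix.mul_sub, Matrix.sub_apply] at h2
    have h3 := congrFun (congrFun hWX p) q
    rw [Matrix.sub_apply] at h1 h3
    linarith
  -- the remainder of the conjugated kernel
  have hrem : ∀ a : ℝ, ∀ p q,
      (NormedSpace.exp (a • L) * Matrix.diagonal l * NormedSpace.exp (a • L)) p q -
      Matrix.diagonal l p q - a * ((l p + l q) * L p q) =
      ((a • L + Y a) * Matrix.diagonal l * (a • L + Y a)) p q + (l p + l q) * Y a p q := by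
    intro a p q
    have h1 : NormedSpace.exp (a • L) * Matrix.diagonal l * NormedSpace.exp (a • L) =
        Matrix.diagonal l + (a • L + Y a) * Matrix.diagonal l + Matrix.diagonal l * (a • L + Y a) +
        (a • L + Y a) * Matrix.diagonal l * (a • L + Y a) := by
      rw [hexp, add_assoc]
      generalize a • L + Y a = Z
      noncomm_ring
    rw [h1, Matrix.add_apply, Matrix.add_apply, Matrix.add_apply, Matrix.mul_diagonal,
      Matrix.diagonal_mul, Matrix.add_apply, Matrix.smul_apply, smul_eq_mul]
    ring
  -- At `a = 1` the matrix `aL + Y a` is `X`, and the quadratic equation evaluates the remainder.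
  have hrem1 : ∀ p q, ((1 • L + Y 1) * Matrix.diagonal l * (1 • L + Y 1)) p q +
      (l p + l q) * Y 1 p q = 2 * (v p * v q) - (l p + l q) * L p q := by
    intro p q
    have h1 := hquad p q
    rw [one_smul, ← hXY]
    have h2 : Y 1 p q = X p q - L p q := by rw [hXY, Matrix.add_apply]; ring
    rw [h2]; linarith
  rw [← hLdef]
  refine ⟨hexpL, fun p q => ?_, hL, fun p q => ?_, fun p q => ?_, fun a ha p q => ?_,
    fun a ha p q => ?_⟩
  · conv_lhs => rw [hLdef, ← diagConj_transpose]
    rw [hLdef, Matrix.transpose_apply]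
  · have h1 := hXle p q
    rw [le_div_iff₀ (add_pos (hl p) (hl q))] at h1
    have h2 := mul_le_mul_of_nonneg_left (hLX p q) (add_pos (hl p) (hl q)).le
    linarith
  · rw [← hα]
    have h1 := mul_le_mul_of_nonneg_left (hlow p q) (add_pos (hl p) (hl q)).le
    have := hquad p q; have := hXhX p q; have := hXXs p q
    linarith
  · rw [hrem]
    have hZ : EntryNonneg (a • L + Y a) := (hL.smul ha.1).add (hY a ha).1
    have h1 := (hZ.mul (EntryNonneg.diagonal fun i => (hl i).le)).mul hZ p q
    have h2 := mul_nonneg (add_pos (hl p) (hl q)).le ((hY a ha).1 p q)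
    linarith
  · rw [hrem, ← hrem1]
    have hZ : EntryNonneg (a • L + Y a) := (hL.smul ha.1).add (hY a ha).1
    have hZ1 : EntryNonneg ((1 • L + Y 1) - (a • L + Y a)) := by
      have : (1 • L + Y 1) - (a • L + Y a) = (1 - a) • L + (Y 1 - Y a) := by
        rw [sub_smul, one_smul, one_smul]; abel
      rw [this]
      exact (hL.smul (sub_nonneg.mpr ha.2)).add (hY a ha).2
    have h1 := EntryNonneg.sandwich_mono hl hZ hZ1 p q
    have h2 := mul_le_mul_of_nonneg_left (sub_nonneg.mp ((hY a ha).2 p q))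
      (add_pos (hl p) (hl q)).le
    linarith

end Kernel

/-! ### Matrix square roots and the equation `E h E = F` -/

section Kernel

variable {ι : Type*} [Fintype ι] [DecidableEq ι]

theorem posDef_diagConj {U : Matrix ι ι ℝ} (hU' : U * U.transpose = 1)
    {d : ι → ℝ} (hd : ∀ i, 0 < d i) : (diagConj U d).PosDef := by
  have := (Matrix.PosDef.diagonal hd).conjTranspose_mul_mul_same (B := U.transpose) (by
    intro x y hxy
    have := congrArg (Matrix.mulVec U) hxy
    simpa [Matrix.mulVec_mulVec, hU'] using this)
  simpa [diagConj] using this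

theorem cfc_sqrt_posDef {A : Matrix ι ι ℝ} (hA : A.PosDef) :
    (cfc Real.sqrt A).PosDef ∧ cfc Real.sqrt A * cfc Real.sqrt A = A := by
  obtain ⟨U, μ, hU, hU', hAU, hcfc⟩ := exists_diagConj hA.isHermitian
  have hμ : ∀ i, 0 < μ i := posDef_eigenvalue_pos hU (hAU ▸ hA)
  rw [hcfc]
  refine ⟨posDef_diagConj hU' fun i => Real.sqrt_pos.mpr (hμ i), ?_⟩
  rw [diagConj_mul hU, hAU]
  congr 1; ext i; exact Real.mul_self_sqrt (hμ i).le

theorem PosDef.conj {A B : Matrix ι ι ℝ} (hA : A.PosDef) (hB : B.PosDef) :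
    (B * A * B).PosDef := by
  have := hA.conjTranspose_mul_mul_same (B := B)
    (Matrix.mulVec_injective_iff_isUnit.mpr hB.isUnit)
  rwa [hB.isHermitian.eq] at this

/-- The matrix `E = h^{-1/2} (h^{1/2} F h^{1/2})^{1/2} h^{-1/2}` is the positive solution of
`E h E = F`. -/
theorem geometricMean_spec {h F : Matrix ι ι ℝ} (hh : h.PosDef) (hF : F.PosDef) :
    ((cfc Real.sqrt h)⁻¹ * cfc Real.sqrt (cfc Real.sqrt h * F * cfc Real.sqrt h) *
      (cfc Real.sqrt h)⁻¹).PosDef ∧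
    ((cfc Real.sqrt h)⁻¹ * cfc Real.sqrt (cfc Real.sqrt h * F * cfc Real.sqrt h) *
      (cfc Real.sqrt h)⁻¹) * h *
    ((cfc Real.sqrt h)⁻¹ * cfc Real.sqrt (cfc Real.sqrt h * F * cfc Real.sqrt h) *
      (cfc Real.sqrt h)⁻¹) = F := by
  obtain ⟨hR, hRR⟩ := cfc_sqrt_posDef hh
  generalize cfc Real.sqrt h = R at hR hRR ⊢
  obtain ⟨hS, hSS⟩ := cfc_sqrt_posDef (PosDef.conj hF hR)
  generalize cfc Real.sqrt (R * F * R) = S at hS hSS ⊢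
  refine ⟨PosDef.conj hS hR.inv, ?_⟩
  have hdet : IsUnit R.det := (Matrix.isUnit_iff_isUnit_det _).mp hR.isUnit
  have h1 : R⁻¹ * R = 1 := Matrix.nonsing_inv_mul R hdet
  have h2 : R * R⁻¹ = 1 := Matrix.mul_nonsing_inv R hdet
  calc R⁻¹ * S * R⁻¹ * h * (R⁻¹ * S * R⁻¹)
      = R⁻¹ * S * (R⁻¹ * R) * (R * R⁻¹) * S * R⁻¹ := by
        rw [← hRR]; simp only [Matrix.mul_assoc]
    _ = R⁻¹ * (S * S) * R⁻¹ := by rw [h1, h2]; simp only [Matrix.mul_assoc, Matrix.mul_one]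
    _ = (R⁻¹ * R) * F * (R * R⁻¹) := by rw [hSS]; simp only [Matrix.mul_assoc]
    _ = F := by rw [h1, h2, Matrix.one_mul, Matrix.mul_one]

end Kernel

/-! ### Excitation energies, couplings, and the entries of `K_k` and `B_k(t)` -/

theorem mem_lune {kF : ℝ} {k p : Mom} : p ∈ lune kF k ↔ len (p - k) ≤ kF ∧ kF < len p := by
  simp [lune]

theorem sqLen_nonneg (p : Mom) : 0 ≤ sqLen p := Finset.sum_nonneg fun _ _ => sq_nonneg _

theorem len_nonneg (p : Mom) : 0 ≤ len p := Real.sqrt_nonneg _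

theorem len_sq (p : Mom) : len p ^ 2 = sqLen p := Real.sq_sqrt (sqLen_nonneg p)

theorem exists_int_sqLen (p : Mom) : ∃ n : ℤ, sqLen p = n :=
  ⟨∑ i, p i ^ 2, by simp [sqLen]⟩

/-- `|p|²` and `|p - k|²` are integers and differ on a lune, so their difference is at least `1`. -/
theorem half_le_lam {kF : ℝ} {k p : Mom} (hp : p ∈ lune kF k) :
    1 / 2 ≤ lam k p := by
  obtain ⟨h1, h2⟩ := mem_lune.mp hp
  have h3 : sqLen (p - k) < sqLen p := by
    rw [← len_sq, ← len_sq]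
    exact pow_lt_pow_left₀ (h1.trans_lt h2) (len_nonneg _) two_ne_zero
  obtain ⟨m, hm⟩ := exists_int_sqLen p
  obtain ⟨n, hn⟩ := exists_int_sqLen (p - k)
  unfold lam
  rw [hm, hn] at h3 ⊢
  have h4 : n + 1 ≤ m := by exact_mod_cast h3
  have h5 : (n : ℝ) + 1 ≤ m := by exact_mod_cast h4
  linarith

theorem lam_pos {kF : ℝ} {k p : Mom} (hp : p ∈ lune kF k) : 0 < lam k p :=
  lt_of_lt_of_le (by norm_num) (half_le_lam hp)

/-- The coupling `s V̂_k k_F⁻¹ / (2 (2π)³)`, the squared coefficient of `v_k`. -/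
noncomputable def coupling (s : ℕ) (V : Mom → ℝ) (kF : ℝ) (k : Mom) : ℝ :=
  s * V k * kF⁻¹ / (2 * (2 * Real.pi) ^ 3)

theorem coupling_nonneg (s : ℕ) {V : Mom → ℝ} {kF : ℝ} {k : Mom} (hV : 0 ≤ V k)
    (hkF : 0 ≤ kF) : 0 ≤ coupling s V kF k := by
  unfold coupling; positivity

/-- `⟨v_k, h_k⁻¹ v_k⟩`. -/
noncomputable def couplingRatio (s : ℕ) (V : Mom → ℝ) (kF : ℝ) (k : Mom) : ℝ :=
  coupling s V kF k * ∑ p ∈ lune kF k, (lam k p)⁻¹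

section Bogoliubov

variable {s : ℕ} {V : Mom → ℝ} {kF : ℝ} {k : Mom}

theorem vVec_mul_self (hV : 0 ≤ V k) (hkF : 0 ≤ kF) (p q : lune kF k) :
    vVec s V kF k p * vVec s V kF k q = coupling s V kF k :=
  Real.mul_self_sqrt (coupling_nonneg s hV hkF)

/-- The argument of the logarithm in `K_k` is the positive solution `E` of `E h_k E = h_k + 2 P_k`,
so the general kernel bounds apply with `v = v_k`. -/
theorem exists_logKernel (s : ℕ) (V : Mom → ℝ) (kF : ℝ) (k : Mom) :
    ∃ E L : LuneMat kF k, LogKernelBounds E L (fun p : lune kF k => lam k p) (vVec s V kF k) ∧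
      E * hOp kF k * E = hOp kF k + (2 : ℝ) • POp s V kF k ∧
      KOp s V kF k = -((1 / 2 : ℝ) • L) := by
  have hl : ∀ p : lune kF k, 0 < lam k p := fun p => lam_pos p.2
  have hh : (hOp kF k).PosDef := Matrix.PosDef.diagonal hl
  have hP : (POp s V kF k).PosSemidef := by
    have := Matrix.posSemidef_vecMulVec_self_star (vVec s V kF k)
    simpa [POp] using this
  have hF : (hOp kF k + (2 : ℝ) • POp s V kF k).PosDef :=
    hh.add_posSemidef (hP.smul two_pos.le)
  obtain ⟨h1, h2⟩ := geometricMean_spec hh hF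
  exact ⟨_, _, logKernelBounds h1 hl (fun _ => Real.sqrt_nonneg _) h2, h2, rfl⟩

theorem sum_vVec_sq_div (hV : 0 ≤ V k) (hkF : 0 ≤ kF) :
    ∑ r : lune kF k, vVec s V kF k r ^ 2 / lam k r = couplingRatio s V kF k := by
  unfold couplingRatio
  rw [Finset.mul_sum, ← Finset.sum_coe_sort (lune kF k)]
  exact Finset.sum_congr rfl fun r _ => by
    rw [sq, vVec_mul_self hV hkF, div_eq_mul_inv]

/-- Entrywise bounds on `K_k`. -/
theorem KOp_bounds (hV : 0 ≤ V k) (hkF : 0 ≤ kF) (p q : lune kF k) :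
    KOp s V kF k p q = KOp s V kF k q p ∧ 0 ≤ -KOp s V kF k p q ∧
    -KOp s V kF k p q ≤ coupling s V kF k / (lam k p + lam k q) ∧
    |-KOp s V kF k p q - coupling s V kF k / (lam k p + lam k q)| ≤
      4 * couplingRatio s V kF k * coupling s V kF k / (lam k p + lam k q) := by
  obtain ⟨E, L, hL, -, hK⟩ := exists_logKernel s V kF k
  have hpos : 0 < lam k p + lam k q := add_pos (lam_pos p.2) (lam_pos q.2)
  have h1 := hL.le p q
  have h2 := hL.ge p q
  rw [vVec_mul_self hV hkF] at h1 h2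
  rw [sum_vVec_sq_div hV hkF] at h2
  have h3 : -KOp s V kF k p q = L p q / 2 := by rw [hK]; simp; ring
  refine ⟨?_, ?_, ?_, ?_⟩
  · rw [hK]; simp [hL.symm p q]
  · rw [h3]; have := hL.nonneg p q; positivity
  · rw [h3, le_div_iff₀ hpos]; linarith
  · rw [h3, div_sub_div _ _ two_ne_zero hpos.ne', abs_div, abs_of_pos (mul_pos two_pos hpos),
      div_le_div_iff₀ (mul_pos two_pos hpos) hpos]
    have h4 : |L p q * (lam k p + lam k q) - 2 * coupling s V kF k| ≤
        8 * couplingRatio s V kF k * coupling s V kF k := by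
      rw [abs_le]; constructor <;> nlinarith
    nlinarith

theorem continuous_BOp (p q : lune kF k) : Continuous fun t : ℝ => BOp s V kF k t p q := by
  -- A submultiplicative norm is chosen only to have continuity of the exponential.
  let : NormedRing (LuneMat kF k) := Matrix.linftyOpNormedRing
  let : NormedAlgebra ℝ (LuneMat kF k) := Matrix.linftyOpNormedAlgebra
  let : NormedAlgebra ℚ (LuneMat kF k) := NormedAlgebra.restrictScalars ℚ ℝ (LuneMat kF k)
  have h1 : Continuous fun t : ℝ => NormedSpace.exp (t • KOp s V kF k) :=
    (NormedSpace.exp_continuous (𝔸 := LuneMat kF k)).comp (by fun_prop)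
  have h2 : Continuous fun t : ℝ => NormedSpace.exp (-(t • KOp s V kF k)) :=
    (NormedSpace.exp_continuous (𝔸 := LuneMat kF k)).comp (by fun_prop)
  have h3 : Continuous fun t : ℝ => BOp s V kF k t := by
    unfold BOp
    fun_prop
  exact (continuous_apply q).comp ((continuous_apply p).comp h3)

/-- Since `e^{tK} E = E e^{tK} = e^{(1-t/2)L}`, `B_k(t)` is half the difference of `e^{aL} h e^{aL}`
at `a = 1 - t/2` and `a = t/2`. With `D = (λ_p + λ_q) L_{pq}` its entry is `½ (1-t) D` plus half the
difference of two remainders in `[0, 2g - D]`. As `0 ≤ 2g - D ≤ 8αg` with `α = ⟨v, h⁻¹ v⟩`, the main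
term and the remainders cost at most `4αg` each. -/
theorem BOp_bound (hV : 0 ≤ V k) (hkF : 0 ≤ kF) (p q : lune kF k) {t : ℝ}
    (ht : t ∈ Set.Icc (0 : ℝ) 1) :
    |BOp s V kF k t p q - (1 - t) * coupling s V kF k| ≤
      8 * couplingRatio s V kF k * coupling s V kF k := by
  obtain ⟨E, L, hL, hE, hK⟩ := exists_logKernel s V kF k
  have e1 : NormedSpace.exp (t • KOp s V kF k) * E = NormedSpace.exp ((1 - t / 2) • L) := by
    rw [← hL.exp_eq, ← Matrix.exp_add_of_commute]
    · congr 1; rw [hK]; module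
    · rw [hK]
      exact (((Commute.refl L).smul_left _).neg_left).smul_left _
  have e2 : E * NormedSpace.exp (t • KOp s V kF k) = NormedSpace.exp ((1 - t / 2) • L) := by
    rw [← hL.exp_eq, ← Matrix.exp_add_of_commute]
    · congr 1; rw [hK]; module
    · rw [hK]
      exact (((Commute.refl L).smul_right _).neg_right).smul_right _
  have e3 : -(t • KOp s V kF k) = (t / 2) • L := by rw [hK]; module
  have e4 : BOp s V kF k t = (1 / 2 : ℝ) •
      (NormedSpace.exp ((1 - t / 2) • L) * hOp kF k * NormedSpace.exp ((1 - t / 2) • L) -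
        NormedSpace.exp ((t / 2) • L) * hOp kF k * NormedSpace.exp ((t / 2) • L)) := by
    unfold BOp
    rw [e3, ← hE]
    congr 2
    calc NormedSpace.exp (t • KOp s V kF k) * (E * hOp kF k * E) *
          NormedSpace.exp (t • KOp s V kF k)
        = (NormedSpace.exp (t • KOp s V kF k) * E) * hOp kF k *
          (E * NormedSpace.exp (t • KOp s V kF k)) := by simp only [Matrix.mul_assoc]
      _ = _ := by rw [e1, e2]
  have m1 : 1 - t / 2 ∈ Set.Icc (0 : ℝ) 1 := ⟨by linarith [ht.2], by linarith [ht.1]⟩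
  have m2 : t / 2 ∈ Set.Icc (0 : ℝ) 1 := ⟨by linarith [ht.1], by linarith [ht.2]⟩
  have r1 := hL.remainder_nonneg _ m1 p q
  have r2 := hL.remainder_le _ m1 p q
  have r3 := hL.remainder_nonneg _ m2 p q
  have r4 := hL.remainder_le _ m2 p q
  have h1 := hL.le p q
  have h2 := hL.ge p q
  rw [vVec_mul_self hV hkF] at h1 h2 r2 r4
  rw [sum_vVec_sq_div hV hkF] at h2
  have e5 := congrFun (congrFun e4 p) q
  rw [Matrix.smul_apply, Matrix.sub_apply, smul_eq_mul] at e5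
  change _ = 1 / 2 * ((NormedSpace.exp ((1 - t / 2) • L) *
    Matrix.diagonal (fun p : lune kF k => lam k p) * NormedSpace.exp ((1 - t / 2) • L)) p q -
    (NormedSpace.exp ((t / 2) • L) *
    Matrix.diagonal (fun p : lune kF k => lam k p) * NormedSpace.exp ((t / 2) • L)) p q) at e5
  generalize (NormedSpace.exp ((1 - t / 2) • L) * Matrix.diagonal (fun p : lune kF k => lam k p) *
    NormedSpace.exp ((1 - t / 2) • L)) p q = A at *
  generalize (NormedSpace.exp ((t / 2) • L) * Matrix.diagonal (fun p : lune kF k => lam k p) *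
    NormedSpace.exp ((t / 2) • L)) p q = B at *
  generalize (Matrix.diagonal (fun p : lune kF k => lam k p)) p q = h0 at *
  generalize (lam k p + lam k q) * L p q = D at *
  rw [e5]
  have ht0 := ht.1
  have ht1 := ht.2
  rw [abs_le]
  constructor <;> nlinarith [mul_nonneg ht0 (sub_nonneg.mpr h1)]

/-- Entrywise bound on `∫₀¹ B_k(t) dt`. -/
theorem integral_BOp_bound (hV : 0 ≤ V k) (hkF : 0 ≤ kF) (p q : lune kF k) :
    |(∫ t in (0 : ℝ)..1, BOp s V kF k t p q) - coupling s V kF k / 2| ≤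
      8 * couplingRatio s V kF k * coupling s V kF k := by
  have h1 : ∫ t in (0 : ℝ)..1, (1 - t) * coupling s V kF k = coupling s V kF k / 2 := by
    rw [intervalIntegral.integral_mul_const, intervalIntegral.integral_sub (by simp) (by simp)]
    simp; ring
  have h2 : (∫ t in (0 : ℝ)..1, BOp s V kF k t p q) - coupling s V kF k / 2 =
      ∫ t in (0 : ℝ)..1, (BOp s V kF k t p q - (1 - t) * coupling s V kF k) := by
    rw [intervalIntegral.integral_sub ((continuous_BOp p q).intervalIntegrable _ _)
      (by apply Continuous.intervalIntegrable; fun_prop), h1]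
  rw [h2, ← Real.norm_eq_abs]
  have h3 := intervalIntegral.norm_integral_le_of_norm_le_const (a := (0 : ℝ)) (b := 1)
    (f := fun t => BOp s V kF k t p q - (1 - t) * coupling s V kF k)
    (C := 8 * couplingRatio s V kF k * coupling s V kF k) (fun t ht => by
      rw [Set.uIoc_of_le zero_le_one] at ht
      exact BOp_bound hV hkF p q ⟨ht.1.le, ht.2⟩)
  simpa using h3

end Bogoliubov

/-! ### Canonical anticommutation relations -/

section CAR

variable {s : ℕ}

theorem ann_apply (m : Mode s) (Ψ : Fock s) (S : Finset (Mode s)) :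
    ann m Ψ S = if m ∈ S then 0 else modeSign S m * Ψ (insert m S) := rfl

theorem modeSign_mul_self (S : Finset (Mode s)) (m : Mode s) :
    modeSign S m * modeSign S m = 1 := by
  unfold modeSign; rw [← mul_pow]; norm_num

theorem star_modeSign (S : Finset (Mode s)) (m : Mode s) :
    (starRingEnd ℂ) (modeSign S m) = modeSign S m := by
  simp [modeSign]

theorem modeSign_insert {S : Finset (Mode s)} {m n : Mode s} (hn : n ∉ S) :
    modeSign (insert n S) m =
      (if Encodable.encode n < Encodable.encode m then -1 else 1) * modeSign S m := by
  unfold modeSign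
  rw [Finset.filter_insert]
  split_ifs with h
  · rw [Finset.card_insert_of_notMem (by simp [hn]), pow_succ]; ring
  · rw [one_mul]

theorem modeSign_insert_self (S : Finset (Mode s)) (m : Mode s) :
    modeSign (insert m S) m = modeSign S m := by
  unfold modeSign
  rw [Finset.filter_insert, if_neg (lt_irrefl _)]

theorem modeSign_erase_self (S : Finset (Mode s)) (m : Mode s) :
    modeSign (S.erase m) m = modeSign S m := by
  by_cases h : m ∈ S
  · rw [← modeSign_insert_self (S.erase m), Finset.insert_erase h]
  · rw [Finset.erase_eq_of_notMem h]

/-- The two orders of inserting distinct modes `m`, `n` have opposite signs. -/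
theorem modeSign_swap {S : Finset (Mode s)} {m n : Mode s} (hmn : m ≠ n) (hm : m ∉ S)
    (hn : n ∉ S) :
    modeSign S m * modeSign (insert m S) n = -(modeSign S n * modeSign (insert n S) m) := by
  rw [modeSign_insert hm, modeSign_insert hn]
  have h : Encodable.encode m ≠ Encodable.encode n := fun h => hmn (Encodable.encode_injective h)
  rcases lt_or_gt_of_ne h with h | h
  · rw [if_pos h, if_neg h.not_gt]; ring
  · rw [if_neg h.not_gt, if_pos h]; ring

/-- The coordinate at `S` is the inner product with the Slater state of `S`, and the adjoint moves
`c_m` onto that state. -/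
theorem cre_apply (m : Mode s) (Ψ : Fock s) (S : Finset (Mode s)) :
    cre m Ψ S = if m ∈ S then modeSign S m * Ψ (S.erase m) else 0 := by
  have h1 : cre m Ψ S = inner ℂ (lp.single 2 S (1 : ℂ)) (cre m Ψ) := by
    rw [lp.inner_single_left]; simp
  have h2 : ann m (lp.single 2 S (1 : ℂ)) =
      if m ∈ S then lp.single 2 (S.erase m) (modeSign S m) else 0 := by
    ext R
    rw [ann_apply]
    by_cases hS : m ∈ S
    · rw [if_pos hS]
      by_cases hR : m ∈ R
      · rw [if_pos hR, lp.single_apply_ne]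
        rintro rfl; simp at hR
      · rw [if_neg hR]
        by_cases hRS : R = S.erase m
        · subst hRS
          rw [Finset.insert_erase hS, lp.single_apply_self, lp.single_apply_self,
            modeSign_erase_self, mul_one]
        · rw [lp.single_apply_ne _ _ _ hRS, lp.single_apply_ne, mul_zero]
          rintro rfl
          exact hRS (Finset.erase_insert hR).symm
    · rw [if_neg hS]
      by_cases hR : m ∈ R
      · rw [if_pos hR]; simp
      · rw [if_neg hR, lp.single_apply_ne, mul_zero]
        · simp
        · rintro rfl; exact hS (Finset.mem_insert_self _ _)
  rw [h1, cre, ContinuousLinearMap.star_eq_adjoint, ContinuousLinearMap.adjoint_inner_right, h2]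
  split_ifs with h
  · rw [lp.inner_single_left]
    simp [RCLike.inner_apply, star_modeSign, mul_comm]
  · simp

theorem ann_ann (m n : Mode s) (Ψ : Fock s) : ann m (ann n Ψ) = -ann n (ann m Ψ) := by
  ext S
  rw [lp.coeFn_neg, Pi.neg_apply, ann_apply, ann_apply, ann_apply, ann_apply]
  by_cases hmn : m = n
  · subst hmn; simp
  by_cases hm : m ∈ S
  · simp [hm]
  by_cases hn : n ∈ S
  · simp [hn]
  rw [if_neg hm, if_neg hn, if_neg (by simp [hn, Ne.symm hmn]), if_neg (by simp [hm, hmn]),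
    Finset.insert_comm, ← mul_assoc, ← mul_assoc, modeSign_swap hmn hm hn]
  ring

theorem cre_cre (m n : Mode s) (Ψ : Fock s) : cre m (cre n Ψ) = -cre n (cre m Ψ) := by
  refine ext_inner_left ℂ fun Φ => ?_
  simp only [cre, ContinuousLinearMap.star_eq_adjoint, inner_neg_right,
    ContinuousLinearMap.adjoint_inner_right]
  rw [ann_ann, inner_neg_left]

theorem ann_cre (m n : Mode s) (Ψ : Fock s) :
    ann m (cre n Ψ) = (if m = n then Ψ else 0) - cre n (ann m Ψ) := by
  ext S
  rw [lp.coeFn_sub, Pi.sub_apply, ann_apply, cre_apply, cre_apply, ann_apply]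
  by_cases hmn : m = n
  · subst hmn
    by_cases hm : m ∈ S
    · simp only [hm, if_true, Finset.mem_insert_self, Finset.mem_erase, ne_eq, not_true_eq_false,
        false_and, if_false, Finset.insert_erase hm, modeSign_erase_self]
      rw [← mul_assoc, modeSign_mul_self]; simp
    · simp only [hm, if_true, if_false, Finset.mem_insert_self, Finset.erase_insert hm,
        modeSign_insert_self]
      rw [← mul_assoc, modeSign_mul_self]; simp
  · rw [if_neg hmn]
    by_cases hm : m ∈ S
    · simp [hm, hmn]
    by_cases hn : n ∈ S
    · obtain ⟨R, hR, rfl⟩ : ∃ R, n ∉ R ∧ S = insert n R :=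
        ⟨S.erase n, Finset.notMem_erase _ _, (Finset.insert_erase hn).symm⟩
      have hmR : m ∉ R := fun h => hm (Finset.mem_insert_of_mem h)
      rw [if_neg hm, if_pos (by simp), if_pos (by simp), Finset.erase_insert hR, if_neg hmR,
        Finset.insert_comm, Finset.erase_insert (by simp [hR, Ne.symm hmn]),
        modeSign_insert_self, modeSign_insert_self, ← mul_assoc, ← mul_assoc]
      have h2 : modeSign (insert n R) m * modeSign (insert m R) n =
          -(modeSign R n * modeSign R m) := by
        rw [modeSign_insert hR, modeSign_insert hmR]
        have h : Encodable.encode m ≠ Encodable.encode n :=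
          fun h => hmn (Encodable.encode_injective h)
        rcases lt_or_gt_of_ne h with h | h
        · rw [if_pos h, if_neg h.not_gt]; ring
        · rw [if_neg h.not_gt, if_pos h]; ring
      rw [h2]; simp
    · simp [hm, hn, Ne.symm hmn]

end CAR

/-! ### Particle-hole states over the Fermi state -/

section FermiState

variable {s : ℕ} {kF : ℝ}

theorem mul_op_apply (X Y : Fock s →L[ℂ] Fock s) (Ψ : Fock s) : (X * Y) Ψ = X (Y Ψ) := rfl

theorem mem_fermiBall {p : Mom} : p ∈ fermiBall kF ↔ len p ≤ kF := by
  simp [fermiBall]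

theorem sqLen_neg (p : Mom) : sqLen (-p) = sqLen p := by simp [sqLen]

theorem len_neg (p : Mom) : len (-p) = len p := by rw [len, len, sqLen_neg]

theorem neg_mem_fermiBall {p : Mom} : -p ∈ fermiBall kF ↔ p ∈ fermiBall kF := by
  rw [mem_fermiBall, mem_fermiBall, len_neg]

theorem mem_lune_iff {k p : Mom} :
    p ∈ lune kF k ↔ p - k ∈ fermiBall kF ∧ p ∉ fermiBall kF := by
  rw [mem_lune, mem_fermiBall, mem_fermiBall, not_le]

theorem ann_fermiState {m : Mode s} (hm : m.1 ∉ fermiBall kF) : ann m (fermiState s kF) = 0 := by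
  ext S
  rw [ann_apply]
  split_ifs with h
  · simp
  · rw [fermiState, lp.single_apply_ne, mul_zero]
    · simp
    · intro hS
      have : m ∈ insert m S := Finset.mem_insert_self _ _
      rw [hS, Finset.mem_product] at this
      exact hm this.1

theorem cre_fermiState {m : Mode s} (hm : m.1 ∈ fermiBall kF) : cre m (fermiState s kF) = 0 := by
  ext S
  rw [cre_apply]
  split_ifs with h
  · rw [fermiState, lp.single_apply_ne, mul_zero]
    · simp
    · intro hS
      have : m ∉ S.erase m := Finset.notMem_erase _ _
      rw [hS, Finset.mem_product] at this
      exact this ⟨hm, Finset.mem_univ _⟩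
  · simp

theorem inner_fermiState_self : inner ℂ (fermiState s kF) (fermiState s kF) = 1 := by
  rw [fermiState, lp.inner_single_left]; simp

theorem inner_cre_left (m : Mode s) (Φ Ψ : Fock s) :
    inner ℂ (cre m Φ) Ψ = inner ℂ Φ (ann m Ψ) := by
  rw [cre, ContinuousLinearMap.star_eq_adjoint, ContinuousLinearMap.adjoint_inner_left]

theorem inner_ann_left (m : Mode s) (Φ Ψ : Fock s) :
    inner ℂ (ann m Φ) Ψ = inner ℂ Φ (cre m Ψ) := by
  rw [cre, ContinuousLinearMap.star_eq_adjoint, ContinuousLinearMap.adjoint_inner_right]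

/-- The particle-hole excitation `c_m^* c_h ψ_F`. -/
noncomputable def pairState (kF : ℝ) (m h : Mode s) : Fock s := cre m (ann h (fermiState s kF))

/-- After moving the left pair to the right argument, the anticommutation relations leave Kronecker
deltas, and the other terms contain `c_m ψ_F = 0` or `c_h^* ψ_F = 0`. Only the left pair must be a
genuine particle and hole. -/
theorem inner_pairState {m m' h h' : Mode s} (hm : m.1 ∉ fermiBall kF)
    (hh : h.1 ∈ fermiBall kF) :
    inner ℂ (pairState kF m h) (pairState kF m' h') = if m = m' ∧ h = h' then 1 else 0 := by
  unfold pairState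
  rw [inner_cre_left, ann_cre, ann_ann m h', ann_fermiState hm]
  simp only [map_zero, neg_zero, sub_zero]
  by_cases hmm : m = m'
  · rw [if_pos hmm, inner_ann_left]
    have h1 : cre h (ann h' (fermiState s kF)) = if h' = h then fermiState s kF else 0 := by
      have := ann_cre h' h (fermiState s kF)
      rw [cre_fermiState hh, map_zero, eq_comm, sub_eq_zero] at this
      exact this.symm
    rw [h1]
    by_cases hhh : h' = h
    · rw [if_pos hhh, if_pos ⟨hmm, hhh.symm⟩, inner_fermiState_self]
    · rw [if_neg hhh, if_neg fun h => hhh h.2.symm, inner_zero_right]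
  · rw [if_neg hmm, if_neg fun h => hmm h.1, inner_zero_right]

/-- The first summand of `ε` moves the hole from `h` to `a`. The two sign changes cancel. -/
theorem ann_cre_pairState {a b m h : Mode s} (ha : a.1 ∈ fermiBall kF) (hb : b.1 ∈ fermiBall kF)
    (hm : m.1 ∉ fermiBall kF) :
    ann a (cre b (pairState kF m h)) = if b = h then pairState kF m a else 0 := by
  have h1 : cre b (ann h (fermiState s kF)) = if h = b then fermiState s kF else 0 := by
    have := ann_cre h b (fermiState s kF)
    rw [cre_fermiState hb, map_zero, eq_comm, sub_eq_zero] at this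
    exact this.symm
  unfold pairState
  rw [cre_cre, h1]
  by_cases hbh : b = h
  · rw [if_pos hbh, if_pos hbh.symm, map_neg, ann_cre, if_neg (by rintro rfl; exact hm ha)]
    simp
  · rw [if_neg hbh, if_neg (Ne.symm hbh)]; simp

/-- The second summand of `ε` moves the particle from `m` to `n`. -/
theorem cre_ann_pairState {n r m h : Mode s} (hr : r.1 ∉ fermiBall kF) :
    cre n (ann r (pairState kF m h)) = if r = m then pairState kF n h else 0 := by
  unfold pairState
  rw [ann_cre, ann_ann r h, ann_fermiState hr]
  by_cases hrm : r = m
  · rw [if_pos hrm, if_pos hrm]; simp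
  · rw [if_neg hrm, if_neg hrm]; simp

theorem excCre_fermiState (k p : Mom) : excCre s k p (fermiState s kF) =
    ((Real.sqrt s)⁻¹ : ℂ) • ∑ σ : Fin s, pairState kF (p, σ) (p - k, σ) := by
  simp [excCre, pairState]

theorem excAnn_fermiState {k p : Mom} (hp : p ∈ lune kF k) :
    excAnn s k p (fermiState s kF) = 0 := by
  have h := (mem_lune_iff.mp hp).2
  simp only [excAnn, smul_apply, sum_apply,
    mul_op_apply]
  simp [ann_fermiState (s := s) (m := (p, _)) h]

theorem inner_excAnn (k p : Mom) (Φ Ψ : Fock s) :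
    inner ℂ Φ (excAnn s k p Ψ) = inner ℂ (excCre s k p Φ) Ψ := by
  simp only [excAnn, excCre, smul_apply, sum_apply,
    inner_smul_left, inner_smul_right, sum_inner, inner_sum]
  congr 1
  · simp
  · refine Finset.sum_congr rfl fun σ _ => ?_
    rw [mul_op_apply, mul_op_apply, inner_cre_left, inner_ann_left]

theorem inner_excCre_fermiState (hs : 1 ≤ s) {k p r : Mom} (hp : p ∈ lune kF k) :
    inner ℂ (excCre s k p (fermiState s kF)) (excCre s k r (fermiState s kF)) =
      if p = r then 1 else 0 := by
  have hp' := mem_lune_iff.mp hp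
  rw [excCre_fermiState, excCre_fermiState]
  simp only [inner_smul_left, inner_smul_right, sum_inner, inner_sum]
  have h1 : ∀ σ τ : Fin s, inner ℂ (pairState kF (p, σ) (p - k, σ))
      (pairState kF (r, τ) (r - k, τ)) = if p = r ∧ τ = σ then (1 : ℂ) else 0 := by
    intro σ τ
    rw [inner_pairState hp'.2 hp'.1]
    congr 1
    simp only [Prod.mk.injEq, sub_left_inj, eq_iff_iff]
    tauto
  simp only [h1]
  have hs0 : (Real.sqrt s : ℂ) ≠ 0 := by
    have : 0 < Real.sqrt s := Real.sqrt_pos.mpr (by exact_mod_cast hs)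
    exact_mod_cast this.ne'
  have hss : (Real.sqrt s : ℂ) * (Real.sqrt s : ℂ) = s := by
    rw [← Complex.ofReal_mul, Real.mul_self_sqrt (Nat.cast_nonneg s)]; simp
  by_cases hpr : p = r
  · simp only [hpr, true_and, if_true, Finset.sum_ite_eq, Finset.mem_univ,
      Finset.sum_const, Finset.card_univ, Fintype.card_fin, nsmul_eq_mul, mul_one, map_inv₀,
      Complex.conj_ofReal]
    rw [← hss]; field_simp
  · simp [hpr]

/-- The Fermi ball is symmetric, so `-p + k` lies inside and `-p` outside. Each summand has on the
right a creator or an annihilator that kills `ψ_F`. -/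
theorem exchCorr_fermiState {k l p q : Mom} (hp : p ∈ lune kF k) :
    exchCorr s (-k) (-l) (-p) (-q) (fermiState s kF) = 0 := by
  obtain ⟨h1, h2⟩ := mem_lune_iff.mp hp
  have h3 : ∀ σ : Fin s, cre (-p - -k, σ) (fermiState s kF) = 0 := fun σ =>
    cre_fermiState (by
      change -p - -k ∈ fermiBall kF
      rwa [show -p - -k = -(p - k) by abel, neg_mem_fermiBall])
  have h4 : ∀ σ : Fin s, ann (-p, σ) (fermiState s kF) = 0 := fun σ =>
    ann_fermiState (by change -p ∉ fermiBall kF; rwa [neg_mem_fermiBall])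
  unfold exchCorr
  rw [neg_apply, smul_apply,
    sum_apply]
  rw [Finset.sum_eq_zero, smul_zero, neg_zero]
  intro σ _
  have e1 : (ann (-q - -l, σ) * cre (-p - -k, σ)) (fermiState s kF) = 0 := by
    rw [mul_op_apply, h3, map_zero]
  have e2 : (cre (-q, σ) * ann (-p, σ)) (fermiState s kF) = 0 := by
    rw [mul_op_apply, h4, map_zero]
  rw [add_apply, ← add_zero (0 : Fock s)]
  congr 1
  · split_ifs
    · exact e1
    · rfl
  · split_ifs
    · exact e2
    · rfl

/-- The exchange correction maps a particle-hole excitation of momentum `l` to one of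
momentum `k`. -/
theorem exchCorr_excCre_fermiState {k l p q q' : Mom} (hp : p ∈ lune kF k)
    (hq : q ∈ lune kF l) (hq' : q' ∈ lune kF l) :
    exchCorr s (-k) (-l) (-p) (-q) (excCre s l q' (fermiState s kF)) =
      -((s : ℂ)⁻¹ • ((if p = q ∧ p + q' = k + l then excCre s k q' (fermiState s kF) else 0) +
        if p - k = q - l ∧ q' = -p then excCre s k (-q) (fermiState s kF) else 0)) := by
  obtain ⟨hp1, hp2⟩ := mem_lune_iff.mp hp
  obtain ⟨hq1, hq2⟩ := mem_lune_iff.mp hq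
  obtain ⟨hr1, hr2⟩ := mem_lune_iff.mp hq'
  have hp1' : -p - -k ∈ fermiBall kF := by
    rwa [show -p - -k = -(p - k) by abel, neg_mem_fermiBall]
  have hq1' : -q - -l ∈ fermiBall kF := by
    rwa [show -q - -l = -(q - l) by abel, neg_mem_fermiBall]
  have hp2' : -p ∉ fermiBall kF := by rwa [neg_mem_fermiBall]
  have e1 : ∀ σ τ : Fin s, (ann (-q - -l, σ) * cre (-p - -k, σ)) (pairState kF (q', τ) (q' - l, τ)) =
      if p + q' = k + l ∧ τ = σ then pairState kF (q', σ) (-q - -l, σ) else 0 := by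
    intro σ τ
    rw [mul_op_apply, ann_cre_pairState (a := (-q - -l, σ)) (b := (-p - -k, σ)) hq1' hp1' hr2]
    have : ((-p - -k, σ) = (q' - l, τ)) ↔ (p + q' = k + l ∧ τ = σ) := by
      rw [Prod.mk.injEq]
      refine and_congr ⟨fun h => ?_, fun h => ?_⟩ eq_comm
      · have : p + q' = p + (q' - l) + l := by abel
        rw [this, ← h]; abel
      · have : q' = k + l - p := by rw [← h]; abel
        rw [this]; abel
    by_cases h : p + q' = k + l ∧ τ = σ
    · rw [if_pos h, if_pos (this.mpr h), h.2]
    · rw [if_neg h, if_neg (mt this.mp h)]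
  have e2 : ∀ σ τ : Fin s, (cre (-q, σ) * ann (-p, σ)) (pairState kF (q', τ) (q' - l, τ)) =
      if q' = -p ∧ τ = σ then pairState kF (-q, σ) (q' - l, σ) else 0 := by
    intro σ τ
    rw [mul_op_apply, cre_ann_pairState (r := (-p, σ)) hp2']
    have : ((-p, σ) = (q', τ)) ↔ (q' = -p ∧ τ = σ) := by
      rw [Prod.mk.injEq]; exact and_congr eq_comm eq_comm
    by_cases h : q' = -p ∧ τ = σ
    · rw [if_pos h, if_pos (this.mpr h), h.2]
    · rw [if_neg h, if_neg (mt this.mp h)]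
  rw [excCre_fermiState, excCre_fermiState, excCre_fermiState, map_smul, exchCorr,
    neg_apply, smul_apply, sum_apply]
  have e3 : ∀ σ : Fin s, ((if -p = -q then ann (-q - -l, σ) * cre (-p - -k, σ) else 0) +
      (if -p - -k = -q - -l then cre (-q, σ) * ann (-p, σ) else 0) : Fock s →L[ℂ] Fock s)
      (∑ τ : Fin s, pairState kF (q', τ) (q' - l, τ)) =
      (if p = q ∧ p + q' = k + l then pairState kF (q', σ) (q' - k, σ) else 0) +
        if p - k = q - l ∧ q' = -p then pairState kF (-q, σ) (-q - k, σ) else 0 := by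
    intro σ
    rw [add_apply]
    congr 1
    · by_cases hpq : p = q
      · rw [if_pos (by rw [hpq]), map_sum]
        simp only [e1]
        by_cases h : p + q' = k + l
        · have : -q - -l = q' - k := by
            have : q' = k + l - p := by rw [← h]; abel
            rw [this, hpq]; abel
          simp [hpq ▸ h, hpq, this]
        · simp [h]
      · rw [if_neg (by simpa using hpq), if_neg fun h => hpq h.1]; simp
    · have hiff : -p - -k = -q - -l ↔ p - k = q - l := by
        rw [show -p - -k = -(p - k) by abel, show -q - -l = -(q - l) by abel, neg_inj]
      by_cases hpq : p - k = q - l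
      · rw [if_pos (hiff.mpr hpq), map_sum]
        simp only [e2]
        by_cases h : q' = -p
        · have : -p - l = -q - k := by
            have : p = q - l + k := by rw [← hpq]; abel
            rw [this]; abel
          simp [h, hpq, this]
        · simp [h]
      · rw [if_neg (mt hiff.mp hpq), if_neg fun h => hpq h.1]; simp
  simp only [e3, Finset.sum_add_distrib]
  rw [smul_neg, smul_comm, smul_add]
  congr 3
  · split_ifs <;> simp
  · split_ifs <;> simp

end FermiState

/-! ### The expectation of the exchange operator in the Fermi state -/

section Expectation

variable {s : ℕ} {V : Mom → ℝ} {kF : ℝ}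

/-- The matrix of an operator on `ℓ²(L_k)`, extended by zero to `ℤ³ × ℤ³`. -/
noncomputable def matExt {k : Mom} (A : LuneMat kF k) (p q : Mom) : ℝ :=
  if h : p ∈ lune kF k ∧ q ∈ lune kF k then A ⟨p, h.1⟩ ⟨q, h.2⟩ else 0

theorem matExt_coe {k : Mom} (A : LuneMat kF k) (p q : lune kF k) : matExt A p q = A p q := by
  rw [matExt, dif_pos ⟨p.2, q.2⟩]

theorem matExt_of_mem {k : Mom} (A : LuneMat kF k) {p q : Mom} (hp : p ∈ lune kF k)
    (hq : q ∈ lune kF k) : matExt A p q = A ⟨p, hp⟩ ⟨q, hq⟩ := by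
  rw [matExt, dif_pos ⟨hp, hq⟩]

theorem matExt_of_notMem {k : Mom} (A : LuneMat kF k) {p q : Mom}
    (h : ¬(p ∈ lune kF k ∧ q ∈ lune kF k)) : matExt A p q = 0 := dif_neg h

theorem sum_lune_ite {k : Mom} (A : LuneMat kF k) (a b : Mom) :
    ∑ q : lune kF k, ∑ q' : lune kF k, A q' q * (if (q : Mom) = a ∧ (q' : Mom) = b then 1 else 0) =
      matExt A b a := by
  by_cases h : b ∈ lune kF k ∧ a ∈ lune kF k
  · rw [Finset.sum_eq_single ⟨a, h.2⟩, Finset.sum_eq_single ⟨b, h.1⟩]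
    · simp [matExt_of_mem A h.1 h.2]
    · intro q' _ hq'
      rw [if_neg, mul_zero]
      exact fun hh => hq' (Subtype.ext hh.2)
    · simp
    · intro q _ hq
      refine Finset.sum_eq_zero fun q' _ => ?_
      rw [if_neg, mul_zero]
      exact fun hh => hq (Subtype.ext hh.1)
    · simp
  · rw [matExt_of_notMem A h]
    refine Finset.sum_eq_zero fun q _ => Finset.sum_eq_zero fun q' _ => ?_
    rw [if_neg, mul_zero]
    exact fun hh => h ⟨hh.2 ▸ q'.2, hh.1 ▸ q.2⟩

theorem genAnn_fermiState {k : Mom} (φ : lune kF k → ℝ) :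
    genAnn s kF k φ (fermiState s kF) = 0 := by
  rw [genAnn, sum_apply]
  refine Finset.sum_eq_zero fun p _ => ?_
  rw [smul_apply, excAnn_fermiState p.2, smul_zero]

/-- Only the middle ordering of the double anticommutator survives on the Fermi state. -/
theorem exch2Term_fermiState (k l : Mom) (B : LuneMat kF k) :
    exch2Term s V kF k B l (fermiState s kF) =
      (1 / 2 : ℂ) • ∑ p : lune kF k, ∑ q : lune kF l, genAnn s kF k (B.col p)
        (exchCorr s (-k) (-l) (-p) (-q)
          (genCre s kF l ((KOp s V kF l).col q) (fermiState s kF))) := by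
  rw [exch2Term, smul_apply, sum_apply]
  congr 1
  refine Finset.sum_congr rfl fun p _ => ?_
  rw [sum_apply]
  refine Finset.sum_congr rfl fun q _ => ?_
  -- The other three orderings have `b_k` or `ε` acting directly on `ψ_F`, or act after `b_k ψ_F =
  -- 0`.
  simp only [anticomm, add_apply, mul_op_apply, genAnn_fermiState, exchCorr_fermiState p.2,
    map_zero, add_zero]

theorem exchCorr_genCre_fermiState {k l p q : Mom} (hp : p ∈ lune kF k)
    (hq : q ∈ lune kF l) (χ : lune kF l → ℝ) :
    exchCorr s (-k) (-l) (-p) (-q) (genCre s kF l χ (fermiState s kF)) =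
      ∑ q' : lune kF l, (χ q' : ℂ) •
      -((s : ℂ)⁻¹ • ((if p = q ∧ p + q' = k + l then excCre s k q' (fermiState s kF) else 0) +
        if p - k = q - l ∧ (q' : Mom) = -p then excCre s k (-q) (fermiState s kF) else 0)) := by
  rw [genCre, sum_apply, map_sum]
  refine Finset.sum_congr rfl fun q' _ => ?_
  rw [smul_apply, map_smul, exchCorr_excCre_fermiState hp hq q'.2]

/-- A term of `ℰ²_k(B) ψ_F` vanishes unless `L_l` meets `L_k` or `-L_k`. -/
theorem exch2Term_fermiState_eq_zero {k l : Mom} (B : LuneMat kF k)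
    (h : ∀ p ∈ lune kF k, p ∉ lune kF l ∧ -p ∉ lune kF l) :
    exch2Term s V kF k B l (fermiState s kF) = 0 := by
  rw [exch2Term_fermiState, Finset.sum_eq_zero, smul_zero]
  refine fun p _ => Finset.sum_eq_zero fun q _ => ?_
  rw [exchCorr_genCre_fermiState p.2 q.2, Finset.sum_eq_zero, map_zero]
  intro q' _
  have h1 : ¬((p : Mom) = q ∧ (p : Mom) + q' = k + l) := fun hh => (h p p.2).1 (hh.1 ▸ q.2)
  have h2 : ¬((p : Mom) - k = q - l ∧ (q' : Mom) = -p) := fun hh => (h p p.2).2 (hh.2 ▸ q'.2)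
  rw [if_neg h1, if_neg h2]
  simp

theorem finite_lune_inter (kF : ℝ) (p : Mom) : {l : Mom | p ∈ lune kF l}.Finite := by
  refine (finite_ball kF p).subset fun l hl => ?_
  have := (mem_lune.mp hl).1
  rw [Set.mem_ofPred_eq, ← len_neg, neg_sub]
  exact this

/-- Outside this set all terms vanish on `ψ_F`. It depends neither on the operator nor on `t`, so
for fixed `k` the sum over `l` is a finite sum with a common index set, and commutes with limits and
integrals. -/
theorem finite_support_exch2Term (kF : ℝ) (k : Mom) :
    {l : MomStar | ∃ p ∈ lune kF k, p ∈ lune kF l ∨ -p ∈ lune kF l}.Finite := by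
  have h1 : {l : Mom | ∃ p ∈ lune kF k, p ∈ lune kF l ∨ -p ∈ lune kF l}.Finite := by
    have : {l : Mom | ∃ p ∈ lune kF k, p ∈ lune kF l ∨ -p ∈ lune kF l} =
        ⋃ p ∈ lune kF k, ({l : Mom | p ∈ lune kF l} ∪ {l : Mom | -p ∈ lune kF l}) := by
      ext l; simp
    rw [this]
    exact Set.Finite.biUnion (lune kF k).finite_toSet fun p _ =>
      (finite_lune_inter kF p).union (finite_lune_inter kF (-p))
  exact Set.Finite.of_finite_image (f := Subtype.val)
    (h1.subset (by rintro _ ⟨l, hl, rfl⟩; exact hl)) Subtype.val_injective.injOn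

theorem exch2Term_eq_zero_of_notMem {k : Mom} (B : LuneMat kF k) {l : MomStar}
    (hl : l ∉ (finite_support_exch2Term kF k).toFinset) :
    exch2Term s V kF k B l (fermiState s kF) = 0 := by
  refine exch2Term_fermiState_eq_zero B fun p hp => ?_
  simp only [Set.Finite.mem_toFinset, Set.mem_ofPred_eq, not_exists, not_and, not_or] at hl
  exact hl p hp

theorem summable_exch2Term (k : Mom) (B : LuneMat kF k) :
    Summable fun l : MomStar => exch2Term s V kF k B l (fermiState s kF) :=
  summable_of_ne_finset_zero (s := (finite_support_exch2Term kF k).toFinset)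
    fun _ hl => exch2Term_eq_zero_of_notMem B hl

theorem inner_genAnn {k : Mom} (φ : lune kF k → ℝ) (Φ Ψ : Fock s) :
    inner ℂ Φ (genAnn s kF k φ Ψ) = ∑ p : lune kF k, (φ p : ℂ) * inner ℂ (excCre s k p Φ) Ψ := by
  rw [genAnn, sum_apply, inner_sum]
  refine Finset.sum_congr rfl fun p _ => ?_
  rw [smul_apply, inner_smul_right, inner_excAnn]

/-- The expectation of a term of `ℰ²_k(B)` in the Fermi state. -/
theorem inner_exch2Term (hs : 1 ≤ s) (k l : Mom) (B : LuneMat kF k) :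
    inner ℂ (fermiState s kF) (exch2Term s V kF k B l (fermiState s kF)) =
      ((-(2 * s : ℝ)⁻¹ * ∑ p ∈ lune kF k, ∑ q ∈ lune kF k, matExt B q p *
        ((if p + q = k + l then matExt (KOp s V kF l) q p else 0) +
          if p + q = k - l then matExt (KOp s V kF l) (-p) (-q) else 0) : ℝ) : ℂ) := by
  -- Orthonormality fixes `p'` as the particle momentum after `ε` has acted: the first delta forces
  -- `(q, q') = (p, p')`, the second `(q, q') = (-p', -p)`.
  have key : ∀ (p : lune kF k) (q : lune kF l),
      inner ℂ (fermiState s kF) (genAnn s kF k (B.col p) (exchCorr s (-k) (-l) (-p) (-q)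
          (genCre s kF l ((KOp s V kF l).col q) (fermiState s kF)))) =
      ((-(s : ℝ)⁻¹ * ∑ p' : lune kF k, B p' p * ∑ q' : lune kF l, KOp s V kF l q' q *
        ((if (p : Mom) + p' = k + l then 1 else 0) *
            (if (q : Mom) = p ∧ (q' : Mom) = p' then 1 else 0) +
          (if (p : Mom) + p' = k - l then 1 else 0) *
            (if (q : Mom) = -p' ∧ (q' : Mom) = -p then 1 else 0)) : ℝ) : ℂ) := by
    intro p q
    rw [inner_genAnn, exchCorr_genCre_fermiState p.2 q.2]
    push_cast
    rw [Finset.mul_sum]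
    refine Finset.sum_congr rfl fun p' _ => ?_
    rw [inner_sum, Finset.mul_sum, Finset.mul_sum, Finset.mul_sum]
    refine Finset.sum_congr rfl fun q' _ => ?_
    have h1 : inner ℂ (excCre s k p' (fermiState s kF))
        (if (p : Mom) = q ∧ (p : Mom) + q' = k + l then excCre s k q' (fermiState s kF) else 0) =
        (if (p : Mom) + p' = k + l then 1 else 0) *
            (if (q : Mom) = p ∧ (q' : Mom) = p' then 1 else 0 : ℂ) := by
      by_cases h : (p : Mom) = q ∧ (p : Mom) + q' = k + l
      · rw [if_pos h, inner_excCre_fermiState hs p'.2]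
        by_cases h2 : (p' : Mom) = q'
        · rw [if_pos h2, if_pos (h2 ▸ h.2), if_pos ⟨h.1.symm, h2.symm⟩, one_mul]
        · rw [if_neg h2, if_neg (c := (q : Mom) = p ∧ _) (fun hh => h2 hh.2.symm), mul_zero]
      · rw [if_neg h, inner_zero_right]
        by_cases h2 : (q : Mom) = p ∧ (q' : Mom) = p'
        · rw [if_neg fun hh => h ⟨h2.1.symm, by rw [h2.2]; exact hh⟩, zero_mul]
        · rw [if_neg h2, mul_zero]
    have h2 : inner ℂ (excCre s k p' (fermiState s kF))
        (if (p : Mom) - k = q - l ∧ (q' : Mom) = -p then excCre s k (-q) (fermiState s kF)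
          else 0) =
        (if (p : Mom) + p' = k - l then 1 else 0) *
            (if (q : Mom) = -p' ∧ (q' : Mom) = -p then 1 else 0 : ℂ) := by
      by_cases h : (p : Mom) - k = q - l ∧ (q' : Mom) = -p
      · rw [if_pos h, inner_excCre_fermiState hs p'.2]
        by_cases h3 : (p' : Mom) = -q
        · have h4 : (p : Mom) + p' = k - l := by
            have : (p : Mom) = q - l + k := by rw [← h.1]; abel
            rw [h3, this]; abel
          rw [if_pos h3, if_pos h4, if_pos ⟨by rw [h3, neg_neg], h.2⟩, one_mul]
        · rw [if_neg h3, if_neg (c := (q : Mom) = -p' ∧ _)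
            (fun hh => h3 (by rw [hh.1, neg_neg])), mul_zero]
      · rw [if_neg h, inner_zero_right]
        by_cases h3 : (q : Mom) = -p' ∧ (q' : Mom) = -p
        · rw [if_neg, zero_mul]
          intro hh
          refine h ⟨?_, h3.2⟩
          have : (p : Mom) = k - l - p' := by rw [← hh]; abel
          rw [h3.1, this]; abel
        · rw [if_neg h3, mul_zero]
    rw [inner_smul_right, inner_neg_right, inner_smul_right, inner_add_right, h1, h2]
    simp only [Matrix.col_apply, apply_ite Complex.ofReal, Complex.ofReal_one,
      Complex.ofReal_zero]
    ring
  rw [exch2Term_fermiState, inner_smul_right, inner_sum]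
  have h3 : ∀ p : lune kF k, inner ℂ (fermiState s kF) (∑ q : lune kF l,
      genAnn s kF k (B.col p) (exchCorr s (-k) (-l) (-p) (-q)
          (genCre s kF l ((KOp s V kF l).col q) (fermiState s kF)))) =
      ((-(s : ℝ)⁻¹ * ∑ p' : lune kF k, B p' p *
        ((if (p : Mom) + p' = k + l then matExt (KOp s V kF l) p' p else 0) +
          if (p : Mom) + p' = k - l then matExt (KOp s V kF l) (-p) (-p') else 0) : ℝ) : ℂ) := by
    intro p
    rw [inner_sum]
    simp only [key]
    rw [← Complex.ofReal_sum]
    congr 1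
    rw [← Finset.mul_sum, Finset.sum_comm]
    congr 1
    refine Finset.sum_congr rfl fun p' _ => ?_
    rw [← Finset.mul_sum]
    congr 1
    have h4 := sum_lune_ite (KOp s V kF l) (p : Mom) (p' : Mom)
    have h5 := sum_lune_ite (KOp s V kF l) (-p' : Mom) (-p : Mom)
    rw [← h4, ← h5]
    simp only [mul_add, Finset.sum_add_distrib]
    congr 1
    · split_ifs <;> simp
    · split_ifs <;> simp
  simp only [h3]
  rw [← Complex.ofReal_sum, ← Finset.mul_sum, ← Finset.sum_coe_sort (lune kF k)]
  have h6 : ∀ p : lune kF k, ∑ q ∈ lune kF k, matExt B q p *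
        ((if (p : Mom) + q = k + l then matExt (KOp s V kF l) q p else 0) +
          if (p : Mom) + q = k - l then matExt (KOp s V kF l) (-p) (-q) else 0) =
      ∑ p' : lune kF k, B p' p *
        ((if (p : Mom) + p' = k + l then matExt (KOp s V kF l) p' p else 0) +
          if (p : Mom) + p' = k - l then matExt (KOp s V kF l) (-p) (-p') else 0) := by
    intro p
    rw [← Finset.sum_coe_sort (lune kF k)]
    refine Finset.sum_congr rfl fun p' _ => ?_
    rw [matExt_coe]
  simp only [h6]
  push_cast
  rw [mul_inv]
  ring

/-- The expectation of `2 Re(ℰ²_k(B))` in the Fermi state. -/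
theorem fermiExch2_hasSum (hs : 1 ≤ s) (k : Mom) (B : LuneMat kF k) :
    HasSum (fun l : MomStar => -(s : ℝ)⁻¹ * ∑ p ∈ lune kF k, ∑ q ∈ lune kF k, matExt B q p *
        ((if p + q = k + l then matExt (KOp s V kF l) q p else 0) +
          if p + q = k - l then matExt (KOp s V kF l) (-p) (-q) else 0))
      (fermiExch2 s V kF k B) := by
  have h1 := (summable_exch2Term (V := V) (s := s) k B).hasSum
  have h2 := h1.mapL (innerSL ℂ (fermiState s kF))
  have h3 := (h2.mapL Complex.reCLM).mul_left 2
  have h4 : (fun l : MomStar => 2 * Complex.reCLM (innerSL ℂ (fermiState s kF)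
      (exch2Term s V kF k B l (fermiState s kF)))) = fun l : MomStar =>
      -(s : ℝ)⁻¹ * ∑ p ∈ lune kF k, ∑ q ∈ lune kF k, matExt B q p *
        ((if p + q = k + l then matExt (KOp s V kF l) q p else 0) +
          if p + q = k - l then matExt (KOp s V kF l) (-p) (-q) else 0) := by
    funext l
    rw [innerSL_apply_apply, inner_exch2Term hs, Complex.reCLM_apply, Complex.ofReal_re, mul_inv]
    ring
  rw [h4] at h3
  exact h3

end Expectation

/-! ### Volumes of slabs and lattice point counting -/

open MeasureTheory in
-- The area depends only on the difference of the squared radii. For `a ≤ 0 ≤ b` the set is a disc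
-- of area `π b ≤ π (b - a)`.
theorem volume_annulus_le (a b : ℝ) (hab : a ≤ b) :
    volume {y : Fin 2 → ℝ | a ≤ ∑ i, y i ^ 2 ∧ ∑ i, y i ^ 2 ≤ b} ≤
      ENNReal.ofReal (Real.pi * (b - a)) := by
  have hmp : MeasurePreserving (MeasurableEquiv.toLp 2 (Fin 2 → ℝ)) volume volume :=
    (EuclideanSpace.volume_preserving_symm_measurableEquiv_toLp (Fin 2)).symm
  rcases lt_or_ge b 0 with hb | hb
  · have : {y : Fin 2 → ℝ | a ≤ ∑ i, y i ^ 2 ∧ ∑ i, y i ^ 2 ≤ b} = ∅ := by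
      ext y
      simp only [Set.mem_ofPred_eq, Set.mem_empty_iff_false, iff_false, not_and, not_le]
      exact fun _ => hb.trans_le (Finset.sum_nonneg fun i _ => sq_nonneg _)
    rw [this]; simp
  have hsub : {y : Fin 2 → ℝ | a ≤ ∑ i, y i ^ 2 ∧ ∑ i, y i ^ 2 ≤ b} ⊆
      (MeasurableEquiv.toLp 2 (Fin 2 → ℝ)) ⁻¹'
        (Metric.closedBall (0 : EuclideanSpace ℝ (Fin 2)) (Real.sqrt b) \
          Metric.ball 0 (Real.sqrt a)) := by
    intro y hy
    have hn : ‖WithLp.toLp 2 y‖ = Real.sqrt (∑ i, y i ^ 2) := by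
      rw [EuclideanSpace.norm_eq]; simp
    refine ⟨?_, ?_⟩
    · rw [mem_closedBall_zero_iff]
      exact hn.trans_le (Real.sqrt_le_sqrt hy.2)
    · rw [mem_ball_zero_iff, not_lt]
      exact (Real.sqrt_le_sqrt hy.1).trans hn.ge
  refine (measure_mono hsub).trans ?_
  rw [hmp.measure_preimage
    ((measurableSet_closedBall.diff measurableSet_ball).nullMeasurableSet)]
  rcases le_or_gt a 0 with ha | ha
  · refine (measure_mono Set.sdiff_subset).trans ?_
    rw [EuclideanSpace.volume_closedBall_fin_two, ← ENNReal.ofReal_pow (Real.sqrt_nonneg _),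
      Real.sq_sqrt hb, ← ENNReal.ofReal_mul hb]
    refine ENNReal.ofReal_le_ofReal ?_
    nlinarith [Real.pi_pos]
  · rw [measure_sdiff (Metric.ball_subset_closedBall.trans
      (Metric.closedBall_subset_closedBall (Real.sqrt_le_sqrt hab)))
      measurableSet_ball.nullMeasurableSet measure_ball_lt_top.ne,
      EuclideanSpace.volume_closedBall_fin_two, EuclideanSpace.volume_ball_fin_two,
      ← ENNReal.ofReal_pow (Real.sqrt_nonneg _), ← ENNReal.ofReal_pow (Real.sqrt_nonneg _),
      Real.sq_sqrt hb, Real.sq_sqrt ha.le, ← ENNReal.ofReal_mul hb, ← ENNReal.ofReal_mul ha.le,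
      ← ENNReal.ofReal_sub _ (mul_nonneg ha.le Real.pi_pos.le)]
    exact ENNReal.ofReal_le_ofReal (le_of_eq (by ring))

open MeasureTheory in
/-- The volume of a region whose section orthogonal to a unit vector is an annulus. -/
theorem volume_slab_le {u : Fin 3 → ℝ} (hu : ∑ i, u i ^ 2 = 1) (φ : ℝ → ℝ) (hφ : Continuous φ)
    {a b c d : ℝ} (hab : a ≤ b) :
    volume {z : Fin 3 → ℝ | (c ≤ ∑ i, u i * z i ∧ ∑ i, u i * z i ≤ d) ∧
      a ≤ ∑ i, z i ^ 2 - φ (∑ i, u i * z i) ∧ ∑ i, z i ^ 2 - φ (∑ i, u i * z i) ≤ b} ≤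
      ENNReal.ofReal (d - c) * ENNReal.ofReal (Real.pi * (b - a)) := by
  set A : Set (Fin 3 → ℝ) := {z : Fin 3 → ℝ | (c ≤ ∑ i, u i * z i ∧ ∑ i, u i * z i ≤ d) ∧
      a ≤ ∑ i, z i ^ 2 - φ (∑ i, u i * z i) ∧ ∑ i, z i ^ 2 - φ (∑ i, u i * z i) ≤ b} with hA
  set A' : Set (Fin 3 → ℝ) := {y : Fin 3 → ℝ | (c ≤ y 0 ∧ y 0 ≤ d) ∧
      a ≤ ∑ i, y i ^ 2 - φ (y 0) ∧ ∑ i, y i ^ 2 - φ (y 0) ≤ b} with hA'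
  -- an orthonormal basis whose first vector is `u`
  have hun : ‖WithLp.toLp 2 u‖ = 1 := by
    rw [EuclideanSpace.norm_eq]; simp [hu]
  obtain ⟨B, hB⟩ := Orthonormal.exists_orthonormalBasis_extension_of_card_eq (𝕜 := ℝ)
    (E := EuclideanSpace ℝ (Fin 3)) (ι := Fin 3) (by simp)
    (v := fun _ => WithLp.toLp 2 u) (s := {0}) (by
      constructor
      · intro i; exact hun
      · intro i j hij; exact absurd (Subtype.ext (i.2.trans j.2.symm)) hij)
  have hB0 : B 0 = WithLp.toLp 2 u := hB 0 rfl
  have hmp1 := (EuclideanSpace.volume_preserving_symm_measurableEquiv_toLp (Fin 3)).symm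
  have hmp2 := B.measurePreserving_repr
  have hmp3 := EuclideanSpace.volume_preserving_symm_measurableEquiv_toLp (Fin 3)
  have hmp := hmp3.comp (hmp2.comp hmp1)
  have hA'm : MeasurableSet A' := by
    have c1 : IsClosed {y : Fin 3 → ℝ | c ≤ y 0} := isClosed_le (by fun_prop) (by fun_prop)
    have c2 : IsClosed {y : Fin 3 → ℝ | y 0 ≤ d} := isClosed_le (by fun_prop) (by fun_prop)
    have c3 : IsClosed {y : Fin 3 → ℝ | a ≤ ∑ i, y i ^ 2 - φ (y 0)} :=
      isClosed_le (by fun_prop) (by fun_prop)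
    have c4 : IsClosed {y : Fin 3 → ℝ | ∑ i, y i ^ 2 - φ (y 0) ≤ b} :=
      isClosed_le (by fun_prop) (by fun_prop)
    have h1 : IsClosed A' := (c1.inter c2).inter (c3.inter c4)
    exact h1.measurableSet
  have hpre : A ⊆ ((MeasurableEquiv.toLp 2 (Fin 3 → ℝ)).symm ∘ B.repr ∘
      (MeasurableEquiv.toLp 2 (Fin 3 → ℝ)).symm.symm) ⁻¹' A' := by
    intro z hz
    have e0 : B.repr (WithLp.toLp 2 z) 0 = ∑ i, u i * z i := by
      rw [B.repr_apply_apply, hB0, PiLp.inner_apply]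
      simp [mul_comm]
    have e1 : ∑ i, (B.repr (WithLp.toLp 2 z) i) ^ 2 = ∑ i, z i ^ 2 := by
      have h1 := B.repr.norm_map (WithLp.toLp 2 z)
      rw [EuclideanSpace.norm_eq, EuclideanSpace.norm_eq] at h1
      have h2 := congrArg (fun x => x ^ 2) h1
      simp only at h2
      rw [Real.sq_sqrt (Finset.sum_nonneg fun i _ => sq_nonneg _),
        Real.sq_sqrt (Finset.sum_nonneg fun i _ => sq_nonneg _)] at h2
      simpa using h2
    change (c ≤ B.repr (WithLp.toLp 2 z) 0 ∧ B.repr (WithLp.toLp 2 z) 0 ≤ d) ∧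
      a ≤ ∑ i, (B.repr (WithLp.toLp 2 z) i) ^ 2 - φ (B.repr (WithLp.toLp 2 z) 0) ∧
      ∑ i, (B.repr (WithLp.toLp 2 z) i) ^ 2 - φ (B.repr (WithLp.toLp 2 z) 0) ≤ b
    rw [e0, e1]
    exact hz
  refine (measure_mono hpre).trans ?_
  rw [hmp.measure_preimage hA'm.nullMeasurableSet]
  -- slice along the first coordinate
  have hmp4 := (volume_preserving_piFinSuccAbove (fun _ : Fin 3 => ℝ) 0).symm
  rw [← hmp4.measure_preimage hA'm.nullMeasurableSet]
  rw [Measure.volume_eq_prod, Measure.prod_apply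
    ((MeasurableEquiv.piFinSuccAbove (fun _ : Fin 3 => ℝ) 0).symm.measurable hA'm)]
  have hslice : ∀ x : ℝ, volume (Prod.mk x ⁻¹'
      ((MeasurableEquiv.piFinSuccAbove (fun _ : Fin 3 => ℝ) 0).symm ⁻¹' A')) ≤
      (Set.Icc c d).indicator (fun _ => ENNReal.ofReal (Real.pi * (b - a))) x := by
    intro x
    by_cases hx : x ∈ Set.Icc c d
    · rw [Set.indicator_of_mem hx]
      -- At height `x` along `u` the section is an annulus whose area bound is independent of `x`
      -- and of `φ`.
      have h1 := volume_annulus_le (a + φ x - x ^ 2) (b + φ x - x ^ 2) (by linarith)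
      rw [show b + φ x - x ^ 2 - (a + φ x - x ^ 2) = b - a by ring] at h1
      refine (measure_mono ?_).trans h1
      intro y hy
      have h2 : (c ≤ x ∧ x ≤ d) ∧
        a ≤ ∑ i, ((Fin.insertNth 0 x y : Fin 3 → ℝ) i) ^ 2 - φ x ∧
        ∑ i, ((Fin.insertNth 0 x y : Fin 3 → ℝ) i) ^ 2 - φ x ≤ b := hy
      rw [Fin.sum_univ_succ] at h2
      simp only [Fin.insertNth_zero', Fin.cons_zero, Fin.cons_succ] at h2
      exact ⟨by linarith [h2.2.1], by linarith [h2.2.2]⟩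
    · rw [Set.indicator_of_notMem hx]
      have : Prod.mk x ⁻¹'
        ((MeasurableEquiv.piFinSuccAbove (fun _ : Fin 3 => ℝ) 0).symm ⁻¹' A') = ∅ := by
        ext y
        simp only [Set.mem_empty_iff_false, iff_false]
        intro hy
        have h2 : (c ≤ x ∧ x ≤ d) ∧ _ := hy
        exact hx h2.1
      rw [this, measure_empty]
  refine (lintegral_mono hslice).trans ?_
  rw [lintegral_indicator measurableSet_Icc, setLIntegral_const, Real.volume_Icc, mul_comm]

open MeasureTheory in
/-- A set of lattice points whose unit cubes lie in a region has at most the volume of the region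
many elements. -/
theorem card_le_volume (S : Finset Mom) (A : Set (Fin 3 → ℝ))
    (h : ∀ p ∈ S, ∀ w : Fin 3 → ℝ, (∀ i, 0 ≤ w i ∧ w i ≤ 1) → (fun i => (p i : ℝ) + w i) ∈ A) :
    (S.card : ENNReal) ≤ volume A := by
  let Q : Mom → Set (Fin 3 → ℝ) := fun p => Set.univ.pi fun i => Set.Ico (p i : ℝ) (p i + 1)
  have hvol : ∀ p, volume (Q p) = 1 := by
    intro p
    rw [Real.volume_pi_Ico]; simp
  have hdisj : Set.PairwiseDisjoint (S : Set Mom) Q := by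
    intro p _ q _ hpq
    rw [Function.onFun, Set.disjoint_left]
    intro z hzp hzq
    apply hpq
    ext i
    have h1 := hzp i (Set.mem_univ i)
    have h2 := hzq i (Set.mem_univ i)
    rw [← Int.floor_eq_iff.mpr ⟨h1.1, h1.2⟩, ← Int.floor_eq_iff.mpr ⟨h2.1, h2.2⟩]
  have h1 : volume (⋃ p ∈ S, Q p) = S.card := by
    rw [measure_biUnion_finset hdisj fun p _ =>
      MeasurableSet.univ_pi fun i => measurableSet_Ico]
    simp [hvol]
  rw [← h1]
  refine measure_mono (Set.iUnion₂_subset fun p hp z hz => ?_)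
  have := h p hp (fun i => z i - p i) fun i => by
    have := hz i (Set.mem_univ i)
    exact ⟨by linarith [this.1], by linarith [this.2]⟩
  simpa using this

/-- Lattice points in a slab with a quadratic constraint. -/
theorem card_le_slab (S : Finset Mom) {u : Fin 3 → ℝ} (hu : ∑ i, u i ^ 2 = 1) {θ : ℝ}
    (hθ : 0 ≤ θ) (hθ1 : θ ≤ 1) {a b c d R : ℝ} (hcd : c ≤ d) (hab : a ≤ b) (hR : 1 ≤ R)
    (h : ∀ p ∈ S, (c ≤ ∑ i, u i * (p i : ℝ) ∧ ∑ i, u i * (p i : ℝ) ≤ d) ∧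
      (a ≤ ∑ i, (p i : ℝ) ^ 2 - θ * (∑ i, u i * (p i : ℝ)) ^ 2 ∧
      ∑ i, (p i : ℝ) ^ 2 - θ * (∑ i, u i * (p i : ℝ)) ^ 2 ≤ b) ∧
      ∑ i, (p i : ℝ) ^ 2 - θ * (∑ i, u i * (p i : ℝ)) ^ 2 ≤ R ^ 2) :
    (S.card : ℝ) ≤ (d - c + 4) * (Real.pi * (b - a + 14 * R)) := by
  -- Let `Q(z) = |z|² - θ(u·z)²`. Moving from a lattice point `p` by `w` in the unit cube changes
  -- `u·p` by at most `√3 ≤ 2`, and `Q` by at most `4R + 3 ≤ 7R`.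
  have hvol := volume_slab_le hu (fun x => θ * x ^ 2) (by fun_prop) (a := a - 7 * R)
    (b := b + 7 * R) (c := c - 2) (d := d + 2) (by linarith)
  have hcard := (card_le_volume S _ ?_).trans hvol
  · rw [← ENNReal.ofReal_mul (by linarith), ← ENNReal.ofReal_natCast] at hcard
    have h1 : 0 ≤ (d + 2 - (c - 2)) * (Real.pi * (b + 7 * R - (a - 7 * R))) :=
      mul_nonneg (by linarith) (mul_nonneg Real.pi_pos.le (by linarith))
    have := (ENNReal.ofReal_le_ofReal_iff h1).mp hcard
    refine this.trans (le_of_eq ?_)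
    ring
  intro p hp w hw
  obtain ⟨⟨h1, h2⟩, ⟨h3, h4⟩, h5⟩ := h p hp
  have hw3 : ∑ i, w i ^ 2 ≤ 3 := by
    calc ∑ i, w i ^ 2 ≤ ∑ i : Fin 3, (1 : ℝ) :=
          Finset.sum_le_sum fun i _ => pow_le_one₀ (hw i).1 (hw i).2
      _ = 3 := by simp
  have hCS : ∀ z : Fin 3 → ℝ, (∑ i, u i * z i) ^ 2 ≤ ∑ i, z i ^ 2 := fun z => by
    have := Finset.sum_mul_sq_le_sq_mul_sq Finset.univ u z
    rwa [hu, one_mul] at this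
  have hQ0 : ∀ z : Fin 3 → ℝ, 0 ≤ ∑ i, z i ^ 2 - θ * (∑ i, u i * z i) ^ 2 := fun z => by
    have := hCS z
    nlinarith [sq_nonneg (∑ i, u i * z i)]
  have huw : (∑ i, u i * w i) ^ 2 ≤ 3 := (hCS w).trans hw3
  have huw2 : |∑ i, u i * w i| ≤ 2 := abs_le.mpr ⟨by nlinarith, by nlinarith⟩
  obtain ⟨g1, g2⟩ := abs_le.mp huw2
  have s1 : ∑ i, u i * ((p i : ℝ) + w i) = ∑ i, u i * (p i : ℝ) + ∑ i, u i * w i := by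
    rw [← Finset.sum_add_distrib]; exact Finset.sum_congr rfl fun i _ => by ring
  have s2 : ∀ t : ℝ, ∑ i, ((p i : ℝ) + t * w i) ^ 2 =
      ∑ i, (p i : ℝ) ^ 2 + 2 * t * ∑ i, (p i : ℝ) * w i + t ^ 2 * ∑ i, w i ^ 2 := fun t => by
    rw [Finset.mul_sum, Finset.mul_sum, ← Finset.sum_add_distrib, ← Finset.sum_add_distrib]
    exact Finset.sum_congr rfl fun i _ => by ring
  have s3 : ∀ t : ℝ, ∑ i, u i * ((p i : ℝ) + t * w i) =
      ∑ i, u i * (p i : ℝ) + t * ∑ i, u i * w i := fun t => by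
    rw [Finset.mul_sum, ← Finset.sum_add_distrib]
    exact Finset.sum_congr rfl fun i _ => by ring
  have s4 := s2 1
  simp only [one_mul, mul_one, one_pow] at s4
  -- Positivity of `Q` at `p ± R w`, with `Q(p) ≤ R²` and `Q(w) ≤ 3`, is Cauchy–Schwarz for the
  -- cross term: twice the polar form is at most `4R` in absolute value.
  have q1 := hQ0 fun i => (p i : ℝ) + R * w i
  have q2 := hQ0 fun i => (p i : ℝ) + (-R) * w i
  have q3 := hQ0 w
  simp only [s2, s3] at q1 q2
  change (c - 2 ≤ ∑ i, u i * ((p i : ℝ) + w i) ∧ ∑ i, u i * ((p i : ℝ) + w i) ≤ d + 2) ∧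
    a - 7 * R ≤ ∑ i, ((p i : ℝ) + w i) ^ 2 - θ * (∑ i, u i * ((p i : ℝ) + w i)) ^ 2 ∧
    ∑ i, ((p i : ℝ) + w i) ^ 2 - θ * (∑ i, u i * ((p i : ℝ) + w i)) ^ 2 ≤ b + 7 * R
  rw [s1, s4]
  generalize ∑ i, u i * (p i : ℝ) = x at *
  generalize ∑ i, u i * w i = y at *
  generalize ∑ i, (p i : ℝ) ^ 2 = P at *
  generalize ∑ i, w i ^ 2 = W at *
  generalize ∑ i, (p i : ℝ) * w i = z at *
  have hR0 : 0 < R := by linarith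
  have hQW : W - θ * y ^ 2 ≤ 3 := by nlinarith [sq_nonneg y]
  -- the polarized form
  have b1 : -(4 * R) ≤ 2 * (z - θ * (x * y)) := by
    have : 0 ≤ R * (R + 2 * (z - θ * (x * y)) + R * 3) := by nlinarith
    have := nonneg_of_mul_nonneg_right this hR0
    linarith
  have b2 : 2 * (z - θ * (x * y)) ≤ 4 * R := by
    have : 0 ≤ R * (R - 2 * (z - θ * (x * y)) + R * 3) := by nlinarith
    have := nonneg_of_mul_nonneg_right this hR0
    linarith
  refine ⟨⟨by linarith, by linarith⟩, ?_, ?_⟩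
  · have : P + 2 * z + W - θ * (x + y) ^ 2 =
      (P - θ * x ^ 2) + 2 * (z - θ * (x * y)) + (W - θ * y ^ 2) := by ring
    rw [this]; linarith
  · have : P + 2 * z + W - θ * (x + y) ^ 2 =
      (P - θ * x ^ 2) + 2 * (z - θ * (x * y)) + (W - θ * y ^ 2) := by ring
    rw [this]; linarith

/-! ### Cardinality of the lunes -/

theorem abs_coord_le_len (p : Mom) (i : Fin 3) : |(p i : ℝ)| ≤ len p :=
  Real.abs_le_sqrt (Finset.single_le_sum (f := fun j => ((p j : ℤ) : ℝ) ^ 2)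
    (fun _ _ => sq_nonneg _) (Finset.mem_univ i))

theorem abs_coord_le_floor {kF : ℝ} {p : Mom} (hp : len p ≤ kF) (i : Fin 3) :
    |p i| ≤ ⌊kF⌋ := by
  rw [Int.le_floor]
  push_cast
  exact (abs_coord_le_len p i).trans hp

theorem card_box_le {kF : ℝ} (hkF : 1 ≤ kF) :
    ((Finset.Icc (-⌊kF⌋) ⌊kF⌋).card : ℝ) ≤ 3 * kF := by
  have h0 : 0 ≤ ⌊kF⌋ := Int.floor_nonneg.mpr (by linarith)
  have h1 : ((Finset.Icc (-⌊kF⌋) ⌊kF⌋).card : ℤ) = 2 * ⌊kF⌋ + 1 := by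
    rw [Int.card_Icc, Int.toNat_of_nonneg (by omega)]; ring
  have h2 : ((Finset.Icc (-⌊kF⌋) ⌊kF⌋).card : ℝ) = 2 * (⌊kF⌋ : ℝ) + 1 := by exact_mod_cast h1
  rw [h2]
  have := Int.floor_le kF
  linarith

theorem card_fermiBall_le {kF : ℝ} (hkF : 1 ≤ kF) : ((fermiBall kF).card : ℝ) ≤ 27 * kF ^ 3 := by
  have hsub : fermiBall kF ⊆ Fintype.piFinset fun _ : Fin 3 => Finset.Icc (-⌊kF⌋) ⌊kF⌋ := by
    intro p hp
    rw [Fintype.mem_piFinset]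
    intro i
    rw [Finset.mem_Icc, ← abs_le]
    exact abs_coord_le_floor (mem_fermiBall.mp hp) i
  have h1 := Finset.card_le_card hsub
  rw [Fintype.card_piFinset] at h1
  simp only [Finset.prod_const, Finset.card_univ, Fintype.card_fin] at h1
  calc ((fermiBall kF).card : ℝ) ≤ ((Finset.Icc (-⌊kF⌋) ⌊kF⌋).card : ℝ) ^ 3 := by exact_mod_cast h1
    _ ≤ (3 * kF) ^ 3 := pow_le_pow_left₀ (Nat.cast_nonneg _) (card_box_le hkF) 3
    _ = 27 * kF ^ 3 := by ring

theorem card_lune_le_ball (kF : ℝ) (k : Mom) : (lune kF k).card ≤ (fermiBall kF).card :=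
  Finset.card_le_card_of_injOn (fun p => p - k) (fun _ hp => (mem_lune_iff.mp hp).1)
    fun _ _ _ _ h => sub_left_injective h

theorem lune_zero (kF : ℝ) : lune kF 0 = ∅ := by
  ext p; simp [mem_lune_iff]

theorem card_lune_neg (kF : ℝ) (k : Mom) : (lune kF (-k)).card = (lune kF k).card := by
  refine Finset.card_bij (fun p _ => -p) (fun p hp => ?_) (fun _ _ _ _ h => neg_injective h)
    fun p hp => ⟨-p, ?_, neg_neg p⟩
  · rw [mem_lune_iff] at hp ⊢
    rw [neg_mem_fermiBall]
    refine ⟨?_, hp.2⟩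
    rw [← neg_mem_fermiBall, show -(-p - k) = p - -k by abel]; exact hp.1
  · rw [mem_lune_iff] at hp ⊢
    rw [neg_mem_fermiBall]
    refine ⟨?_, hp.2⟩
    rw [← neg_mem_fermiBall, show -(-p - -k) = p - k by abel]; exact hp.1

/-- The path from `p - a - b` to `p` leaves the ball either before or after the intermediate point
`p - b`. -/
theorem card_lune_add_le (kF : ℝ) (a b : Mom) :
    (lune kF (a + b)).card ≤ (lune kF a).card + (lune kF b).card := by
  have hsub : lune kF (a + b) ⊆ (lune kF a).image (fun p => p + b) ∪ lune kF b := by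
    intro p hp
    obtain ⟨h1, h2⟩ := mem_lune_iff.mp hp
    rw [Finset.mem_union, Finset.mem_image]
    by_cases h : p - b ∈ fermiBall kF
    · exact Or.inr (mem_lune_iff.mpr ⟨h, h2⟩)
    · refine Or.inl ⟨p - b, mem_lune_iff.mpr ⟨?_, h⟩, sub_add_cancel p b⟩
      rwa [show p - b - a = p - (a + b) by abel]
  exact (Finset.card_le_card hsub).trans ((Finset.card_union_le _ _).trans
    (Nat.add_le_add_right Finset.card_image_le _))

theorem card_lune_nsmul_le (kF : ℝ) (a : Mom) (n : ℕ) :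
    (lune kF (n • a)).card ≤ n * (lune kF a).card := by
  induction n with
  | zero => simp [lune_zero]
  | succ n ih =>
    rw [succ_nsmul, Nat.succ_mul]
    exact (card_lune_add_le kF _ _).trans (Nat.add_le_add_right ih _)

theorem card_lune_zsmul_le (kF : ℝ) (a : Mom) (n : ℤ) :
    (lune kF (n • a)).card ≤ n.natAbs * (lune kF a).card := by
  rcases Int.natAbs_eq n with h | h
  · conv_lhs => rw [h, natCast_zsmul]
    exact card_lune_nsmul_le kF a _
  · conv_lhs => rw [h, neg_smul, natCast_zsmul, card_lune_neg]
    exact card_lune_nsmul_le kF a _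

/-- A lune of a unit step has at most one point on each line in the direction of the step. -/
theorem card_lune_single_le {kF : ℝ} (hkF : 1 ≤ kF) (i : Fin 3) :
    ((lune kF (Pi.single i 1)).card : ℝ) ≤ 9 * kF ^ 2 := by
  let T : Finset Mom :=
    Fintype.piFinset fun j => if j = i then {0} else Finset.Icc (-⌊kF⌋) ⌊kF⌋
  have hT : (T.card : ℝ) ≤ 9 * kF ^ 2 := by
    have h1 : T.card = (Finset.Icc (-⌊kF⌋) ⌊kF⌋).card ^ 2 := by
      rw [Fintype.card_piFinset]
      fin_cases i <;> simp [Fin.prod_univ_three, sq]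
    rw [h1]
    push_cast
    calc ((Finset.Icc (-⌊kF⌋) ⌊kF⌋).card : ℝ) ^ 2 ≤ (3 * kF) ^ 2 :=
          pow_le_pow_left₀ (Nat.cast_nonneg _) (card_box_le hkF) 2
      _ = 9 * kF ^ 2 := by ring
  refine le_trans (Nat.cast_le.mpr (Finset.card_le_card_of_injOn
    (fun p => Function.update p i 0) (fun p hp => ?_) ?_)) hT
  · rw [Finset.mem_coe, Fintype.mem_piFinset]
    intro j
    rcases eq_or_ne j i with rfl | hj
    · simp
    · dsimp only
      rw [Function.update_of_ne hj, if_neg hj, Finset.mem_Icc, ← abs_le]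
      have := abs_coord_le_floor (mem_lune.mp hp).1 j
      simpa [hj] using this
  · have hsq : ∀ p : Mom, sqLen (p - Pi.single i 1) = sqLen p - 2 * p i + 1 := by
      intro p
      have h1 : ∀ j, (((p - Pi.single i 1 : Mom) j : ℤ) : ℝ) ^ 2 =
          (p j : ℝ) ^ 2 + if j = i then (1 - 2 * (p i : ℝ)) else 0 := by
        intro j
        rcases eq_or_ne j i with rfl | hj
        · simp; ring
        · simp [hj]
      unfold sqLen
      simp only [h1, Finset.sum_add_distrib, Finset.sum_ite_eq', Finset.mem_univ, if_true]
      ring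
    have hup : ∀ p : Mom, sqLen (Function.update p i 0) = sqLen p - (p i : ℝ) ^ 2 := by
      intro p
      have h1 : ∀ j, ((Function.update p i 0 j : ℤ) : ℝ) ^ 2 =
          (p j : ℝ) ^ 2 - if j = i then (p i : ℝ) ^ 2 else 0 := by
        intro j
        rcases eq_or_ne j i with rfl | hj
        · simp
        · simp [hj]
      unfold sqLen
      simp only [h1, Finset.sum_sub_distrib, Finset.sum_ite_eq', Finset.mem_univ, if_true]
    -- In the lune `p_i ≥ 1`. If `q_i - 1 ≥ p_i` and the other coordinates agree, then `|q - e_i| ≥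
    -- |p| > k_F`, a contradiction.
    have key : ∀ p ∈ lune kF (Pi.single i 1), ∀ q ∈ lune kF (Pi.single i 1),
        Function.update p i 0 = Function.update q i 0 → ¬ p i < q i := by
      intro p hp q hq h hlt
      obtain ⟨p1, p2⟩ := mem_lune.mp hp
      obtain ⟨q1, q2⟩ := mem_lune.mp hq
      have l1 := half_le_lam hp
      unfold lam at l1
      have e1 := hup p
      have e2 := hup q
      rw [h, e2] at e1
      have e3 := hsq q
      have e4 := hsq p
      have hlt' : (p i : ℝ) + 1 ≤ q i := by exact_mod_cast hlt
      have hlen : sqLen (q - Pi.single i 1) < sqLen p := by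
        rw [← len_sq, ← len_sq]
        exact pow_lt_pow_left₀ (q1.trans_lt p2) (len_nonneg _) two_ne_zero
      nlinarith
    intro p hp q hq h
    have h1 := key p hp q hq h
    have h2 := key q hq p hp h.symm
    ext j
    rcases eq_or_ne j i with rfl | hj
    · omega
    · have := congrFun h j
      simpa [hj] using this

/-- `|L_l| ≤ C k_F² min(|l|, k_F)`. -/
theorem card_lune_le {kF : ℝ} (hkF : 1 ≤ kF) (l : Mom) :
    ((lune kF l).card : ℝ) ≤ 27 * kF ^ 2 * min (len l) kF := by
  have hkF0 : 0 ≤ kF := by linarith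
  rw [mul_min_of_nonneg _ _ (by positivity), le_min_iff]
  constructor
  · have hl : l = l 0 • Pi.single 0 1 + l 1 • Pi.single 1 1 + l 2 • (Pi.single 2 1 : Mom) := by
      ext j; fin_cases j <;> simp
    have h1 : (lune kF l).card ≤ ∑ i, (l i).natAbs * (lune kF (Pi.single i 1)).card := by
      rw [Fin.sum_univ_three]
      conv_lhs => rw [hl]
      exact (card_lune_add_le _ _ _).trans (Nat.add_le_add ((card_lune_add_le _ _ _).trans
        (Nat.add_le_add (card_lune_zsmul_le _ _ _) (card_lune_zsmul_le _ _ _)))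
        (card_lune_zsmul_le _ _ _))
    calc ((lune kF l).card : ℝ)
        ≤ ∑ i, ((l i).natAbs : ℝ) * (lune kF (Pi.single i 1)).card := by exact_mod_cast h1
      _ ≤ ∑ _i : Fin 3, len l * (9 * kF ^ 2) := Finset.sum_le_sum fun i _ =>
          mul_le_mul (by rw [Nat.cast_natAbs, Int.cast_abs]; exact abs_coord_le_len l i)
            (card_lune_single_le hkF i) (Nat.cast_nonneg _) (len_nonneg _)
      _ = 27 * kF ^ 2 * len l := by simp; ring
  · calc ((lune kF l).card : ℝ) ≤ (fermiBall kF).card := by exact_mod_cast card_lune_le_ball kF l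
      _ ≤ 27 * kF ^ 3 := card_fermiBall_le hkF
      _ = 27 * kF ^ 2 * kF := by ring

theorem one_le_len {k : Mom} (hk : k ≠ 0) : 1 ≤ len k := by
  obtain ⟨i, hi⟩ : ∃ i, k i ≠ 0 := by
    by_contra h; push Not at h; exact hk (funext h)
  refine le_trans ?_ (abs_coord_le_len k i)
  have : (1 : ℤ) ≤ |k i| := Int.one_le_abs hi
  exact_mod_cast this

/-! ### The sum of the inverse excitation energies over a lune -/

/-- The scalar product of momenta. -/
def momDot (p q : Mom) : ℝ := ∑ i, (p i : ℝ) * q i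

theorem sqLen_sub_zsmul (p k : Mom) (n : ℤ) :
    sqLen (p - n • k) = sqLen p - 2 * n * momDot k p + n ^ 2 * sqLen k := by
  unfold sqLen momDot
  rw [Finset.mul_sum, Finset.mul_sum, ← Finset.sum_sub_distrib, ← Finset.sum_add_distrib]
  refine Finset.sum_congr rfl fun i _ => ?_
  simp; ring

theorem lam_eq (k p : Mom) : lam k p = momDot k p - sqLen k / 2 := by
  have := sqLen_sub_zsmul p k 1
  rw [one_smul] at this
  rw [lam, this]; push_cast; ring

theorem momDot_sub_zsmul (p k : Mom) (n : ℤ) :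
    momDot k (p - n • k) = momDot k p - n * sqLen k := by
  unfold sqLen momDot
  rw [Finset.mul_sum, ← Finset.sum_sub_distrib]
  refine Finset.sum_congr rfl fun i _ => ?_
  simp; ring

theorem momDot_sq_le (k p : Mom) : momDot k p ^ 2 ≤ sqLen k * sqLen p :=
  Finset.sum_mul_sq_le_sq_mul_sq Finset.univ (fun i => (k i : ℝ)) fun i => (p i : ℝ)

theorem sqLen_sub_le {kF : ℝ} {k p : Mom} (hp : p ∈ lune kF k) : sqLen (p - k) ≤ kF ^ 2 := by
  rw [← len_sq]
  exact pow_le_pow_left₀ (len_nonneg _) (mem_lune.mp hp).1 2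

theorem lt_sqLen {kF : ℝ} (hkF : 0 ≤ kF) {k p : Mom} (hp : p ∈ lune kF k) : kF ^ 2 < sqLen p := by
  rw [← len_sq]
  exact pow_lt_pow_left₀ (mem_lune.mp hp).2 hkF two_ne_zero

/-- A lune has at most one point on each line in the direction of its own step. -/
theorem lune_translate_injective {kF : ℝ} (hkF : 0 ≤ kF) {k p q : Mom} (hp : p ∈ lune kF k)
    (hq : q ∈ lune kF k) (n : ℤ) (hn : 1 ≤ n) : q ≠ p - n • k := by
  rintro rfl
  have h1 := sqLen_sub_le hp
  have h2 := lt_sqLen hkF hq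
  -- Positivity of `λ` at `q = p - nk` says `2 k·p > (2n+1)|k|²`. Hence `|q|² - |p - k|² =
  -- (n-1)((n+1)|k|² - 2 k·p) ≤ 0`, so `q` would lie in the ball.
  have h3 := lam_pos hq
  rw [lam_eq, momDot_sub_zsmul] at h3
  rw [sqLen_sub_zsmul] at h2
  have h4 := sqLen_sub_zsmul p k 1
  rw [one_smul] at h4
  rw [h4] at h1
  push_cast at h1
  have hn' : (1 : ℝ) ≤ n := by exact_mod_cast hn
  have := sqLen_nonneg k
  nlinarith [mul_nonneg (sub_nonneg.mpr hn') h3.le, mul_nonneg (sub_nonneg.mpr hn') (mul_nonneg (by linarith : (0:ℝ) ≤ n) this)]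

section DirectedLune

variable {kF : ℝ} {k : Mom}

theorem sum_unit_sq (hk : k ≠ 0) : ∑ i, ((k i : ℝ) / len k) ^ 2 = 1 := by
  have h := one_le_len hk
  simp only [div_pow, ← Finset.sum_div]
  rw [div_eq_one_iff_eq (by positivity), len_sq]; rfl

theorem sum_unit_mul (k p : Mom) : ∑ i, ((k i : ℝ) / len k) * (p i : ℝ) = momDot k p / len k := by
  rw [momDot, Finset.sum_div]
  exact Finset.sum_congr rfl fun i _ => by ring

/-- Points of small excitation energy lie in the intersection of a slab and a shell. -/
theorem card_lune_slab_le (hkF : 1 ≤ kF) (hk : k ≠ 0) (hk3 : len k ≤ 3 * kF) {Y : ℝ}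
    (hY : 0 ≤ Y) : (((lune kF k).filter fun p => lam k p ≤ Y).card : ℝ) ≤
      (Y / len k + 4) * (Real.pi * (2 * Y + 70 * kF)) := by
  have hκ := one_le_len hk
  have hκ0 : 0 < len k := by linarith
  -- `0 < k·p - |k|²/2 ≤ Y` is the slab and `k_F² < |p|² ≤ k_F² + 2Y` the shell. The radius is `5
  -- k_F` because `|p|² ≤ 2 k_F² + 2 (3 k_F)² = 20 k_F²`.
  have := card_le_slab ((lune kF k).filter fun p => lam k p ≤ Y) (sum_unit_sq hk) (θ := 0) le_rfl
    zero_le_one (a := kF ^ 2) (b := kF ^ 2 + 2 * Y) (c := len k / 2) (d := len k / 2 + Y / len k)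
    (R := 5 * kF) (by have : 0 ≤ Y / len k := by positivity
                      linarith) (by linarith) (by linarith) ?_
  · refine this.trans (le_of_eq ?_); ring
  intro p hp
  obtain ⟨hp, hpY⟩ := Finset.mem_filter.mp hp
  have h0 := lam_pos hp
  have h1 := sqLen_sub_le hp
  have h2 := lt_sqLen (by linarith) hp
  have h3 : lam k p = (sqLen p - sqLen (p - k)) / 2 := rfl
  have h4 := lam_eq k p
  have h5 := len_sq k
  rw [sum_unit_mul]
  have h6 : sqLen p = ∑ i, (p i : ℝ) ^ 2 := rfl
  rw [← h6, zero_mul, sub_zero]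
  have h7 : sqLen p ≤ 2 * sqLen (p - k) + 2 * sqLen k := by
    unfold sqLen
    rw [Finset.mul_sum, Finset.mul_sum, ← Finset.sum_add_distrib]
    refine Finset.sum_le_sum fun i _ => ?_
    simp only [Pi.sub_apply]; push_cast
    nlinarith [sq_nonneg ((p i : ℝ) - 2 * k i)]
  refine ⟨⟨?_, ?_⟩, ⟨by linarith, by linarith⟩, by nlinarith⟩
  · rw [le_div_iff₀ hκ0]; nlinarith
  · rw [div_le_iff₀ hκ0, add_mul, div_mul_cancel₀ _ hκ0.ne']; nlinarith

/-- Points of larger excitation energy, translated along `k` into one slab. -/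
theorem card_lune_translate_le (hkF : 1 ≤ kF) (hk : k ≠ 0) {Y : ℝ}
    (hY : len k ^ 2 ≤ Y) : (((lune kF k).filter fun p => lam k p ≤ Y).card : ℝ) ≤
      (len k + 4) * (Real.pi * ((3 * Y / (2 * len k)) ^ 2 + 14 * kF)) := by
  have hκ := one_le_len hk
  have hκ0 : 0 < len k := by linarith
  have hκ2 := len_sq k
  have hs0 : 0 < sqLen k := by rw [← hκ2]; positivity
  -- Subtracting this multiple of `k` brings the component along `k` into `[0, |k|)`.
  let j : Mom → ℤ := fun p => ⌊momDot k p / sqLen k⌋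
  let f : Mom → Mom := fun p => p - j p • k
  have hinj : Set.InjOn f ((lune kF k).filter fun p => lam k p ≤ Y : Finset Mom) := by
    intro p hp q hq hpq
    have hp := (Finset.mem_filter.mp hp).1
    have hq := (Finset.mem_filter.mp hq).1
    have hpq : p - j p • k = q - j q • k := hpq
    rcases lt_trichotomy (j p) (j q) with h | h | h
    · refine absurd ?_ (lune_translate_injective (by linarith) hq hp (j q - j p) (by omega))
      rw [sub_smul, sub_sub_eq_add_sub, add_sub_right_comm, ← hpq, sub_add_cancel]
    · rw [h] at hpq; exact sub_left_injective hpq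
    · refine absurd ?_ (lune_translate_injective (by linarith) hp hq (j p - j q) (by omega))
      rw [sub_smul, sub_sub_eq_add_sub, add_sub_right_comm, hpq, sub_add_cancel]
  rw [← Finset.card_image_of_injOn hinj]
  have hY0 : 0 ≤ Y := le_trans (by positivity) hY
  -- With `θ = 1` the form is the squared distance from the axis, unchanged by translation along
  -- `k`. The lower bound uses `k·p = λ + |k|²/2 ≤ 3Y/2`.
  have := card_le_slab (((lune kF k).filter fun p => lam k p ≤ Y).image f) (sum_unit_sq hk)
    (θ := 1) zero_le_one le_rfl (a := kF ^ 2 - (3 * Y / (2 * len k)) ^ 2) (b := kF ^ 2) (c := 0)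
    (d := len k) (R := kF) hκ0.le (by have := sq_nonneg (3 * Y / (2 * len k)); linarith) hkF ?_
  · refine this.trans (le_of_eq ?_); ring
  intro p' hp'
  obtain ⟨p, hp, rfl⟩ := Finset.mem_image.mp hp'
  obtain ⟨hp, hpY⟩ := Finset.mem_filter.mp hp
  have h6 : ∑ i, (f p i : ℝ) ^ 2 = sqLen (p - j p • k) := rfl
  have h7 : ∑ i, ((k i : ℝ) / len k) * (f p i : ℝ) = momDot k (p - j p • k) / len k :=
    sum_unit_mul k (f p)
  have hfl := Int.floor_le (momDot k p / sqLen k)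
  have hfl2 := Int.lt_floor_add_one (momDot k p / sqLen k)
  rw [le_div_iff₀ hs0] at hfl
  rw [div_lt_iff₀ hs0] at hfl2
  have hperp : sqLen (p - j p • k) - 1 * (momDot k (p - j p • k) / len k) ^ 2 =
      sqLen p - momDot k p ^ 2 / sqLen k := by
    rw [sqLen_sub_zsmul, momDot_sub_zsmul, div_pow, hκ2]
    field_simp; ring
  rw [h6, h7, hperp]
  have hup : sqLen p - momDot k p ^ 2 / sqLen k ≤ kF ^ 2 := by
    have h1 := sqLen_sub_le hp
    have h2 := sqLen_sub_zsmul p k 1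
    rw [one_smul] at h2
    have h3 : sqLen p - momDot k p ^ 2 / sqLen k =
        sqLen (p - k) - (momDot k p - sqLen k) ^ 2 / sqLen k := by
      rw [h2]; push_cast; field_simp; ring
    have : 0 ≤ (momDot k p - sqLen k) ^ 2 / sqLen k := by positivity
    linarith
  refine ⟨⟨?_, ?_⟩, ⟨?_, hup⟩, hup⟩
  · rw [momDot_sub_zsmul]
    exact div_nonneg (by linarith) hκ0.le
  · rw [momDot_sub_zsmul, div_le_iff₀ hκ0, ← sq, hκ2]
    linarith
  · have h2 := lt_sqLen (by linarith) hp
    have h4 := lam_eq k p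
    have h0 := lam_pos hp
    have h5 : momDot k p ^ 2 / sqLen k ≤ (3 * Y / (2 * len k)) ^ 2 := by
      rw [div_pow, mul_pow, mul_pow, hκ2, div_le_div_iff₀ hs0 (by positivity)]
      have : momDot k p ≤ 3 / 2 * Y := by rw [hκ2] at hY; linarith
      have h8 : momDot k p ^ 2 ≤ (3 / 2 * Y) ^ 2 := pow_le_pow_left₀ (by linarith) this 2
      nlinarith
    linarith

/-- The dyadic counting bound. -/
theorem card_lune_dyadic_le (hkF : 1 ≤ kF) (hk : k ≠ 0) (hk3 : len k ≤ 3 * kF) (j : ℕ) :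
    (((lune kF k).filter fun p => lam k p ≤ 2 ^ j).card : ℝ) ≤
      400 * Real.pi * 2 ^ j * (2 ^ j / len k + kF * (3 / 4) ^ j) := by
  have hκ := one_le_len hk
  have hκ0 : 0 < len k := by linarith
  have hY1 : (1 : ℝ) ≤ 2 ^ j := one_le_pow₀ (by norm_num)
  have hpi := Real.pi_pos
  have hr0 : (0 : ℝ) < (3 / 4) ^ j := by positivity
  -- `(3/4)^(2j) ≥ 2^(-j)`
  have hr : 1 ≤ ((3 / 4 : ℝ) ^ j) ^ 2 * 2 ^ j := by
    rw [← pow_mul, mul_comm j 2, pow_mul, ← mul_pow]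
    exact one_le_pow₀ (by norm_num)
  generalize (2 : ℝ) ^ j = y at *
  generalize (3 / 4 : ℝ) ^ j = r at *
  have hy0 : 0 < y := by linarith
  -- The translated count serves for `y ≥ |k|²`, where `|k| ≤ r y`; the slab count serves below,
  -- where `1 ≤ r |k|`. Both follow from `r² y ≥ 1` with `r = (3/4)^j`, and they put the boundary
  -- terms of the cube counting below `k_F r y`.
  rcases le_or_gt (len k ^ 2) y with h | h
  · refine (card_lune_translate_le hkF hk h).trans ?_
    have h1 : len k ≤ r * y := by
      have : len k ^ 2 ≤ (r * y) ^ 2 := by nlinarith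
      exact (pow_le_pow_iff_left₀ hκ0.le (by positivity) two_ne_zero).mp this
    have h2 : (3 * y / (2 * len k)) ^ 2 = 9 / 4 * (y / len k) ^ 2 := by field_simp; ring
    rw [h2]
    have h3 : len k * (y / len k) = y := by field_simp
    have hq0 : 0 < y / len k := by positivity
    generalize y / len k = q at *
    have h5 : (len k + 4) * (Real.pi * (9 / 4 * q ^ 2 + 14 * kF)) ≤
        (5 * len k) * (Real.pi * (9 / 4 * q ^ 2 + 14 * kF)) :=
      mul_le_mul_of_nonneg_right (by linarith) (by positivity)
    refine h5.trans ?_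
    have h6 : (5 * len k) * (Real.pi * (9 / 4 * q ^ 2 + 14 * kF)) =
      Real.pi * (45 / 4 * (len k * q) * q + 70 * kF * len k) := by ring
    rw [h6, h3]
    have h7 : 400 * Real.pi * y * (q + kF * r) = Real.pi * (400 * y * q + 400 * kF * (r * y)) := by
      ring
    rw [h7]
    refine mul_le_mul_of_nonneg_left ?_ hpi.le
    have h8 : kF * len k ≤ kF * (r * y) := mul_le_mul_of_nonneg_left h1 (by linarith)
    nlinarith [mul_pos hy0 hq0, mul_pos (by linarith : 0 < kF) hκ0]
  · refine (card_lune_slab_le hkF hk hk3 hy0.le).trans ?_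
    have h1 : 1 ≤ r * len k := by
      have : 1 ≤ (r * len k) ^ 2 := by nlinarith [sq_nonneg r]
      nlinarith [mul_pos hr0 hκ0]
    have h2 : 1 ≤ r * y := by nlinarith
    have h3 : y / len k ≤ r * y := by
      rw [div_le_iff₀ hκ0]; nlinarith
    have hq0 : 0 < y / len k := by positivity
    have h9 : 1 ≤ 3 * kF * r := by nlinarith
    generalize y / len k = q at *
    have h7 : 400 * Real.pi * y * (q + kF * r) = Real.pi * (400 * y * q + 400 * kF * (r * y)) := by
      ring
    have h6 : (q + 4) * (Real.pi * (2 * y + 70 * kF)) =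
      Real.pi * (2 * y * q + 70 * kF * q + 8 * y + 280 * kF) := by ring
    rw [h6, h7]
    refine mul_le_mul_of_nonneg_left ?_ hpi.le
    have hk0 : 0 < kF := by linarith
    have g1 : kF * q ≤ kF * (r * y) := mul_le_mul_of_nonneg_left h3 hk0.le
    have g2 : kF * 1 ≤ kF * (r * y) := mul_le_mul_of_nonneg_left h2 hk0.le
    have g3 : y * 1 ≤ y * (3 * kF * r) := mul_le_mul_of_nonneg_left h9 hy0.le
    nlinarith [mul_pos hy0 hq0]

/-- If `2^j ≤ 2f < 2^{j+1}` then `1/f ≤ 2·2^{-j}`, so the sum is at most `∑_j 2·2^{-j} #{f ≤ 2^j}`.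
The decay `(3/4)^j` keeps the second contribution bounded by `4K` and prevents a logarithm in the
number of scales. -/
theorem sum_inv_le_of_dyadic {α : Type*} (L : Finset α) (f : α → ℝ) {C κ K X : ℝ} (hC : 0 ≤ C)
    (hκ : 0 < κ) (hK : 0 ≤ K) (hf : ∀ p ∈ L, 1 / 2 ≤ f p) (hfX : ∀ p ∈ L, 2 * f p ≤ X)
    (hX : 1 ≤ X)
    (h : ∀ j : ℕ, ((L.filter fun p => f p ≤ 2 ^ j).card : ℝ) ≤
      C * 2 ^ j * (2 ^ j / κ + K * (3 / 4) ^ j)) :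
    ∑ p ∈ L, (f p)⁻¹ ≤ 2 * C * (2 * X / κ + 4 * K) := by
  obtain ⟨J, hJ1, hJ2⟩ := exists_nat_pow_near hX (one_lt_two (α := ℝ))
  have hpt : ∀ p ∈ L, (f p)⁻¹ ≤ ∑ j ∈ Finset.range (J + 1),
      if f p ≤ 2 ^ j then 2 * ((2 : ℝ) ^ j)⁻¹ else 0 := by
    intro p hp
    have h1 := hf p hp
    obtain ⟨j, hj1, hj2⟩ := exists_nat_pow_near (by linarith : (1 : ℝ) ≤ 2 * f p)
      (one_lt_two (α := ℝ))
    have hjJ : j < J + 1 :=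
      (pow_lt_pow_iff_right₀ (one_lt_two (α := ℝ))).mp ((hj1.trans (hfX p hp)).trans_lt hJ2)
    have hfj : f p ≤ 2 ^ j := by rw [pow_succ] at hj2; linarith
    have h2 := Finset.single_le_sum (f := fun j => if f p ≤ 2 ^ j then 2 * ((2 : ℝ) ^ j)⁻¹ else 0)
      (fun i _ => by split_ifs <;> positivity) (Finset.mem_range.mpr hjJ)
    simp only [if_pos hfj] at h2
    refine le_trans ?_ h2
    rw [← div_eq_mul_inv, inv_eq_one_div, div_le_div_iff₀ (by linarith) (by positivity)]
    linarith
  calc ∑ p ∈ L, (f p)⁻¹ ≤ ∑ p ∈ L, ∑ j ∈ Finset.range (J + 1),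
        (if f p ≤ 2 ^ j then 2 * ((2 : ℝ) ^ j)⁻¹ else 0) := Finset.sum_le_sum hpt
    _ = ∑ j ∈ Finset.range (J + 1),
        ((L.filter fun p => f p ≤ 2 ^ j).card : ℝ) * (2 * ((2 : ℝ) ^ j)⁻¹) := by
        rw [Finset.sum_comm]
        refine Finset.sum_congr rfl fun j _ => ?_
        rw [← Finset.sum_filter, Finset.sum_const, nsmul_eq_mul]
    _ ≤ ∑ j ∈ Finset.range (J + 1), 2 * C * (2 ^ j / κ + K * (3 / 4) ^ j) := by
        refine Finset.sum_le_sum fun j _ => ?_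
        refine (mul_le_mul_of_nonneg_right (h j) (by positivity)).trans (le_of_eq ?_)
        field_simp
    _ = 2 * C * ((∑ j ∈ Finset.range (J + 1), (2 : ℝ) ^ j) / κ +
        K * ∑ j ∈ Finset.range (J + 1), (3 / 4 : ℝ) ^ j) := by
        rw [← Finset.mul_sum, Finset.sum_add_distrib, Finset.sum_div, Finset.mul_sum]
    _ ≤ 2 * C * (2 * X / κ + 4 * K) := by
        refine mul_le_mul_of_nonneg_left (add_le_add ?_ ?_) (by positivity)
        · refine div_le_div_of_nonneg_right ?_ hκ.le
          rw [geom_sum_eq (by norm_num), pow_succ]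
          linarith
        · rw [mul_comm]
          refine mul_le_mul_of_nonneg_right ?_ hK
          rw [geom_sum_eq (by norm_num)]
          have : (0 : ℝ) ≤ (3 / 4) ^ (J + 1) := by positivity
          rw [div_le_iff_of_neg (by norm_num)]; linarith

/-- `∑_{p ∈ L_k} λ_{k,p}⁻¹ ≤ C k_F`, uniformly in `k`. -/
theorem sum_inv_lam_le (hkF : 1 ≤ kF) (hk : k ≠ 0) :
    ∑ p ∈ lune kF k, (lam k p)⁻¹ ≤ 800 * Real.pi * 14 * kF := by
  have hκ := one_le_len hk
  have hκ0 : 0 < len k := by linarith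
  have hκ2 := len_sq k
  have hpi := Real.pi_gt_three
  have hdot : ∀ p ∈ lune kF k, momDot k p ≤ len k * kF + len k ^ 2 ∧
      len k ^ 2 - len k * kF ≤ momDot k p := by
    intro p hp
    have h1 := momDot_sq_le k (p - (1 : ℤ) • k)
    rw [momDot_sub_zsmul, one_smul] at h1
    have h2 := sqLen_sub_le hp
    have h3 : (momDot k p - len k ^ 2) ^ 2 ≤ (len k * kF) ^ 2 := by
      rw [mul_pow, hκ2]; push_cast at h1; rw [one_mul] at h1
      exact h1.trans (mul_le_mul_of_nonneg_left h2 (sqLen_nonneg k))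
    have h4 := abs_le.mp (abs_le_of_sq_le_sq h3 (by positivity))
    constructor <;> linarith [h4.1, h4.2]
  -- For `|k| ≤ 3 k_F` one has `2λ ≤ 2|k| k_F + |k|² ≤ 5|k| k_F`, and `14 = 2·5 + 4`. For `|k| > 3
  -- k_F` every `λ` is at least `k_F²` and the ball count suffices.
  rcases le_or_gt (len k) (3 * kF) with hk3 | hk3
  · have := sum_inv_le_of_dyadic (lune kF k) (lam k) (C := 400 * Real.pi) (κ := len k) (K := kF)
      (X := 5 * len k * kF) (by positivity) hκ0 (by linarith) (fun p hp => half_le_lam hp)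
      (fun p hp => ?_) (by nlinarith) fun j => card_lune_dyadic_le hkF hk hk3 j
    · refine this.trans (le_of_eq ?_)
      field_simp; ring
    · rw [lam_eq]
      have := (hdot p hp).1
      nlinarith
  · have hlam : ∀ p ∈ lune kF k, (lam k p)⁻¹ ≤ (kF ^ 2)⁻¹ := by
      intro p hp
      refine inv_anti₀ (by positivity) ?_
      rw [lam_eq]
      have := (hdot p hp).2
      nlinarith
    calc ∑ p ∈ lune kF k, (lam k p)⁻¹ ≤ ∑ p ∈ lune kF k, (kF ^ 2)⁻¹ := Finset.sum_le_sum hlam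
      _ = ((lune kF k).card : ℝ) * (kF ^ 2)⁻¹ := by rw [Finset.sum_const, nsmul_eq_mul]
      _ ≤ (27 * kF ^ 3) * (kF ^ 2)⁻¹ := mul_le_mul_of_nonneg_right
          (le_trans (by exact_mod_cast card_lune_le_ball kF k) (card_fermiBall_le hkF))
          (by positivity)
      _ = 27 * kF := by field_simp
      _ ≤ 800 * Real.pi * 14 * kF := by nlinarith

end DirectedLune

/-! ### The time integral -/

section TimeIntegral

variable {s : ℕ} {V : Mom → ℝ} {kF : ℝ}

/-- The expectation of `2 Re` of the `l`-th exchange term, as a linear form in the matrix `b` of the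
operator on `ℓ²(L_k)`. -/
noncomputable def exchForm (s : ℕ) (V : Mom → ℝ) (kF : ℝ) (k l : Mom) (b : Mom → Mom → ℝ) : ℝ :=
  -(s : ℝ)⁻¹ * ∑ p ∈ lune kF k, ∑ q ∈ lune kF k, b q p *
        ((if p + q = k + l then matExt (KOp s V kF l) q p else 0) +
          if p + q = k - l then matExt (KOp s V kF l) (-p) (-q) else 0)

theorem exchForm_eq_zero {k : Mom} (b : Mom → Mom → ℝ) {l : MomStar}
    (hl : l ∉ (finite_support_exch2Term kF k).toFinset) : exchForm s V kF k l b = 0 := by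
  simp only [Set.Finite.mem_toFinset, Set.mem_ofPred_eq, not_exists, not_and, not_or] at hl
  unfold exchForm
  rw [Finset.sum_eq_zero, mul_zero]
  refine fun p hp => Finset.sum_eq_zero fun q _ => ?_
  rw [matExt_of_notMem _ fun h => (hl p hp).1 h.2, matExt_of_notMem _ fun h => (hl p hp).2 h.1]
  simp

theorem continuous_matExt_BOp (k p q : Mom) :
    Continuous fun t : ℝ => matExt (BOp s V kF k t) p q := by
  by_cases h : p ∈ lune kF k ∧ q ∈ lune kF k
  · simp only [matExt_of_mem _ h.1 h.2]
    exact continuous_BOp _ _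
  · simp only [matExt_of_notMem _ h]
    exact continuous_const

theorem continuous_exchForm_BOp (k l : Mom) :
    Continuous fun t : ℝ => exchForm s V kF k l (matExt (BOp s V kF k t)) := by
  unfold exchForm
  refine continuous_const.mul (continuous_finsetSum _ fun p _ =>
    continuous_finsetSum _ fun q _ => (continuous_matExt_BOp k q p).mul continuous_const)

theorem fermiExch2_eq_sum (hs : 1 ≤ s) (k : Mom) (B : LuneMat kF k) :
    fermiExch2 s V kF k B = ∑ l ∈ (finite_support_exch2Term kF k).toFinset,
      exchForm s V kF k l (matExt B) :=
  (fermiExch2_hasSum hs k B).unique (hasSum_sum_of_ne_finset_zero fun _ hl =>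
    exchForm_eq_zero (matExt B) hl)

theorem continuous_fermiExch2_BOp (hs : 1 ≤ s) (k : Mom) :
    Continuous fun t : ℝ => fermiExch2 s V kF k (BOp s V kF k t) := by
  simp only [fermiExch2_eq_sum hs]
  exact continuous_finsetSum _ fun l _ => continuous_exchForm_BOp k l

/-- The extended matrix of `∫₀¹ B_k(t) dt`. -/
noncomputable def timeKernel (s : ℕ) (V : Mom → ℝ) (kF : ℝ) (k p q : Mom) : ℝ :=
  ∫ t in (0 : ℝ)..1, matExt (BOp s V kF k t) p q

theorem integral_exchForm (k l : Mom) :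
    ∫ t in (0 : ℝ)..1, exchForm s V kF k l (matExt (BOp s V kF k t)) =
      exchForm s V kF k l (timeKernel s V kF k) := by
  unfold exchForm timeKernel
  rw [intervalIntegral.integral_const_mul, intervalIntegral.integral_finsetSum]
  · congr 1
    refine Finset.sum_congr rfl fun p _ => ?_
    rw [intervalIntegral.integral_finsetSum]
    · exact Finset.sum_congr rfl fun q _ => intervalIntegral.integral_mul_const _ _
    · exact fun q _ => ((continuous_matExt_BOp k q p).mul continuous_const).intervalIntegrable _ _
  · exact fun p _ => (continuous_finsetSum _ fun q _ =>
      (continuous_matExt_BOp k q p).mul continuous_const).intervalIntegrable _ _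

theorem hasSum_integral_fermiExch2 (hs : 1 ≤ s) (k : Mom) :
    HasSum (fun l : MomStar => exchForm s V kF k l (timeKernel s V kF k))
      (∫ t in (0 : ℝ)..1, fermiExch2 s V kF k (BOp s V kF k t)) := by
  simp only [fermiExch2_eq_sum hs]
  rw [intervalIntegral.integral_finsetSum]
  · simp only [integral_exchForm]
    exact hasSum_sum_of_ne_finset_zero fun _ hl => exchForm_eq_zero _ hl
  · exact fun l _ => (continuous_exchForm_BOp k l).intervalIntegrable _ _

theorem timeKernel_bound {k p q : Mom} (hV : 0 ≤ V k) (hkF : 0 ≤ kF) (hp : p ∈ lune kF k)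
    (hq : q ∈ lune kF k) : |timeKernel s V kF k p q - coupling s V kF k / 2| ≤
      8 * couplingRatio s V kF k * coupling s V kF k := by
  unfold timeKernel
  simp only [matExt_of_mem _ hp hq]
  exact integral_BOp_bound hV hkF _ _

end TimeIntegral

/-! ### Sums over exchange pairs -/

section ExchangePairs

variable {V : Mom → ℝ} {kF : ℝ}

/-- The pairs `p, q ∈ L_k ∩ L_l` with `p + q = k + l`. -/
noncomputable def exchPairs (kF : ℝ) (k l : Mom) : Finset (Mom × Mom) :=
  ((lune kF k ∩ lune kF l) ×ˢ (lune kF k ∩ lune kF l)).filter fun x => x.1 + x.2 = k + l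

theorem mem_exchPairs {k l : Mom} {x : Mom × Mom} : x ∈ exchPairs kF k l ↔
    (x.1 ∈ lune kF k ∧ x.1 ∈ lune kF l) ∧ (x.2 ∈ lune kF k ∧ x.2 ∈ lune kF l) ∧
      x.1 + x.2 = k + l := by
  simp [exchPairs, and_assoc]

theorem exchPairs_symm (kF : ℝ) (k l : Mom) : exchPairs kF k l = exchPairs kF l k := by
  ext x
  rw [mem_exchPairs, mem_exchPairs, add_comm k l]
  tauto

/-- `∑ δ_{p+q,k+l} / (λ_{k,p} + λ_{k,q})` over `p, q ∈ L_k ∩ L_l`. -/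
noncomputable def exchWeight (kF : ℝ) (k l : Mom) : ℝ :=
  ∑ x ∈ exchPairs kF k l, 1 / (lam k x.1 + lam k x.2)

theorem exchSummand_eq (V : Mom → ℝ) (kF : ℝ) (k l : Mom) :
    exchSummand V kF k l = V k * V l * exchWeight kF k l := by
  rw [exchSummand, exchWeight, exchPairs, Finset.sum_filter, Finset.sum_product]

/-- On exchange pairs the two excitation energies agree. -/
theorem lam_add_lam_eq {k l p q : Mom} (h : p + q = k + l) :
    lam k p + lam k q = lam l p + lam l q := by
  have h1 : q - k = -(p - l) := by
    have : q = k + l - p := by rw [← h]; abel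
    rw [this]; abel
  have h2 : q - l = -(p - k) := by
    have : q = k + l - p := by rw [← h]; abel
    rw [this]; abel
  unfold lam
  rw [h1, h2, sqLen_neg, sqLen_neg]
  ring

theorem exchWeight_symm (kF : ℝ) (k l : Mom) : exchWeight kF k l = exchWeight kF l k := by
  rw [exchWeight, exchWeight, exchPairs_symm kF l k]
  exact Finset.sum_congr rfl fun x hx => by
    rw [lam_add_lam_eq (mem_exchPairs.mp hx).2.2]

theorem one_le_lam_add {k l : Mom} {x : Mom × Mom} (hx : x ∈ exchPairs kF k l) :
    1 ≤ lam k x.1 + lam k x.2 := by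
  obtain ⟨h1, h2, -⟩ := mem_exchPairs.mp hx
  have := half_le_lam h1.1
  have := half_le_lam h2.1
  linarith

theorem exchWeight_nonneg (kF : ℝ) (k l : Mom) : 0 ≤ exchWeight kF k l :=
  Finset.sum_nonneg fun x hx => by
    have := one_le_lam_add hx
    positivity

/-- For fixed `k` the sets of exchange pairs are disjoint. -/
theorem sum_exchPairs_le (kF : ℝ) (k : Mom) (F : Finset MomStar) {φ : Mom × Mom → ℝ}
    (hφ : ∀ x ∈ lune kF k ×ˢ lune kF k, 0 ≤ φ x) :
    ∑ l ∈ F, ∑ x ∈ exchPairs kF k l, φ x ≤ ∑ x ∈ lune kF k ×ˢ lune kF k, φ x := by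
  rw [← Finset.sum_biUnion]
  · refine Finset.sum_le_sum_of_subset_of_nonneg ?_ fun x hx _ => hφ x hx
    intro x hx
    obtain ⟨l, -, hl⟩ := Finset.mem_biUnion.mp hx
    obtain ⟨h1, h2, -⟩ := mem_exchPairs.mp hl
    exact Finset.mem_product.mpr ⟨h1.1, h2.1⟩
  · intro l _ l' _ hne
    rw [Function.onFun, Finset.disjoint_left]
    intro x hx hx'
    have h1 := (mem_exchPairs.mp hx).2.2
    have h2 := (mem_exchPairs.mp hx').2.2
    exact hne (Subtype.ext (add_left_cancel (h1.symm.trans h2)))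

theorem sum_exchWeight_le (hkF : 1 ≤ kF) (k : Mom) (F : Finset MomStar) :
    ∑ l ∈ F, exchWeight kF k l ≤ (27 * kF ^ 3) ^ 2 := by
  have h1 : ∑ l ∈ F, exchWeight kF k l ≤ ∑ l ∈ F, ∑ x ∈ exchPairs kF k l, (1 : ℝ) :=
    Finset.sum_le_sum fun l _ => Finset.sum_le_sum fun x hx =>
      div_le_one_of_le₀ (one_le_lam_add hx) (by linarith [one_le_lam_add hx])
  refine h1.trans ((sum_exchPairs_le kF k F fun _ _ => zero_le_one).trans ?_)
  rw [Finset.sum_const, nsmul_one, Finset.card_product, Nat.cast_mul, ← sq]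
  exact pow_le_pow_left₀ (Nat.cast_nonneg _)
    (le_trans (by exact_mod_cast card_lune_le_ball kF k) (card_fermiBall_le hkF)) 2

/-- The constraint `p + q = k + l` determines `q` from `p ∈ L_l`. -/
theorem card_exchPairs_le (kF : ℝ) (k l : Mom) :
    (exchPairs kF k l).card ≤ (lune kF l).card := by
  refine Finset.card_le_card_of_injOn Prod.fst (fun x hx => (mem_exchPairs.mp hx).1.2) ?_
  intro x hx y hy hxy
  have h1 := (mem_exchPairs.mp hx).2.2
  have h2 := (mem_exchPairs.mp hy).2.2
  refine Prod.ext hxy (add_left_cancel (a := x.1) ?_)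
  rw [h1, hxy, h2]

/-- Cauchy–Schwarz over the pairs, with the lune count for `L_l` and `(λ + λ')² ≥ λ λ'`. The right
side factorizes once summed over all pairs of `L_k`. -/
theorem exchWeight_sq_le (hkF : 1 ≤ kF) {k : Mom} (l : Mom) :
    exchWeight kF k l ^ 2 ≤ 27 * kF ^ 2 * min (len l) kF *
      ∑ x ∈ exchPairs kF k l, (lam k x.1)⁻¹ * (lam k x.2)⁻¹ := by
  have h1 : exchWeight kF k l ^ 2 ≤ (exchPairs kF k l).card *
      ∑ x ∈ exchPairs kF k l, (1 / (lam k x.1 + lam k x.2)) ^ 2 :=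
    sq_sum_le_card_mul_sum_sq
  refine h1.trans (mul_le_mul ?_ (Finset.sum_le_sum fun x hx => ?_)
    (Finset.sum_nonneg fun _ _ => sq_nonneg _) ?_)
  · exact le_trans (by exact_mod_cast card_exchPairs_le kF k l) (card_lune_le hkF l)
  · obtain ⟨h2, h3, -⟩ := mem_exchPairs.mp hx
    have h4 := lam_pos h2.1
    have h5 := lam_pos h3.1
    rw [← mul_inv, div_pow, one_pow, ← one_div]
    refine one_div_le_one_div_of_le (mul_pos h4 h5) ?_
    nlinarith
  · exact le_trans (Nat.cast_nonneg _) (card_lune_le hkF l)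

/-- `∑_l V̂_l ∑_{p,q} δ_{p+q,k+l} / (λ_{k,p} + λ_{k,q}) ≤ C k_F² (∑_l V̂_l² min(|l|, k_F))^{1/2}`. -/
theorem sum_mul_exchWeight_le (hkF : 1 ≤ kF) {k : Mom} (hk : k ≠ 0) (F : Finset MomStar) :
    ∑ l ∈ F, V l * exchWeight kF k l ≤ 6 * (800 * Real.pi * 14) * kF ^ 2 *
      Real.sqrt (∑ l ∈ F, V l ^ 2 * min (len l) kF) := by
  have hm : ∀ l : MomStar, 0 < min (len l) kF := fun l =>
    lt_min (by linarith [one_le_len l.2]) (by linarith)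
  have hpi := Real.pi_pos
  -- The weight `min(|l|, k_F)` inserted in Cauchy–Schwarz cancels the one from the count of `L_l`.
  have h1 : ∑ l ∈ F, V l * exchWeight kF k l ≤
      Real.sqrt (∑ l ∈ F, (V l * Real.sqrt (min (len l) kF)) ^ 2) *
        Real.sqrt (∑ l ∈ F, (exchWeight kF k l / Real.sqrt (min (len l) kF)) ^ 2) := by
    refine le_trans (le_of_eq ?_) (Real.sum_mul_le_sqrt_mul_sqrt F _ _)
    refine Finset.sum_congr rfl fun l _ => ?_
    have := (Real.sqrt_pos.mpr (hm l)).ne'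
    field_simp
  have h2 : ∑ l ∈ F, (V l * Real.sqrt (min (len l) kF)) ^ 2 =
      ∑ l ∈ F, V l ^ 2 * min (len l) kF :=
    Finset.sum_congr rfl fun l _ => by rw [mul_pow, Real.sq_sqrt (hm l).le]
  have h3 : ∑ l ∈ F, (exchWeight kF k l / Real.sqrt (min (len l) kF)) ^ 2 ≤
      (6 * (800 * Real.pi * 14) * kF ^ 2) ^ 2 := by
    calc ∑ l ∈ F, (exchWeight kF k l / Real.sqrt (min (len l) kF)) ^ 2
        ≤ ∑ l ∈ F, 27 * kF ^ 2 * ∑ x ∈ exchPairs kF k l, (lam k x.1)⁻¹ * (lam k x.2)⁻¹ := by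
          refine Finset.sum_le_sum fun l _ => ?_
          rw [div_pow, Real.sq_sqrt (hm l).le, div_le_iff₀ (hm l)]
          refine (exchWeight_sq_le hkF (k := k) l).trans (le_of_eq (by ring))
      _ = 27 * kF ^ 2 * ∑ l ∈ F, ∑ x ∈ exchPairs kF k l, (lam k x.1)⁻¹ * (lam k x.2)⁻¹ := by
          rw [Finset.mul_sum]
      _ ≤ 27 * kF ^ 2 * ∑ x ∈ lune kF k ×ˢ lune kF k, (lam k x.1)⁻¹ * (lam k x.2)⁻¹ := by
          refine mul_le_mul_of_nonneg_left (sum_exchPairs_le kF k F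
            (φ := fun x => (lam k x.1)⁻¹ * (lam k x.2)⁻¹) fun x hx => ?_) (by positivity)
          obtain ⟨h4, h5⟩ := Finset.mem_product.mp hx
          have := lam_pos h4; have := lam_pos h5
          positivity
      _ = 27 * kF ^ 2 * (∑ p ∈ lune kF k, (lam k p)⁻¹) ^ 2 := by
          rw [sq (∑ p ∈ lune kF k, (lam k p)⁻¹), Finset.sum_mul_sum, Finset.sum_product]
      _ ≤ 27 * kF ^ 2 * (800 * Real.pi * 14 * kF) ^ 2 := by
          refine mul_le_mul_of_nonneg_left (pow_le_pow_left₀ (Finset.sum_nonneg fun p hp =>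
            (inv_pos.mpr (lam_pos hp)).le) (sum_inv_lam_le hkF hk) 2) (by positivity)
      -- `27` is rounded up to the perfect square `6²`.
      _ ≤ 36 * kF ^ 2 * (800 * Real.pi * 14 * kF) ^ 2 := by
          refine mul_le_mul_of_nonneg_right ?_ (sq_nonneg _)
          nlinarith
      _ = _ := by ring
  rw [h2] at h1
  refine h1.trans ?_
  rw [mul_comm]
  refine mul_le_mul_of_nonneg_right ?_ (Real.sqrt_nonneg _)
  rw [Real.sqrt_le_left (by positivity)]
  exact h3

/-- `V̂_k V̂_l ∑_{p,q} δ_{p+q,k+l} / (λ_{k,p} + λ_{k,q})` is summable. -/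
theorem summable_exchWeight (hkF : 1 ≤ kF) (hV0 : ∀ k : Mom, k ≠ 0 → 0 ≤ V k)
    (hV2 : Summable fun k : MomStar => V k ^ 2) :
    Summable fun kl : MomStar × MomStar => V kl.1 * V kl.2 * exchWeight kF kl.1 kl.2 := by
  -- For summability at fixed `k_F` a crude bound on the number of pairs is enough, together with
  -- `V̂_k V̂_l ≤ V̂_k² + V̂_l²` and the symmetry of the weight.
  have h1 : Summable fun kl : MomStar × MomStar => V kl.1 ^ 2 * exchWeight kF kl.1 kl.2 := by
    have hs : ∀ k : MomStar, Summable fun l : MomStar => exchWeight kF k l := fun k =>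
      summable_of_sum_le (fun l => exchWeight_nonneg _ _ _) fun F => sum_exchWeight_le hkF k F
    have hs2 : ∀ k : MomStar, Summable fun l : MomStar => V k ^ 2 * exchWeight kF k l := fun k =>
      (hs k).mul_left (V k ^ 2)
    have hs3 : Summable fun k : MomStar => ∑' l : MomStar, V k ^ 2 * exchWeight kF k l := by
      refine Summable.of_nonneg_of_le
        (fun k => tsum_nonneg fun l => mul_nonneg (sq_nonneg _) (exchWeight_nonneg _ _ _))
        (fun k => ?_) (hV2.mul_right ((27 * kF ^ 3) ^ 2))
      rw [tsum_mul_left]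
      exact mul_le_mul_of_nonneg_left
        ((hs k).tsum_le_of_sum_le fun F => sum_exchWeight_le hkF k F) (sq_nonneg _)
    exact (summable_prod_of_nonneg fun kl =>
      mul_nonneg (sq_nonneg _) (exchWeight_nonneg _ _ _)).mpr ⟨hs2, hs3⟩
  have h2 : Summable fun kl : MomStar × MomStar => V kl.2 ^ 2 * exchWeight kF kl.1 kl.2 := by
    refine (h1.comp_injective Prod.swap_injective).congr fun kl => ?_
    simp only [Function.comp, Prod.fst_swap, Prod.snd_swap]
    rw [exchWeight_symm]
  refine Summable.of_nonneg_of_le (fun kl => mul_nonneg (mul_nonneg (hV0 _ kl.1.2) (hV0 _ kl.2.2))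
    (exchWeight_nonneg _ _ _)) (fun kl => ?_) (h1.add h2)
  rw [← add_mul]
  refine mul_le_mul_of_nonneg_right ?_ (exchWeight_nonneg _ _ _)
  nlinarith [sq_nonneg (V kl.1 - V kl.2), sq_nonneg (V kl.1 + V kl.2)]

theorem summable_sq_mul_exchWeight (hkF : 1 ≤ kF) (hV0 : ∀ k : Mom, k ≠ 0 → 0 ≤ V k) {M : ℝ}
    (hV2 : HasSum (fun k : MomStar => V k ^ 2) M) :
    Summable fun kl : MomStar × MomStar => V kl.1 ^ 2 * V kl.2 * exchWeight kF kl.1 kl.2 := by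
  refine Summable.of_nonneg_of_le (fun kl => mul_nonneg (mul_nonneg (sq_nonneg _) (hV0 _ kl.2.2))
    (exchWeight_nonneg _ _ _)) (fun kl => ?_)
    ((summable_exchWeight hkF hV0 hV2.summable).mul_left (Real.sqrt M))
  have h1 : V kl.1 ≤ Real.sqrt M :=
    Real.le_sqrt_of_sq_le (le_hasSum hV2 kl.1 fun _ _ => sq_nonneg _)
  have h2 : 0 ≤ V kl.1 * V kl.2 * exchWeight kF kl.1 kl.2 :=
    mul_nonneg (mul_nonneg (hV0 _ kl.1.2) (hV0 _ kl.2.2)) (exchWeight_nonneg _ _ _)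
  nlinarith [mul_le_mul_of_nonneg_right h1 h2]

theorem tsum_sq_mul_exchWeight_le (hkF : 1 ≤ kF) (hV0 : ∀ k : Mom, k ≠ 0 → 0 ≤ V k) {M : ℝ}
    (hV2 : HasSum (fun k : MomStar => V k ^ 2) M) :
    ∑' kl : MomStar × MomStar, V kl.1 ^ 2 * V kl.2 * exchWeight kF kl.1 kl.2 ≤
      6 * (800 * Real.pi * 14) * kF ^ 2 * M *
        Real.sqrt (∑' l : MomStar, V l ^ 2 * min (len l) kF) := by
  have hkF0 : 0 ≤ kF := by linarith
  have hmin : ∀ l : MomStar, 0 ≤ V l ^ 2 * min (len l) kF := fun l =>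
    mul_nonneg (sq_nonneg _) (le_min (len_nonneg _) hkF0)
  have hX : Summable fun l : MomStar => V l ^ 2 * min (len l) kF :=
    Summable.of_nonneg_of_le hmin
      (fun l => mul_le_mul_of_nonneg_left (min_le_right _ _) (sq_nonneg _))
      (hV2.summable.mul_right kF)
  have hsum := summable_sq_mul_exchWeight hkF hV0 hV2
  rw [hsum.tsum_prod]
  have hbound : ∀ k : MomStar, ∑' l : MomStar, V k ^ 2 * V l * exchWeight kF k l ≤
      V k ^ 2 * (6 * (800 * Real.pi * 14) * kF ^ 2 *
        Real.sqrt (∑' l : MomStar, V l ^ 2 * min (len l) kF)) := by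
    intro k
    refine (hsum.prod_factor k).tsum_le_of_sum_le fun F => ?_
    simp only [mul_assoc (V k ^ 2)]
    rw [← Finset.mul_sum]
    refine mul_le_mul_of_nonneg_left ((sum_mul_exchWeight_le hkF k.2 F).trans ?_) (sq_nonneg _)
    refine mul_le_mul_of_nonneg_left (Real.sqrt_le_sqrt (hX.sum_le_tsum F fun l _ => hmin l)) ?_
    have := Real.pi_pos
    positivity
  refine (hsum.prod.tsum_le_tsum hbound (hV2.summable.mul_right _)).trans (le_of_eq ?_)
  rw [tsum_mul_right, hV2.tsum_eq]
  ring

end ExchangePairs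

/-! ### Comparison with the exchange energy -/

section Comparison

variable {s : ℕ} {V : Mom → ℝ} {kF : ℝ}

/-- Negation on the nonzero momenta. -/
def negStar : MomStar ≃ MomStar := (Equiv.neg Mom).subtypeEquiv fun k => by simp

/-- The contribution of the first Kronecker delta in the exchange correction. -/
noncomputable def directTerm (s : ℕ) (V : Mom → ℝ) (kF : ℝ) (k l : Mom) : ℝ :=
  (s : ℝ)⁻¹ * ∑ x ∈ exchPairs kF k l,
    timeKernel s V kF k x.2 x.1 * -matExt (KOp s V kF l) x.2 x.1

/-- The contribution of the second Kronecker delta in the exchange correction, with `l` replaced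
by `-l`. -/
noncomputable def flippedTerm (s : ℕ) (V : Mom → ℝ) (kF : ℝ) (k l : Mom) : ℝ :=
  (s : ℝ)⁻¹ * ∑ x ∈ exchPairs kF k l,
    timeKernel s V kF k x.2 x.1 * -matExt (KOp s V kF (-l)) (-x.1) (-x.2)

theorem neg_mem_lune_neg {l p : Mom} : -p ∈ lune kF (-l) ↔ p ∈ lune kF l := by
  rw [mem_lune_iff, mem_lune_iff, neg_mem_fermiBall, show -p - -l = -(p - l) by abel,
    neg_mem_fermiBall]

theorem sum_lune_eq_sum_exchPairs (k l : Mom) (b κ : Mom → Mom → ℝ)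
    (hκ : ∀ p q, ¬(p ∈ lune kF l ∧ q ∈ lune kF l) → κ q p = 0) :
    ∑ p ∈ lune kF k, ∑ q ∈ lune kF k, b q p * (if p + q = k + l then κ q p else 0) =
      ∑ x ∈ exchPairs kF k l, b x.2 x.1 * κ x.2 x.1 := by
  rw [← Finset.sum_product']
  symm
  refine Finset.sum_subset_zero_on_sdiff (fun x hx => ?_) (fun x hx => ?_) fun x hx => ?_
  · obtain ⟨h1, h2, -⟩ := mem_exchPairs.mp hx
    exact Finset.mem_product.mpr ⟨h1.1, h2.1⟩
  · obtain ⟨h1, h2⟩ := Finset.mem_sdiff.mp hx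
    obtain ⟨h3, h4⟩ := Finset.mem_product.mp h1
    by_cases h5 : x.1 + x.2 = k + l
    · rw [hκ, ite_self, mul_zero]
      exact fun h6 => h2 (mem_exchPairs.mpr ⟨⟨h3, h6.1⟩, ⟨h4, h6.2⟩, h5⟩)
    · rw [if_neg h5, mul_zero]
  · rw [if_pos (mem_exchPairs.mp hx).2.2]

/-- The condition `p + q = k - l` is the exchange condition for `(k, -l)`, and `-p ∈ L_l` is
equivalent to `p ∈ L_{-l}`. -/
theorem exchForm_timeKernel (k l : Mom) :
    exchForm s V kF k l (timeKernel s V kF k) =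
      directTerm s V kF k l + flippedTerm s V kF k (-l) := by
  have h1 := sum_lune_eq_sum_exchPairs (kF := kF) k l (timeKernel s V kF k)
    (fun q p => matExt (KOp s V kF l) q p) fun p q h => matExt_of_notMem _ fun h' => h h'.symm
  have h2 := sum_lune_eq_sum_exchPairs (kF := kF) k (-l) (timeKernel s V kF k)
    (fun q p => matExt (KOp s V kF l) (-p) (-q)) fun p q h => matExt_of_notMem _ fun h' => by
      have h3 := neg_mem_lune_neg (kF := kF) (l := -l) (p := p)
      have h4 := neg_mem_lune_neg (kF := kF) (l := -l) (p := q)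
      rw [neg_neg] at h3 h4
      exact h ⟨h3.mp h'.1, h4.mp h'.2⟩
  unfold exchForm directTerm flippedTerm
  rw [neg_neg]
  simp only [mul_neg, Finset.sum_neg_distrib]
  rw [← h1, ← h2]
  simp only [mul_add, Finset.sum_add_distrib, sub_eq_add_neg]
  ring

theorem lam_neg_neg (l p : Mom) : lam (-l) (-p) = lam l p := by
  rw [lam, lam, sqLen_neg, show -p - -l = -(p - l) by abel, sqLen_neg]

/-- Comparison of a sum over exchange pairs with its leading order. -/
theorem abs_sum_exchPairs_sub_le {k l : Mom} (hVk : 0 ≤ V k) (hVl : 0 ≤ V l) (hkF : 0 ≤ kF)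
    (κ : Mom × Mom → ℝ) {α : ℝ}
    (h : ∀ x ∈ exchPairs kF k l, 0 ≤ κ x ∧
      κ x ≤ coupling s V kF l / (lam k x.1 + lam k x.2) ∧
      |κ x - coupling s V kF l / (lam k x.1 + lam k x.2)| ≤
        4 * α * coupling s V kF l / (lam k x.1 + lam k x.2)) :
    |(s : ℝ)⁻¹ * ∑ x ∈ exchPairs kF k l, timeKernel s V kF k x.2 x.1 * κ x -
      (s : ℝ)⁻¹ * (coupling s V kF k * coupling s V kF l / 2) * exchWeight kF k l| ≤
      (s : ℝ)⁻¹ * (coupling s V kF k * coupling s V kF l *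
        (8 * couplingRatio s V kF k + 2 * α)) * exchWeight kF k l := by
  have hs0 : 0 ≤ (s : ℝ)⁻¹ := by positivity
  have hgk := coupling_nonneg s hVk hkF
  have hgl := coupling_nonneg s hVl hkF
  rw [mul_assoc (s : ℝ)⁻¹, mul_assoc (s : ℝ)⁻¹, ← mul_sub, abs_mul, abs_of_nonneg hs0]
  refine mul_le_mul_of_nonneg_left ?_ hs0
  rw [exchWeight, Finset.mul_sum, Finset.mul_sum, ← Finset.sum_sub_distrib]
  refine (Finset.abs_sum_le_sum_abs _ _).trans (Finset.sum_le_sum fun x hx => ?_)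
  obtain ⟨h1, h2, h3⟩ := h x hx
  obtain ⟨hx1, hx2, -⟩ := mem_exchPairs.mp hx
  have hβ := timeKernel_bound (s := s) hVk hkF hx2.1 hx1.1
  have hΛ := one_le_lam_add hx
  generalize lam k x.1 + lam k x.2 = Λ at *
  generalize timeKernel s V kF k x.2 x.1 = β at *
  generalize κ x = y at *
  generalize coupling s V kF k = g at *
  generalize coupling s V kF l = g' at *
  generalize couplingRatio s V kF k = ρ at *
  have e1 : β * y - g * g' / 2 * (1 / Λ) = (β - g / 2) * y + g / 2 * (y - g' / Λ) := by ring
  rw [e1]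
  refine (abs_add_le _ _).trans ?_
  rw [abs_mul, abs_mul, abs_of_nonneg h1, abs_of_nonneg (by linarith : 0 ≤ g / 2)]
  have e2 : |β - g / 2| * y ≤ (8 * ρ * g) * (g' / Λ) :=
    mul_le_mul hβ h2 h1 ((abs_nonneg _).trans hβ)
  have e3 : g / 2 * |y - g' / Λ| ≤ g / 2 * (4 * α * g' / Λ) :=
    mul_le_mul_of_nonneg_left h3 (by linarith)
  refine (add_le_add e2 e3).trans (le_of_eq ?_)
  ring

theorem directTerm_bound {k l : Mom} (hVk : 0 ≤ V k) (hVl : 0 ≤ V l) (hkF : 0 ≤ kF) :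
    |directTerm s V kF k l -
      (s : ℝ)⁻¹ * (coupling s V kF k * coupling s V kF l / 2) * exchWeight kF k l| ≤
      (s : ℝ)⁻¹ * (coupling s V kF k * coupling s V kF l *
        (8 * couplingRatio s V kF k + 2 * couplingRatio s V kF l)) * exchWeight kF k l := by
  refine abs_sum_exchPairs_sub_le hVk hVl hkF (fun x => -matExt (KOp s V kF l) x.2 x.1)
    fun x hx => ?_
  obtain ⟨h1, h2, h3⟩ := mem_exchPairs.mp hx
  rw [matExt_of_mem _ h2.2 h1.2, lam_add_lam_eq h3, add_comm (lam l x.1)]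
  exact (KOp_bounds (s := s) hVl hkF ⟨x.2, h2.2⟩ ⟨x.1, h1.2⟩).2

theorem flippedTerm_bound {k l : Mom} (hVk : 0 ≤ V k) (hVl : 0 ≤ V l) (hkF : 0 ≤ kF)
    (hV : V (-l) = V l) :
    |flippedTerm s V kF k l -
      (s : ℝ)⁻¹ * (coupling s V kF k * coupling s V kF l / 2) * exchWeight kF k l| ≤
      (s : ℝ)⁻¹ * (coupling s V kF k * coupling s V kF l *
        (8 * couplingRatio s V kF k + 2 * couplingRatio s V kF (-l))) * exchWeight kF k l := by
  refine abs_sum_exchPairs_sub_le hVk hVl hkF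
    (fun x => -matExt (KOp s V kF (-l)) (-x.1) (-x.2)) fun x hx => ?_
  obtain ⟨h1, h2, h3⟩ := mem_exchPairs.mp hx
  have m1 := neg_mem_lune_neg.mpr h1.2
  have m2 := neg_mem_lune_neg.mpr h2.2
  have hg : coupling s V kF l = coupling s V kF (-l) := by rw [coupling, coupling, hV]
  rw [matExt_of_mem _ m1 m2, lam_add_lam_eq h3, hg, ← lam_neg_neg l x.1, ← lam_neg_neg l x.2]
  exact (KOp_bounds (s := s) (hV ▸ hVl) hkF ⟨-x.1, m1⟩ ⟨-x.2, m2⟩).2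

/-- The factor `k_F` from the sum of inverse excitation energies cancels `k_F⁻¹` in the coupling. -/
theorem couplingRatio_le (s : ℕ) (hkF : 1 ≤ kF) {k : Mom} (hk : k ≠ 0) (hV : 0 ≤ V k) :
    couplingRatio s V kF k ≤ s * (800 * Real.pi * 14) / (2 * (2 * Real.pi) ^ 3) * V k := by
  have h1 := mul_le_mul_of_nonneg_left (sum_inv_lam_le hkF hk)
    (coupling_nonneg s hV (by linarith : 0 ≤ kF))
  refine h1.trans (le_of_eq ?_)
  have : kF ≠ 0 := by positivity
  unfold coupling
  field_simp

/-- The constant in the comparison of a single pair of momenta. -/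
noncomputable def comparisonConst (s : ℕ) : ℝ :=
  (s : ℝ)⁻¹ * (s / (2 * (2 * Real.pi) ^ 3)) ^ 2 *
    (8 * (s * (800 * Real.pi * 14) / (2 * (2 * Real.pi) ^ 3)))

theorem comparisonConst_nonneg (s : ℕ) : 0 ≤ comparisonConst s := by
  have := Real.pi_pos
  unfold comparisonConst; positivity

theorem error_le (hkF : 1 ≤ kF) {k l : Mom} (hk : k ≠ 0) (hVk : 0 ≤ V k) (hVl : 0 ≤ V l)
    {α : ℝ} (hα : α ≤ s * (800 * Real.pi * 14) / (2 * (2 * Real.pi) ^ 3) * V l) :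
    (s : ℝ)⁻¹ * (coupling s V kF k * coupling s V kF l *
        (8 * couplingRatio s V kF k + 2 * α)) * exchWeight kF k l ≤
      comparisonConst s * (kF ^ 2)⁻¹ * (V k ^ 2 * V l * exchWeight kF k l +
        V l ^ 2 * V k * exchWeight kF l k) := by
  have hkF0 : 0 ≤ kF := by linarith
  have h1 := couplingRatio_le s hkF hk hVk
  have hgk := coupling_nonneg s hVk hkF0
  have hgl := coupling_nonneg s hVl hkF0
  have hW := exchWeight_nonneg kF k l
  have hpi := Real.pi_pos
  rw [exchWeight_symm kF l k, ← add_mul, ← mul_assoc (comparisonConst s * (kF ^ 2)⁻¹)]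
  refine mul_le_mul_of_nonneg_right ?_ hW
  obtain ⟨c, hc⟩ : ∃ c, c = s * (800 * Real.pi * 14) / (2 * (2 * Real.pi) ^ 3) := ⟨_, rfl⟩
  have hc0 : 0 ≤ c := by rw [hc]; positivity
  rw [← hc] at h1 hα
  have e1 : 8 * couplingRatio s V kF k + 2 * α ≤ 8 * c * (V k + V l) := by
    nlinarith [mul_nonneg hc0 hVl]
  refine (mul_le_mul_of_nonneg_left (mul_le_mul_of_nonneg_left e1 (mul_nonneg hgk hgl))
    (by positivity : 0 ≤ (s : ℝ)⁻¹)).trans (le_of_eq ?_)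
  rw [comparisonConst, ← hc]
  unfold coupling
  ring

/-- The common leading order of `directTerm` and `flippedTerm`. -/
noncomputable def leadingTerm (s : ℕ) (V : Mom → ℝ) (kF : ℝ) (k l : Mom) : ℝ :=
  (s : ℝ)⁻¹ * (coupling s V kF k * coupling s V kF l / 2) * exchWeight kF k l

/-- The error term in the comparison of a single pair of momenta. -/
noncomputable def errorTerm (s : ℕ) (V : Mom → ℝ) (kF : ℝ) (k l : Mom) : ℝ :=
  comparisonConst s * (kF ^ 2)⁻¹ *
    (V k ^ 2 * V l * exchWeight kF k l + V l ^ 2 * V k * exchWeight kF l k)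

/-- The prefactor has `8` where the exchange energy has `4`: the direct and the flipped term
contribute one half each. -/
theorem leadingTerm_eq (hs : 1 ≤ s) (hkF : 1 ≤ kF) (k l : Mom) :
    leadingTerm s V kF k l =
      s * (kF ^ 2)⁻¹ / (8 * (2 * Real.pi) ^ 6) * exchSummand V kF k l := by
  have hs0 : (s : ℝ) ≠ 0 := by positivity
  have hpi := Real.pi_pos.ne'
  have hk0 : kF ≠ 0 := by positivity
  rw [exchSummand_eq, leadingTerm, coupling, coupling]
  field_simp
  ring

theorem summable_exchSummand (hkF : 1 ≤ kF) (hV0 : ∀ k : Mom, k ≠ 0 → 0 ≤ V k)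
    (hV2 : Summable fun k : MomStar => V k ^ 2) :
    Summable fun kl : MomStar × MomStar => exchSummand V kF kl.1 kl.2 :=
  (summable_exchWeight hkF hV0 hV2).congr fun kl => (exchSummand_eq V kF kl.1 kl.2).symm

theorem summable_leadingTerm (hs : 1 ≤ s) (hkF : 1 ≤ kF) (hV0 : ∀ k : Mom, k ≠ 0 → 0 ≤ V k)
    (hV2 : Summable fun k : MomStar => V k ^ 2) :
    Summable fun kl : MomStar × MomStar => leadingTerm s V kF kl.1 kl.2 :=
  ((summable_exchSummand hkF hV0 hV2).mul_left
    (s * (kF ^ 2)⁻¹ / (8 * (2 * Real.pi) ^ 6))).congr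
      fun kl => (leadingTerm_eq hs hkF kl.1 kl.2).symm

theorem summable_sq_mul_exchWeight_swap {M : ℝ} (hkF : 1 ≤ kF)
    (hV0 : ∀ k : Mom, k ≠ 0 → 0 ≤ V k) (hV2 : HasSum (fun k : MomStar => V k ^ 2) M) :
    Summable fun kl : MomStar × MomStar => V kl.2 ^ 2 * V kl.1 * exchWeight kF kl.2 kl.1 :=
  (Equiv.prodComm MomStar MomStar).summable_iff
    (f := fun kl : MomStar × MomStar => V kl.1 ^ 2 * V kl.2 * exchWeight kF kl.1 kl.2) |>.mpr
      (summable_sq_mul_exchWeight hkF hV0 hV2)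

theorem summable_errorTerm {M : ℝ} (hkF : 1 ≤ kF) (hV0 : ∀ k : Mom, k ≠ 0 → 0 ≤ V k)
    (hV2 : HasSum (fun k : MomStar => V k ^ 2) M) :
    Summable fun kl : MomStar × MomStar => errorTerm s V kF kl.1 kl.2 :=
  ((summable_sq_mul_exchWeight hkF hV0 hV2).add
    (summable_sq_mul_exchWeight_swap hkF hV0 hV2)).mul_left (comparisonConst s * (kF ^ 2)⁻¹)

theorem tsum_errorTerm_le {M : ℝ} (hkF : 1 ≤ kF) (hV0 : ∀ k : Mom, k ≠ 0 → 0 ≤ V k)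
    (hV2 : HasSum (fun k : MomStar => V k ^ 2) M) :
    ∑' kl : MomStar × MomStar, errorTerm s V kF kl.1 kl.2 ≤
      2 * comparisonConst s * (6 * (800 * Real.pi * 14)) * |M| *
        Real.sqrt (∑' k : MomStar, V k ^ 2 * min (len k) kF) := by
  have hG := tsum_sq_mul_exchWeight_le hkF hV0 hV2
  have hswap : ∑' kl : MomStar × MomStar, V kl.2 ^ 2 * V kl.1 * exchWeight kF kl.2 kl.1 =
      ∑' kl : MomStar × MomStar, V kl.1 ^ 2 * V kl.2 * exchWeight kF kl.1 kl.2 :=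
    (Equiv.prodComm MomStar MomStar).tsum_eq
      fun kl : MomStar × MomStar => V kl.1 ^ 2 * V kl.2 * exchWeight kF kl.1 kl.2
  have hsplit : ∑' kl : MomStar × MomStar, errorTerm s V kF kl.1 kl.2 =
      comparisonConst s * (kF ^ 2)⁻¹ *
        (∑' kl : MomStar × MomStar, V kl.1 ^ 2 * V kl.2 * exchWeight kF kl.1 kl.2 +
          ∑' kl : MomStar × MomStar, V kl.2 ^ 2 * V kl.1 * exchWeight kF kl.2 kl.1) := by
    rw [← (summable_sq_mul_exchWeight hkF hV0 hV2).tsum_add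
      (summable_sq_mul_exchWeight_swap hkF hV0 hV2)]
    exact tsum_mul_left
  rw [hsplit, hswap]
  have hD := comparisonConst_nonneg s
  generalize ∑' kl : MomStar × MomStar, V kl.1 ^ 2 * V kl.2 * exchWeight kF kl.1 kl.2 = G at hG
  have hX := Real.sqrt_nonneg (∑' k : MomStar, V k ^ 2 * min (len k) kF)
  generalize Real.sqrt (∑' k : MomStar, V k ^ 2 * min (len k) kF) = X at hG hX ⊢
  have hpi := Real.pi_pos
  calc comparisonConst s * (kF ^ 2)⁻¹ * (G + G)
      = 2 * comparisonConst s * (kF ^ 2)⁻¹ * G := by ring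
    _ ≤ 2 * comparisonConst s * (kF ^ 2)⁻¹ * (6 * (800 * Real.pi * 14) * kF ^ 2 * M * X) :=
        mul_le_mul_of_nonneg_left hG (by positivity)
    _ = 2 * comparisonConst s * (6 * (800 * Real.pi * 14)) * M * X := by field_simp
    _ ≤ 2 * comparisonConst s * (6 * (800 * Real.pi * 14)) * |M| * X :=
        mul_le_mul_of_nonneg_right (mul_le_mul_of_nonneg_left (le_abs_self M) (by positivity)) hX

theorem abs_directTerm_sub_le (hkF : 1 ≤ kF) (hV0 : ∀ k : Mom, k ≠ 0 → 0 ≤ V k) {k l : Mom}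
    (hk : k ≠ 0) (hl : l ≠ 0) :
    |directTerm s V kF k l - leadingTerm s V kF k l| ≤ errorTerm s V kF k l :=
  (directTerm_bound (hV0 k hk) (hV0 l hl) (by linarith)).trans
    (error_le hkF hk (hV0 k hk) (hV0 l hl) (couplingRatio_le s hkF hl (hV0 l hl)))

theorem abs_flippedTerm_sub_le (hkF : 1 ≤ kF) (hVneg : ∀ k : Mom, k ≠ 0 → V (-k) = V k)
    (hV0 : ∀ k : Mom, k ≠ 0 → 0 ≤ V k) {k l : Mom} (hk : k ≠ 0) (hl : l ≠ 0) :
    |flippedTerm s V kF k l - leadingTerm s V kF k l| ≤ errorTerm s V kF k l := by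
  have hn : -l ≠ 0 := neg_ne_zero.mpr hl
  refine (flippedTerm_bound (hV0 k hk) (hV0 l hl) (by linarith) (hVneg l hl)).trans
    (error_le hkF hk (hV0 k hk) (hV0 l hl) ?_)
  have := couplingRatio_le s hkF hn (hV0 _ hn)
  rwa [hVneg l hl] at this

theorem summable_of_abs_sub_le {ι : Type*} {f g e : ι → ℝ} (he : Summable e) (hg : Summable g)
    (h : ∀ i, |f i - g i| ≤ e i) : Summable f :=
  ((Summable.of_norm_bounded (f := fun i => f i - g i) he h).add hg).congr
    fun _ => sub_add_cancel _ _

/-- The time integral of the exchange term, as a sum over the second momentum. -/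
theorem integral_fermiExch2_eq_tsum (hs : 1 ≤ s)
    (hdir : Summable fun kl : MomStar × MomStar => directTerm s V kF kl.1 kl.2)
    (hflip : Summable fun kl : MomStar × MomStar => flippedTerm s V kF kl.1 kl.2) (k : MomStar) :
    ∫ t in (0 : ℝ)..1, fermiExch2 s V kF k (BOp s V kF k t) =
      ∑' l : MomStar, (directTerm s V kF k l + flippedTerm s V kF k l) := by
  have h1 := hasSum_integral_fermiExch2 (V := V) (kF := kF) hs k
  simp only [exchForm_timeKernel] at h1
  have h2 : HasSum (fun l : MomStar => directTerm s V kF k l) _ := (hdir.prod_factor k).hasSum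
  have h3 : HasSum (fun l : MomStar => flippedTerm s V kF k l) _ := (hflip.prod_factor k).hasSum
  -- The flipped term occurs at `-l`, and summing over all `l` absorbs the reflection.
  have h4 := negStar.hasSum_iff.mpr h3
  rw [(h2.add h3).tsum_eq]
  exact h1.unique (h2.add h4)

theorem exchangeEnergy_eq_tsum (hs : 1 ≤ s) (hkF : 1 ≤ kF) :
    exchangeEnergy s V kF = ∑' kl : MomStar × MomStar, 2 * leadingTerm s V kF kl.1 kl.2 := by
  rw [exchangeEnergy, ← tsum_mul_left]
  refine tsum_congr fun kl => ?_
  rw [leadingTerm_eq hs hkF]; ring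

theorem abs_tsum_sub_le_of_abs_sub_le {ι : Type*} {f g h e : ι → ℝ} (he : Summable e)
    (hh : Summable h) (hf : ∀ i, |f i - h i| ≤ e i) (hg : ∀ i, |g i - h i| ≤ e i) :
    |∑' i, (f i + g i) - ∑' i, 2 * h i| ≤ 2 * ∑' i, e i := by
  have hfg := (summable_of_abs_sub_le he hh hf).add (summable_of_abs_sub_le he hh hg)
  rw [← hfg.tsum_sub (hh.mul_left 2), ← tsum_mul_left, ← Real.norm_eq_abs]
  refine tsum_of_norm_bounded (he.mul_left 2).hasSum fun i => ?_
  have h1 := abs_le.mp (hf i)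
  have h2 := abs_le.mp (hg i)
  rw [Real.norm_eq_abs, abs_le]
  constructor <;> linarith [h1.1, h1.2, h2.1, h2.2]

end Comparison

end FermiGas

theorem mainTheorem8 (s : ℕ) (hs : 1 ≤ s) (M : ℝ) :
    ∃ C : ℝ, 0 < C ∧
      ∀ V : FermiGas.Mom → ℝ,
        (∀ k : FermiGas.Mom, k ≠ 0 → V (-k) = V k) →
        (∀ k : FermiGas.Mom, k ≠ 0 → 0 ≤ V k) →
        HasSum (fun k : FermiGas.MomStar => V k ^ 2) M →
        ∀ kF : ℝ, 1 ≤ kF →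
          (∀ (k : FermiGas.MomStar), ∀ t ∈ Set.Icc (0 : ℝ) 1,
            Summable fun l : FermiGas.MomStar =>
              FermiGas.exch2Term s V kF k (FermiGas.BOp s V kF k t) l
                (FermiGas.fermiState s kF)) ∧
          (∀ k : FermiGas.MomStar, IntervalIntegrable
            (fun t : ℝ => FermiGas.fermiExch2 s V kF k (FermiGas.BOp s V kF k t))
            MeasureTheory.volume 0 1) ∧
          (Summable fun k : FermiGas.MomStar =>
            ∫ t in (0 : ℝ)..1, FermiGas.fermiExch2 s V kF k (FermiGas.BOp s V kF k t)) ∧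
          (Summable fun kl : FermiGas.MomStar × FermiGas.MomStar =>
            FermiGas.exchSummand V kF kl.1 kl.2) ∧
          |(∑' k : FermiGas.MomStar,
              ∫ t in (0 : ℝ)..1, FermiGas.fermiExch2 s V kF k (FermiGas.BOp s V kF k t)) -
            FermiGas.exchangeEnergy s V kF| ≤
            C * Real.sqrt (∑' k : FermiGas.MomStar, V k ^ 2 * min (FermiGas.len k) kF) := by
  -- The factor `4` counts direct and flipped terms and the two symmetric halves of the error. The
  -- modulus and the added `1` make the constant positive for every real `M`, chosen before the
  -- potential.
  refine ⟨4 * FermiGas.comparisonConst s * (6 * (800 * Real.pi * 14)) * |M| + 1, ?_, ?_⟩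
  · have := Real.pi_pos
    have := FermiGas.comparisonConst_nonneg s
    positivity
  intro V hVneg hV0 hV2 kF hkF
  have herr := FermiGas.summable_errorTerm (s := s) hkF hV0 hV2
  have hlead := FermiGas.summable_leadingTerm hs hkF hV0 hV2.summable
  have hdir : ∀ kl : FermiGas.MomStar × FermiGas.MomStar, _ :=
    fun kl => FermiGas.abs_directTerm_sub_le (s := s) hkF hV0 kl.1.2 kl.2.2
  have hflip : ∀ kl : FermiGas.MomStar × FermiGas.MomStar, _ :=
    fun kl => FermiGas.abs_flippedTerm_sub_le (s := s) hkF hVneg hV0 kl.1.2 kl.2.2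
  have hsdir := FermiGas.summable_of_abs_sub_le herr hlead hdir
  have hsflip := FermiGas.summable_of_abs_sub_le herr hlead hflip
  have hsum := hsdir.add hsflip
  have hI := FermiGas.integral_fermiExch2_eq_tsum hs hsdir hsflip
  refine ⟨fun k t _ => FermiGas.summable_exch2Term _ _,
    fun k => (FermiGas.continuous_fermiExch2_BOp hs k).intervalIntegrable _ _, ?_,
    FermiGas.summable_exchSummand hkF hV0 hV2.summable, ?_⟩
  · simp only [hI]
    exact hsum.prod
  simp only [hI]
  rw [← hsum.tsum_prod, FermiGas.exchangeEnergy_eq_tsum hs hkF]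
  refine (FermiGas.abs_tsum_sub_le_of_abs_sub_le herr hlead hdir hflip).trans ?_
  have hX := Real.sqrt_nonneg (∑' k : FermiGas.MomStar, V k ^ 2 * min (FermiGas.len k) kF)
  linarith [FermiGas.tsum_errorTerm_le (s := s) hkF hV0 hV2]
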